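/- Let $\mathbf{k}$ be a field containing $\mathbb{Q}$, let $n\ge 0$ and $m$ be integers, and let $A=\mathbf{k}[x]/(x^{n+1})$ be the graded algebra (zero differential) with generator $x$ of cohomological degree $2m$, i.e. of lower degree $-2m$. Let $HH^*(A;A)$ be the cohomology of the normalized Hochschild cochain complex $\mathrm{Hom}(T(s\bar A),A)$, $\bar A=A/\mathbf{k}$, with differential $$(\beta f)(a_1,\dots,a_{p+1})=a_1f(a_2,\dots,a_{p+1})+\sum_{j=1}^{p}(-1)^jf(\dots,a_ja_{j+1},\dots)+(-1)^{p+1}f(a_1,\dots,a_p)a_{p+1},$$ with the cup product $(f\cup g)(a_1,\dots,a_{p+q})=f(a_1,\dots,a_p)\,g(a_{p+1},\dots,a_{p+q})$, graded by the total (lower) degree, where $|sa|=|a|+1$. Let $\Delta$ be the operator of degree $+1$ on $HH^*(A;A)$ induced by the following operator on cochains. For $f$ of $p+1$ arguments, $$(\Delta f)(a_1,\dots,a_p)=\sum_{j=0}^{n}(-1)^{p+1}\sum_{i=0}^{p}(-1)^{i(p+1-i)}\langle 1,f(a_i,\dots,a_p,a_0,a_1,\dots,a_{i-1})\rangle\,x^{n-j},\qquad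 a_0=x^j,$$ where the summand $i=0$ is $\langle 1,f(a_0,a_1,\dots,a_p)\rangle$ and $\langle a,c\rangle$ is the coefficient of $x^n$ in $ac$. Then $HH^*(A;A)$ with the cup product and $\Delta$ is a Batalin--Vilkovisky algebra: it is a graded commutative graded algebra, $\Delta$ has degree $+1$, $\Delta^2=0$, and for homogeneous $a,b,c$ $$\Delta(abc)=\Delta(ab)c+(-1)^{|a|}a\Delta(bc)+(-1)^{(|a|-1)|b|}b\Delta(ac)-\Delta(a)bc-(-1)^{|a|}a\Delta(b)c-(-1)^{|a|+|b|}ab\Delta(c).$$ Moreover there is an isomorphism of graded $\mathbf{k}$-algebras $$HH^*(A;A)\cong \mathbf{k}[x,u,t]/(x^{n+1},\,u^2,\,x^nt,\,ux^n),\qquad |x|=-2m,\quad |u|=-1,\quad |t|=2mn+2(m-1),$$ under which, for all integers $k,l\ge 0$, $$\Delta(t^kx^l)=0,\qquad \Delta(t^kux^l)=\bigl(-(k+1)n-k+l\bigr)\,t^kx^l .$$ -/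

import Mathlib

/-!
# Hochschild cohomology of an evenly graded commutative algebra

Let `A` be a commutative `k`-algebra whose grading is concentrated in even degrees, with zero
differential.  A Hochschild cochain with values in `A` is an element of `Hom(T(s Ā), A)`,
`Ā = A / k · 1`; it is recorded by its values `f [a₁, …, aₚ]` on words in `A`.  As every element
of `A` has even degree, every suspended element `s a` is odd, so the Koszul sign of moving a word
of length `p` past a word of length `q` is `(-1) ^ (p * q)`, and the total degree of a cochain
defined on words of length `p` has the parity of `p`.
-/

namespace Hochschild

open Finset

/-- Arbitrary functions from words in `A` to `A`. -/
def WordFun (A : Type*) : Type _ := List A → A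

section WordFun

variable {A : Type*} [CommRing A]

instance : AddCommGroup (WordFun A) := inferInstanceAs (AddCommGroup (List A → A))

instance {k : Type*} [CommRing k] [Algebra k A] : Module k (WordFun A) :=
  inferInstanceAs (Module k (List A → A))

/-- The cup product
`(f ∪ g)[a₁, …, aₚ] = ∑ᵢ f[a₁, …, aᵢ] * g[aᵢ₊₁, …, aₚ]`. -/
def cup (f g : WordFun A) : WordFun A := fun l =>
  ∑ i ∈ range (l.length + 1), f (l.take i) * g (l.drop i)

/-- The unit of the cup product: the constant `1` on the empty word. -/
def cupOne : WordFun A := fun l => match l with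
  | [] => 1
  | _ :: _ => 0

/-- `mergeAt j [a₀, …, aₚ] = [a₀, …, aⱼ * aⱼ₊₁, …, aₚ]` for `j < p`. -/
def mergeAt : ℕ → List A → List A
  | 0, a :: b :: l => (a * b) :: l
  | j + 1, a :: l => a :: mergeAt j l
  | _, l => l

/-- The Hochschild differential
`(β f)[a₁, …, aₚ₊₁] = a₁ f[a₂, …, aₚ₊₁] + ∑_{j=1}^{p} (-1)^j f[a₁, …, aⱼ aⱼ₊₁, …, aₚ₊₁]
  + (-1)^(p+1) f[a₁, …, aₚ] aₚ₊₁`. -/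
def betaFun (f : WordFun A) : WordFun A := fun l => match l with
  | [] => 0
  | a :: w =>
      a * f w
      + ∑ j ∈ range w.length, (-1) ^ (j + 1) * f (mergeAt j (a :: w))
      + (-1) ^ (w.length + 1) * (f (a :: w).dropLast * (a :: w).getLast (List.cons_ne_nil a w))

theorem wadd (f g : WordFun A) (l : List A) : (f + g) l = f l + g l := rfl
theorem wneg (f : WordFun A) (l : List A) : (-f) l = -f l := rfl
theorem wsub (f g : WordFun A) (l : List A) : (f - g) l = f l - g l := rfl
theorem wzero (l : List A) : (0 : WordFun A) l = 0 := rfl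
theorem wsmul {k : Type*} [CommRing k] [Algebra k A] (c : k) (f : WordFun A) (l : List A) :
    (c • f) l = c • f l := rfl

/-- `f` with a fixed first letter. -/
def pre (a : A) (f : WordFun A) : WordFun A := fun l => f (a :: l)

theorem cup_nil (f g : WordFun A) : cup f g [] = f [] * g [] := by simp [cup]

theorem cup_cons (f g : WordFun A) (a : A) (l : List A) :
    cup f g (a :: l) = f [] * g (a :: l) + cup (pre a f) g l := by
  simp only [cup, List.length_cons]
  rw [sum_range_succ']
  simp [pre, add_comm]

theorem cup_add_left (f f' g : WordFun A) : cup (f + f') g = cup f g + cup f' g := by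
  funext l
  simp [cup, wadd, add_mul, sum_add_distrib]

theorem cup_add_right (f g g' : WordFun A) : cup f (g + g') = cup f g + cup f g' := by
  funext l
  simp [cup, wadd, mul_add, sum_add_distrib]

theorem cup_smul_left {k : Type*} [CommRing k] [Algebra k A] (c : k) (f g : WordFun A) :
    cup (c • f) g = c • cup f g := by
  funext l
  simp [cup, wsmul, smul_sum]

theorem cup_smul_right {k : Type*} [CommRing k] [Algebra k A] (c : k) (f g : WordFun A) :
    cup f (c • g) = c • cup f g := by
  funext l
  simp [cup, wsmul, smul_sum]

theorem cup_assoc (f g h : WordFun A) : cup (cup f g) h = cup f (cup g h) := by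
  funext l
  induction l generalizing f with
  | nil => simp [cup_nil, mul_assoc]
  | cons a l ih =>
    have e : pre a (cup f g) = f [] • pre a g + cup (pre a f) g := by
      funext w
      simp [pre, cup_cons, wadd, wsmul]
    rw [cup_cons, e, cup_add_left, wadd, ih, cup_smul_left, wsmul, cup_nil, cup_cons, cup_cons]
    simp only [smul_eq_mul]
    ring

theorem zero_cup (g : WordFun A) : cup 0 g = 0 := by
  funext l
  simp [cup, wzero]

theorem cup_zero (g : WordFun A) : cup g 0 = 0 := by
  funext l
  simp [cup, wzero]

theorem cupOne_cup (g : WordFun A) : cup cupOne g = g := by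
  funext l
  cases l with
  | nil => simp [cup_nil, cupOne]
  | cons a l =>
    have : pre a (cupOne : WordFun A) = 0 := rfl
    rw [cup_cons, this, zero_cup]
    simp [cupOne, wzero]

theorem cup_cupOne (g : WordFun A) : cup g cupOne = g := by
  funext l
  induction l generalizing g with
  | nil => simp [cup_nil, cupOne]
  | cons a l ih =>
    rw [cup_cons, ih]
    simp [cupOne, pre]

instance : Ring (WordFun A) :=
  { (inferInstance : AddCommGroup (WordFun A)) with
    mul := cup
    one := cupOne
    mul_assoc := cup_assoc
    one_mul := cupOne_cup
    mul_one := cup_cupOne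
    left_distrib := cup_add_right
    right_distrib := fun f f' g => cup_add_left f f' g
    zero_mul := zero_cup
    mul_zero := cup_zero }

instance {k : Type*} [CommRing k] [Algebra k A] : Algebra k (WordFun A) :=
  Algebra.ofModule (fun c f g => cup_smul_left c f g) (fun c f g => cup_smul_right c f g)

theorem wmul_nil (f g : WordFun A) : (f * g) [] = f [] * g [] := cup_nil f g
theorem wmul_cons (f g : WordFun A) (a : A) (l : List A) :
    (f * g) (a :: l) = f [] * g (a :: l) + (pre a f * g) l := cup_cons f g a l
theorem wone_nil : (1 : WordFun A) [] = 1 := rfl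
theorem wone_cons (a : A) (l : List A) : (1 : WordFun A) (a :: l) = 0 := rfl

/-- Auxiliary: the sign `(-1) ^ length`. -/
def sg (f : WordFun A) : WordFun A := fun l => (-1) ^ l.length * f l

/-- Auxiliary: the identity of `A`, as a function on one-letter words. -/
def iota : WordFun A := fun l => match l with
  | [a] => a
  | _ => 0

/-- Auxiliary: the inner part of the Hochschild differential. -/
def del (f : WordFun A) : WordFun A := fun l =>
  ∑ j ∈ range (l.length - 1), (-1) ^ (j + 1) * f (mergeAt j l)

/-- Auxiliary: multiply the first letter by `a`. -/
def mrg (a : A) (f : WordFun A) : WordFun A := fun l => match l with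
  | [] => 0
  | b :: l => f ((a * b) :: l)

theorem del_nil (f : WordFun A) : del f [] = 0 := by simp [del]
theorem del_single (f : WordFun A) (a : A) : del f [a] = 0 := by simp [del]
theorem del_cons_cons (f : WordFun A) (a b : A) (l : List A) :
    del f (a :: b :: l) = -f ((a * b) :: l) - del (pre a f) (b :: l) := by
  simp only [del, List.length_cons, Nat.add_sub_cancel]
  rw [sum_range_succ', sub_eq_add_neg, ← sum_neg_distrib, add_comm]
  simp [mergeAt, pre, pow_succ]

theorem pre_add (a : A) (f g : WordFun A) : pre a (f + g) = pre a f + pre a g := rfl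
theorem mrg_add (a : A) (f g : WordFun A) : mrg a (f + g) = mrg a f + mrg a g := by
  funext l; cases l <;> simp [mrg, wadd]

theorem del_add (f g : WordFun A) : del (f + g) = del f + del g := by
  funext l
  simp [del, wadd, mul_add, sum_add_distrib]

theorem del_smul {k : Type*} [CommRing k] [Algebra k A] (c : k) (f : WordFun A) :
    del (c • f) = c • del f := by
  funext l
  simp [del, wsmul, smul_sum]

theorem del_neg (f : WordFun A) : del (-f) = -del f := by
  funext l
  simp [del, wneg]

theorem del_sub (f g : WordFun A) : del (f - g) = del f - del g := by
  rw [sub_eq_add_neg, del_add, del_neg, sub_eq_add_neg]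

theorem pre_del (a : A) (f : WordFun A) : pre a (del f) = -mrg a f - del (pre a f) := by
  funext l
  cases l with
  | nil => simp [pre, del_single, wsub, wneg, mrg, del_nil]
  | cons b l => simp [pre, del_cons_cons, wsub, wneg, mrg]

theorem del_cons (f : WordFun A) (a : A) (l : List A) :
    del f (a :: l) = -mrg a f l - del (pre a f) l := congrFun (pre_del a f) l

theorem del_mrg (a b : A) (f : WordFun A) (l : List A) :
    del (mrg a f) (b :: l) = del f ((a * b) :: l) := by
  cases l with
  | nil => simp [del_single]
  | cons c l =>
    rw [del_cons_cons, del_cons_cons]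
    simp [mrg, mul_assoc]
    rfl

theorem del_del (f : WordFun A) : del (del f) = 0 := by
  funext l
  induction l generalizing f with
  | nil => simp [del_nil, wzero]
  | cons a l ih =>
    rw [del_cons, pre_del, del_sub, wsub, ih, del_neg, wneg, wzero]
    cases l with
    | nil => simp [mrg, del_nil, wzero]
    | cons b l => rw [del_mrg]; simp [mrg, wzero]

theorem sg_add (f g : WordFun A) : sg (f + g) = sg f + sg g := by
  funext l; simp [sg, wadd, mul_add]
theorem sg_smul {k : Type*} [CommRing k] [Algebra k A] (c : k) (f : WordFun A) :
    sg (c • f) = c • sg f := by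
  funext l; simp [sg, wsmul]
theorem sg_neg (f : WordFun A) : sg (-f) = -sg f := by
  funext l; simp [sg, wneg]
theorem sg_sub (f g : WordFun A) : sg (f - g) = sg f - sg g := by
  rw [sub_eq_add_neg, sg_add, sg_neg, sub_eq_add_neg]
theorem sg_sg (f : WordFun A) : sg (sg f) = f := by
  funext l
  simp only [sg]
  rw [← mul_assoc, ← pow_add, ← two_mul, pow_mul]
  simp
theorem pre_sg (a : A) (f : WordFun A) : pre a (sg f) = -sg (pre a f) := by
  funext l
  simp [pre, sg, wneg, pow_succ]
theorem sg_iota : sg (iota : WordFun A) = -iota := by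
  funext l
  match l with
  | [] => simp [sg, iota, wneg]
  | [a] => simp [sg, iota, wneg]
  | a :: b :: l => simp [sg, iota, wneg]

theorem sg_mul (f g : WordFun A) : sg (f * g) = sg f * sg g := by
  funext l
  induction l generalizing f with
  | nil => simp [sg, wmul_nil]
  | cons a l ih =>
    have h := ih (pre a f)
    simp only [sg] at h
    rw [wmul_cons, pre_sg, neg_mul, wneg, ← h]
    simp only [sg, wmul_cons, List.length_cons, List.length_nil]
    ring

theorem del_sg (f : WordFun A) : del (sg f) = -sg (del f) := by
  funext l
  induction l generalizing f with
  | nil => simp [sg, del_nil, wneg]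
  | cons a l ih =>
    have h := ih (pre a f)
    simp only [wneg, sg] at h
    rw [del_cons, pre_sg, del_neg, wneg, h]
    simp only [wneg, sg, del_cons, List.length_cons]
    cases l with
    | nil => simp [mrg, del_nil]
    | cons b l => simp only [mrg, sg, List.length_cons]; ring

theorem del_iota : del (iota : WordFun A) = -(iota * iota) := by
  funext l
  match l with
  | [] => simp [del_nil, wneg, wmul_nil, iota]
  | [a] => simp [del_single, wneg, wmul_nil, wmul_cons, iota]
  | [a, b] => simp [del_cons_cons, del_single, wneg, wmul_nil, wmul_cons, iota, pre]
  | a :: b :: c :: l =>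
    have e1 : pre a (iota : WordFun A) = a • 1 := by
      funext w; cases w <;> simp [pre, iota, wsmul, wone_nil, wone_cons]
    have e2 : del (1 : WordFun A) (b :: c :: l) = 0 := by
      rw [del_cons_cons, show pre b (1 : WordFun A) = 0 from rfl]
      simp [wone_cons, del, wzero]
    rw [del_cons_cons, wneg, wmul_cons, e1, del_smul, wsmul, e2, smul_mul_assoc, one_mul, wsmul]
    simp [iota]

theorem pre_mul (a : A) (f g : WordFun A) : pre a (f * g) = f [] • pre a g + pre a f * g := by
  funext l
  simp [pre, wmul_cons, wadd, wsmul]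

theorem mrg_mul (a : A) (f g : WordFun A) (l : List A) :
    mrg a (f * g) l = f [] * mrg a g l + (mrg a f * g) l := by
  cases l with
  | nil => simp [mrg, wmul_nil]
  | cons b l =>
    simp only [mrg, wmul_cons]
    have : pre b (mrg a f) = pre (a * b) f := rfl
    rw [this]; ring

theorem del_mul (f g : WordFun A) : del (f * g) = del f * g + sg f * del g := by
  funext l
  induction l generalizing f with
  | nil => simp [wmul_nil, wadd, del_nil]
  | cons a l ih =>
    rw [del_cons, pre_mul, del_add, wadd, ih, mrg_mul, wadd, wadd, del_smul, wsmul, wmul_cons,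
      wmul_cons, pre_del, pre_sg, del_nil, sub_mul, neg_mul, neg_mul, wsub, wneg, wneg, del_cons]
    simp only [sg, List.length_nil, smul_eq_mul]
    ring

theorem mul_iota_cons (f : WordFun A) (a : A) (w : List A) :
    (f * (iota : WordFun A)) (a :: w) = f (a :: w).dropLast * (a :: w).getLast (List.cons_ne_nil a w) := by
  induction w generalizing f a with
  | nil => simp [wmul_cons, wmul_nil, iota]
  | cons b w ih =>
    rw [wmul_cons, ih]
    simp [iota, pre]

theorem betaFun_eq (f : WordFun A) : betaFun f = iota * f + del f - sg f * iota := by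
  funext l
  cases l with
  | nil => simp [betaFun, wsub, wadd, wmul_nil, iota, del_nil]
  | cons a w =>
    have e1 : pre a (iota : WordFun A) = a • 1 := by
      funext w; cases w <;> simp [pre, iota, wsmul, wone_nil, wone_cons]
    rw [wsub, wadd, mul_iota_cons, wmul_cons, e1, smul_mul_assoc, one_mul, wsmul]
    simp only [betaFun, del, sg, iota, List.length_cons, List.length_dropLast,
      Nat.add_sub_cancel, smul_eq_mul, zero_mul, zero_add]
    ring

theorem betaFun_add (f g : WordFun A) : betaFun (f + g) = betaFun f + betaFun g := by
  simp only [betaFun_eq, del_add, sg_add]; noncomm_ring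

theorem betaFun_smul {k : Type*} [CommRing k] [Algebra k A] (c : k) (f : WordFun A) :
    betaFun (c • f) = c • betaFun f := by
  simp only [betaFun_eq, del_smul, sg_smul, mul_smul_comm, smul_mul_assoc, smul_add, smul_sub]

theorem betaFun_betaFun (f : WordFun A) : betaFun (betaFun f) = 0 := by
  simp only [betaFun_eq, del_add, del_sub, sg_add, sg_sub, sg_mul, del_mul, del_del, del_sg,
    sg_iota, sg_sg, del_iota]
  noncomm_ring

theorem betaFun_mul (f g : WordFun A) :
    betaFun (f * g) = betaFun f * g + sg f * betaFun g := by
  simp only [betaFun_eq, del_mul, sg_mul]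
  noncomm_ring

theorem betaFun_sg (f : WordFun A) : betaFun (sg f) = -sg (betaFun f) := by
  simp only [betaFun_eq, del_sg, sg_mul, sg_sub, sg_add, sg_sg, sg_iota]
  noncomm_ring

theorem betaFun_one : betaFun (1 : WordFun A) = 0 := by
  have : sg (1 : WordFun A) = 1 := by
    funext l; cases l <;> simp [sg, wone_nil, wone_cons]
  have h : del (1 : WordFun A) = 0 := by
    funext l
    match l with
    | [] => simp [del_nil, wzero]
    | [a] => simp [del_single, wzero]
    | a :: b :: l =>
      rw [del_cons_cons, show pre a (1 : WordFun A) = 0 from rfl]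
      simp [wone_cons, del, wzero]
  rw [betaFun_eq, this, h]; noncomm_ring

theorem pre_smul {k : Type*} [CommRing k] [Algebra k A] (c : k) (a : A) (f : WordFun A) :
    pre a (c • f) = c • pre a f := rfl

end WordFun

/-- A word function is a normalized Hochschild cochain, i.e. an element of
`⨁ₚ Hom_k((s Ā)^{⊗ p}, A)`: it is `k`-multilinear in the letters, vanishes on the words with a
letter `1` and on all sufficiently long words. -/
structure IsCochain (k : Type*) {A : Type*} [CommRing k] [CommRing A] [Algebra k A]
    (f : WordFun A) : Prop where
  map_add : ∀ (u v : List A) (a b : A), f (u ++ (a + b) :: v) = f (u ++ a :: v) + f (u ++ b :: v)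
  map_smul : ∀ (u v : List A) (c : k) (a : A), f (u ++ (c • a) :: v) = c • f (u ++ a :: v)
  map_one : ∀ u v : List A, f (u ++ 1 :: v) = 0
  bounded : ∃ N : ℕ, ∀ l : List A, N ≤ l.length → f l = 0

section Cochains

variable {k A : Type*} [CommRing k] [CommRing A] [Algebra k A]

/-- Auxiliary: multilinearity alone. -/
structure IsLin (k : Type*) {A : Type*} [CommRing k] [CommRing A] [Algebra k A]
    (f : WordFun A) : Prop where
  map_add : ∀ (u v : List A) (a b : A), f (u ++ (a + b) :: v) = f (u ++ a :: v) + f (u ++ b :: v)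
  map_smul : ∀ (u v : List A) (c : k) (a : A), f (u ++ (c • a) :: v) = c • f (u ++ a :: v)

theorem IsCochain.isLin {f : WordFun A} (h : IsCochain k f) : IsLin k f :=
  ⟨h.map_add, h.map_smul⟩

theorem IsLin.pre {f : WordFun A} (h : IsLin k f) (c : A) : IsLin k (pre c f) :=
  ⟨fun u v a b => h.map_add (c :: u) v a b, fun u v a b => h.map_smul (c :: u) v a b⟩

theorem IsLin.pre_add {f : WordFun A} (h : IsLin k f) (a b : A) :
    Hochschild.pre (a + b) f = Hochschild.pre a f + Hochschild.pre b f :=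
  funext fun v => h.map_add [] v a b

theorem IsLin.pre_smul {f : WordFun A} (h : IsLin k f) (c : k) (a : A) :
    Hochschild.pre (c • a) f = c • Hochschild.pre a f :=
  funext fun v => h.map_smul [] v c a

theorem IsLin.mrg {f : WordFun A} (h : IsLin k f) (c : A) : IsLin k (mrg c f) := by
  constructor
  · intro u v a b
    cases u with
    | nil => simpa [Hochschild.mrg, mul_add] using h.map_add [] v (c * a) (c * b)
    | cons e u => exact h.map_add ((c * e) :: u) v a b
  · intro u v a b
    cases u with
    | nil => simpa [Hochschild.mrg] using h.map_smul [] v a (c * b)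
    | cons e u => exact h.map_smul ((c * e) :: u) v a b

theorem IsLin.mul {f g : WordFun A} (hf : IsLin k f) (hg : IsLin k g) : IsLin k (f * g) := by
  constructor
  · intro u v a b
    induction u generalizing f with
    | nil =>
      have := hg.map_add [] v a b
      simp only [List.nil_append] at this
      simp only [List.nil_append, wmul_cons, hf.pre_add, add_mul, wadd, this]
      ring
    | cons c u ih =>
      have := hg.map_add (c :: u) v a b
      simp only [List.cons_append] at this
      simp only [List.cons_append, wmul_cons, ih (hf.pre c), this]
      ring
  · intro u v a b
    induction u generalizing f with
    | nil =>
      have := hg.map_smul [] v a b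
      simp only [List.nil_append] at this
      simp only [List.nil_append, wmul_cons, hf.pre_smul, smul_mul_assoc, wsmul, this,
        smul_add, mul_smul_comm]
    | cons c u ih =>
      have := hg.map_smul (c :: u) v a b
      simp only [List.cons_append] at this
      simp only [List.cons_append, wmul_cons, ih (hf.pre c), this, smul_add, mul_smul_comm]

theorem IsLin.sg {f : WordFun A} (h : IsLin k f) : IsLin k (sg f) := by
  constructor
  · intro u v a b
    simp [Hochschild.sg, h.map_add, mul_add]
  · intro u v a b
    simp [Hochschild.sg, h.map_smul]

theorem isLin_iota : IsLin k (iota : WordFun A) := by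
  constructor
  · intro u v a b
    match u, v with
    | [], [] => simp [iota]
    | [], c :: v => simp [iota]
    | [c], v => simp [iota]
    | c :: d :: u, v => simp [iota]
  · intro u v a b
    match u, v with
    | [], [] => simp [iota]
    | [], c :: v => simp [iota]
    | [c], v => simp [iota]
    | c :: d :: u, v => simp [iota]

theorem IsLin.del {f : WordFun A} (h : IsLin k f) : IsLin k (del f) := by
  constructor
  · intro u v a b
    induction u generalizing f with
    | nil =>
      cases v with
      | nil => simp [del_single]
      | cons e v =>
        have := h.map_add [] v (a * e) (b * e)
        simp only [List.nil_append] at this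
        simp only [List.nil_append, del_cons_cons, h.pre_add, del_add, wadd, add_mul, this]
        ring
    | cons c u ih =>
      simp only [List.cons_append, del_cons, ih (h.pre c), (h.mrg c).map_add]
      ring
  · intro u v a b
    induction u generalizing f with
    | nil =>
      cases v with
      | nil => simp [del_single]
      | cons e v =>
        have := h.map_smul [] v a (b * e)
        simp only [List.nil_append] at this
        simp only [List.nil_append, del_cons_cons, h.pre_smul, del_smul, wsmul, smul_mul_assoc,
          this, smul_sub, smul_neg]
    | cons c u ih =>
      simp only [List.cons_append, del_cons, ih (h.pre c), (h.mrg c).map_smul, smul_sub, smul_neg]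

theorem IsLin.add {f g : WordFun A} (hf : IsLin k f) (hg : IsLin k g) : IsLin k (f + g) := by
  constructor
  · intro u v a b
    simp only [wadd, hf.map_add, hg.map_add]; ring
  · intro u v a b
    simp only [wadd, hf.map_smul, hg.map_smul, smul_add]

theorem IsLin.smul {f : WordFun A} (hf : IsLin k f) (c : k) : IsLin k (c • f) := by
  constructor
  · intro u v a b
    simp only [wsmul, hf.map_add, smul_add]
  · intro u v a b
    simp only [wsmul, hf.map_smul, smul_comm c a]

theorem IsLin.betaFun {f : WordFun A} (h : IsLin k f) : IsLin k (betaFun f) := by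
  have e : Hochschild.betaFun f = iota * f + Hochschild.del f + (-1 : k) • (Hochschild.sg f * iota) := by
    rw [betaFun_eq]; simp [sub_eq_add_neg]
  rw [e]
  exact ((isLin_iota.mul h).add h.del).add ((h.sg.mul isLin_iota).smul _)

theorem right_cons (f : WordFun A) (a b : A) (l : List A) :
    (del f - sg f * (iota : WordFun A)) (a :: b :: l)
      = -f ((a * b) :: l) - (del (pre a f) - sg (pre a f) * (iota : WordFun A)) (b :: l) := by
  rw [wsub, wsub, del_cons_cons, wmul_cons, pre_sg]
  simp [iota, wneg]
  ring

theorem right_one (f : WordFun A) (h : pre 1 f = 0) (v : List A) :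
    (del f - sg f * (iota : WordFun A)) (1 :: v) = -f v := by
  cases v with
  | nil =>
    simp [wsub, del_single, wmul_cons, wmul_nil, iota, pre_sg, h, sg, wneg, wzero]
  | cons b l =>
    rw [right_cons, h]
    simp [wsub, del, wzero, sg, mul_iota_cons]

theorem right_cons_one (f : WordFun A) (h : ∀ u v, f (u ++ 1 :: v) = 0) (c : A) (u v : List A) :
    (del f - sg f * (iota : WordFun A)) (c :: (u ++ 1 :: v)) = 0 := by
  induction u generalizing f c with
  | nil =>
    rw [List.nil_append, right_cons, right_one (pre c f) (funext fun w => h [c] w)]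
    simp [pre]
  | cons e u ih =>
    rw [List.cons_append, right_cons, ih (pre c f) (fun u v => h (c :: u) v)]
    have := h ((c * e) :: u) v
    simp only [List.cons_append] at this
    simp [this]

theorem IsCochain.betaFun {f : WordFun A} (h : IsCochain k f) : IsCochain k (betaFun f) where
  map_add := h.isLin.betaFun.map_add
  map_smul := h.isLin.betaFun.map_smul
  map_one := by
    intro u v
    rw [betaFun_eq, add_sub_assoc, wadd]
    have e1 : ∀ a : A, Hochschild.pre a (iota : WordFun A) = a • 1 := by
      intro a
      funext w; cases w <;> simp [Hochschild.pre, iota, wsmul, wone_nil, wone_cons]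
    cases u with
    | nil =>
      rw [List.nil_append, right_one f (funext fun w => h.map_one [] w), wmul_cons, e1]
      simp [iota]
    | cons c u =>
      rw [List.cons_append, right_cons_one f h.map_one, wmul_cons, e1, smul_mul_assoc, one_mul,
        wsmul, h.map_one]
      simp [iota]
  bounded := by
    obtain ⟨N, hN⟩ := h.bounded
    refine ⟨N + 1, fun l hl => ?_⟩
    cases l with
    | nil => rfl
    | cons a w =>
      simp only [List.length_cons, Nat.add_le_add_iff_right] at hl
      have hm : ∀ (j : ℕ) (l : List A), l.length ≤ (mergeAt j l).length + 1 := by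
        intro j
        induction j with
        | zero => intro l; match l with
          | [] => simp [mergeAt]
          | [a] => simp [mergeAt]
          | a :: b :: l => simp [mergeAt]
        | succ j ih => intro l; match l with
          | [] => simp [mergeAt]
          | a :: l => simpa [mergeAt] using ih l
      simp only [Hochschild.betaFun]
      rw [hN w hl, hN (a :: w).dropLast (by simpa using hl), sum_eq_zero]
      · simp
      · intro j _
        have := hm j (a :: w)
        rw [hN _ (by simp only [List.length_cons] at this; lia), mul_zero]

theorem IsCochain.add {f g : WordFun A} (hf : IsCochain k f) (hg : IsCochain k g) :
    IsCochain k (f + g) where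
  map_add := (hf.isLin.add hg.isLin).map_add
  map_smul := (hf.isLin.add hg.isLin).map_smul
  map_one u v := by simp [wadd, hf.map_one, hg.map_one]
  bounded := by
    obtain ⟨N, hN⟩ := hf.bounded
    obtain ⟨M, hM⟩ := hg.bounded
    exact ⟨N + M, fun l hl => by rw [wadd, hN l (by lia), hM l (by lia), add_zero]⟩

theorem IsCochain.smul {f : WordFun A} (hf : IsCochain k f) (c : k) : IsCochain k (c • f) where
  map_add := (hf.isLin.smul c).map_add
  map_smul := (hf.isLin.smul c).map_smul
  map_one u v := by simp [wsmul, hf.map_one]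
  bounded := by
    obtain ⟨N, hN⟩ := hf.bounded
    exact ⟨N, fun l hl => by rw [wsmul, hN l hl, smul_zero]⟩

theorem IsCochain.sg {f : WordFun A} (hf : IsCochain k f) : IsCochain k (sg f) where
  map_add := hf.isLin.sg.map_add
  map_smul := hf.isLin.sg.map_smul
  map_one u v := by simp [Hochschild.sg, hf.map_one]
  bounded := by
    obtain ⟨N, hN⟩ := hf.bounded
    exact ⟨N, fun l hl => by simp [Hochschild.sg, hN l hl]⟩

theorem IsCochain.mul {f g : WordFun A} (hf : IsCochain k f) (hg : IsCochain k g) :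
    IsCochain k (f * g) where
  map_add := (hf.isLin.mul hg.isLin).map_add
  map_smul := (hf.isLin.mul hg.isLin).map_smul
  map_one u v := by
    have h1 := hf.map_one
    clear hf
    induction u generalizing f with
    | nil =>
      have := hg.map_one [] v
      simp only [List.nil_append] at this
      rw [List.nil_append, wmul_cons, this, show pre 1 f = 0 from funext fun w => h1 [] w]
      simp [wzero]
    | cons c u ih =>
      have := hg.map_one (c :: u) v
      simp only [List.cons_append] at this
      rw [List.cons_append, wmul_cons, this, ih (f := pre c f) (fun u v => h1 (c :: u) v)]
      simp
  bounded := by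
    obtain ⟨N, hN⟩ := hf.bounded
    obtain ⟨M, hM⟩ := hg.bounded
    refine ⟨N + M, fun l hl => ?_⟩
    change cup f g l = 0
    refine sum_eq_zero fun i hi => ?_
    rw [mem_range] at hi
    by_cases h : N ≤ i
    · rw [hN (l.take i) (by rw [List.length_take]; lia), zero_mul]
    · rw [hM (l.drop i) (by rw [List.length_drop]; lia), mul_zero]

theorem wone_append (u v : List A) (a : A) : (1 : WordFun A) (u ++ a :: v) = 0 := by
  cases u <;> rfl

theorem isCochain_one : IsCochain k (1 : WordFun A) where
  map_add u v a b := by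
    rw [wone_append, wone_append, wone_append, add_zero]
  map_smul u v a b := by
    rw [wone_append, wone_append, smul_zero]
  map_one u v := wone_append u v 1
  bounded := ⟨1, fun l hl => by
    cases l with
    | nil => simp at hl
    | cons a l => exact wone_cons a l⟩

variable (k A)

/-- The cocycles of the normalized Hochschild cochain complex, as an algebra under cup product. -/
def cocycles : Subalgebra k (WordFun A) where
  carrier := {f | IsCochain k f ∧ betaFun f = 0}
  mul_mem' := fun {f g} hf hg => ⟨hf.1.mul hg.1, by
    rw [betaFun_mul, hf.2, hg.2, zero_mul, mul_zero, add_zero]⟩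
  add_mem' := fun {f g} hf hg => ⟨hf.1.add hg.1, by rw [betaFun_add, hf.2, hg.2, add_zero]⟩
  algebraMap_mem' := fun c => by
    rw [Algebra.algebraMap_eq_smul_one]
    exact ⟨isCochain_one.smul c, by rw [betaFun_smul, betaFun_one, smul_zero]⟩

/-- The ideal of coboundaries in the algebra of cocycles. -/
def coboundaries : Ideal (cocycles k A) where
  carrier := {z | ∃ g : WordFun A, IsCochain k g ∧ betaFun g = z}
  add_mem' := by
    rintro z w ⟨g, hg, hz⟩ ⟨g', hg', hw⟩
    exact ⟨g + g', hg.add hg', by rw [betaFun_add, hz, hw]; rfl⟩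
  zero_mem' := ⟨(0 : k) • 1, isCochain_one.smul 0, by rw [betaFun_smul, zero_smul]; rfl⟩
  smul_mem' := by
    rintro z w ⟨g, hg, hw⟩
    refine ⟨sg z * g, z.2.1.sg.mul hg, ?_⟩
    rw [betaFun_mul, betaFun_sg, z.2.2, sg_sg, hw]
    have : sg (0 : WordFun A) = 0 := by funext l; simp [sg, wzero]
    simp [this]

instance : (coboundaries k A).IsTwoSided where
  mul_mem_of_left := by
    rintro z w ⟨g, hg, hz⟩
    refine ⟨g * w, hg.mul w.2.1, ?_⟩
    rw [betaFun_mul, hz, w.2.2]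
    simp

/-- The Hochschild cohomology algebra `HH^*(A; A)`, with the cup product. -/
abbrev HH : Type _ := cocycles k A ⧸ coboundaries k A

variable {A}

/-- Let `𝒜 d` be the part of `A` of (lower) degree `d`.  The cochain `f` has total degree `d` if
it maps a word of homogeneous letters `a₁, …, aₚ` into degree `d + |s a₁| + ⋯ + |s aₚ|`, where
`|s a| = |a| + 1`. -/
def HasDegree (𝒜 : ℤ → Submodule k A) (d : ℤ) (f : WordFun A) : Prop :=
  ∀ (l : List A) (e : List ℤ), List.Forall₂ (fun a i => a ∈ 𝒜 i) l e →
    f l ∈ 𝒜 (d + (e.map (fun i => i + 1)).sum)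

/-- The part of `HH^*(A; A)` of degree `d`: the classes of the cocycles of total degree `d`. -/
def HHdeg (𝒜 : ℤ → Submodule k A) (d : ℤ) : Submodule k (HH k A) where
  carrier := {c | ∃ z : cocycles k A, HasDegree k 𝒜 d z ∧ Ideal.Quotient.mk _ z = c}
  add_mem' := by
    rintro _ _ ⟨z, hz, rfl⟩ ⟨w, hw, rfl⟩
    exact ⟨z + w, fun l e h => (𝒜 _).add_mem (hz l e h) (hw l e h), map_add _ _ _⟩
  zero_mem' := ⟨0, fun _ _ _ => (𝒜 _).zero_mem, map_zero _⟩
  smul_mem' := by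
    rintro c _ ⟨z, hz, rfl⟩
    exact ⟨c • z, fun l e h => (𝒜 _).smul_mem c (hz l e h), rfl⟩

end Cochains

theorem rotate_append_cons {A : Type*} (i : ℕ) (u v : List A) :
    ∃ u' v' : List A, ∀ a, (u ++ a :: v).rotate i = u' ++ a :: v' := by
  induction i generalizing u v with
  | zero => exact ⟨u, v, fun a => by simp⟩
  | succ i ih =>
    cases u with
    | nil =>
      obtain ⟨u', v', h⟩ := ih v []
      exact ⟨u', v', fun a => by simpa using h a⟩
    | cons c u =>
      obtain ⟨u', v', h⟩ := ih u (v ++ [c])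
      exact ⟨u', v', fun a => by simpa using h a⟩

section Delta

variable {k A : Type*} [CommRing k] [CommRing A] [Algebra k A] {ι : Type*} [Fintype ι]

/-- The operator `Δ` on cochains, for the duality pairing `⟨a, c⟩ = ε (a * c)`, a basis `b` of `A`
and its dual basis `b'`: for a word `[a₁, …, aₚ]`, with `a₀ = b j` in the `j`-th summand,
`(Δ f)[a₁, …, aₚ] = ∑ⱼ (-1)^|f| ∑ᵢ (-1)^(i (p + 1 - i)) ⟨1, f[aᵢ, …, aₚ, a₀, …, aᵢ₋₁]⟩ b' j`,
where `(-1)^|f| = (-1)^(p + 1)`. -/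
def deltaFun (ε : A →ₗ[k] k) (b b' : ι → A) (f : WordFun A) : WordFun A := fun l =>
  ∑ j, ((-1) ^ (l.length + 1) * ∑ i ∈ range (l.length + 1),
    (-1) ^ (i * (l.length + 1 - i)) * ε (f ((b j :: l).rotate i))) • b' j

theorem IsLin.rotate_add {f : WordFun A} (h : IsLin k f) (i : ℕ) (u v : List A) (a c : A) :
    f ((u ++ (a + c) :: v).rotate i) = f ((u ++ a :: v).rotate i) + f ((u ++ c :: v).rotate i) := by
  obtain ⟨u', v', e⟩ := rotate_append_cons i u v
  rw [e, e, e, h.map_add]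

theorem IsLin.rotate_smul {f : WordFun A} (h : IsLin k f) (i : ℕ) (u v : List A) (a : k) (c : A) :
    f ((u ++ (a • c) :: v).rotate i) = a • f ((u ++ c :: v).rotate i) := by
  obtain ⟨u', v', e⟩ := rotate_append_cons i u v
  rw [e, e, h.map_smul]

variable (ε : A →ₗ[k] k) (b b' : ι → A)

theorem deltaFun_add (f g : WordFun A) :
    deltaFun ε b b' (f + g) = deltaFun ε b b' f + deltaFun ε b b' g := by
  funext l
  simp only [deltaFun, wadd, map_add, mul_add, sum_add_distrib, add_smul]

theorem deltaFun_smul (c : k) (f : WordFun A) :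
    deltaFun ε b b' (c • f) = c • deltaFun ε b b' f := by
  funext l
  simp only [deltaFun, wsmul, map_smul, smul_eq_mul, smul_sum, smul_smul, mul_left_comm _ c,
    ← mul_sum]

theorem IsCochain.deltaFun {f : WordFun A} (h : IsCochain k f) :
    IsCochain k (deltaFun ε b b' f) where
  map_add u v a c := by
    have e : ∀ (j : ι) (i : ℕ), f ((b j :: (u ++ (a + c) :: v)).rotate i)
        = f ((b j :: (u ++ a :: v)).rotate i) + f ((b j :: (u ++ c :: v)).rotate i) :=
      fun j i => h.isLin.rotate_add i (b j :: u) v a c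
    simp only [Hochschild.deltaFun, e, _root_.map_add, mul_add, sum_add_distrib, add_smul,
      List.length_append, List.length_cons]
  map_smul u v a c := by
    have e : ∀ (j : ι) (i : ℕ), f ((b j :: (u ++ (a • c) :: v)).rotate i)
        = a • f ((b j :: (u ++ c :: v)).rotate i) :=
      fun j i => h.isLin.rotate_smul i (b j :: u) v a c
    simp only [Hochschild.deltaFun, e, _root_.map_smul, smul_eq_mul, smul_sum, smul_smul,
      mul_left_comm _ a, ← mul_sum, List.length_append, List.length_cons]
  map_one u v := by
    have e : ∀ (j : ι) (i : ℕ), f ((b j :: (u ++ 1 :: v)).rotate i) = 0 := fun j i => by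
      obtain ⟨u', v', e⟩ := rotate_append_cons i (b j :: u) v
      have := e 1
      simp only [List.cons_append] at this
      rw [this, h.map_one]
    simp [Hochschild.deltaFun, e]
  bounded := by
    obtain ⟨N, hN⟩ := h.bounded
    refine ⟨N, fun l hl => ?_⟩
    have e : ∀ (j : ι) (i : ℕ), f ((b j :: l).rotate i) = 0 := fun j i =>
      hN _ (by rw [List.length_rotate, List.length_cons]; lia)
    simp [Hochschild.deltaFun, e]

theorem eps_deltaFun (hb : ∀ a, a = ∑ j, ε (a * b' j) • b j) {f : WordFun A} (h : IsLin k f)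
    (a : A) (l : List A) :
    ε (a * deltaFun ε b b' f l) = (-1) ^ (l.length + 1) * ∑ i ∈ range (l.length + 1),
      (-1) ^ (i * (l.length + 1 - i)) * ε (f ((a :: l).rotate i)) := by
  let G : A →ₗ[k] k :=
    { toFun := fun a => (-1) ^ (l.length + 1) * ∑ i ∈ range (l.length + 1),
        (-1) ^ (i * (l.length + 1 - i)) * ε (f ((a :: l).rotate i))
      map_add' := fun a c => by
        have e : ∀ i, f (((a + c) :: l).rotate i) = f ((a :: l).rotate i) + f ((c :: l).rotate i) :=
          fun i => h.rotate_add i [] l a c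
        simp only [e, map_add, mul_add, sum_add_distrib]
      map_smul' := fun a c => by
        have e : ∀ i, f (((a • c) :: l).rotate i) = a • f ((c :: l).rotate i) :=
          fun i => h.rotate_smul i [] l a c
        simp only [e, map_smul, smul_eq_mul, mul_left_comm _ a, ← mul_sum, RingHom.id_apply] }
  change ε (a * ∑ j, G (b j) • b' j) = G a
  conv_rhs => rw [hb a, map_sum]
  rw [mul_sum, map_sum]
  refine sum_congr rfl fun j _ => ?_
  rw [mul_smul_comm, map_smul, map_smul, smul_eq_mul, smul_eq_mul, mul_comm]

theorem sum_shift {k : Type*} [CommRing k] {N : ℕ} (g : ℕ → k) (hg : ∀ i, g (i + N) = g i) (c : ℕ) :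
    ∑ i ∈ range N, g (i + c) = ∑ i ∈ range N, g i := by
  induction c with
  | zero => rfl
  | succ c ih =>
    have h1 := sum_range_succ (fun i => g (i + c)) N
    have h2 := sum_range_succ' (fun i => g (i + c)) N
    have h3 := hg c
    rw [← ih]
    simp only [Nat.zero_add, add_right_comm _ 1 c, add_comm N c] at h1 h2
    rw [h1, h3] at h2
    simpa [add_assoc] using (add_right_cancel h2).symm

theorem mergeAt_rotate (j : ℕ) (u : List A) (N : ℕ) (hu : u.length = N + 1) (hj : j < N) :
    mergeAt j u = (mergeAt 0 (u.rotate j)).rotate (N - j) := by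
  have hm : ∀ (p q : List A) (x y : A),
      mergeAt p.length (p ++ x :: y :: q) = p ++ (x * y) :: q := by
    intro p q x y
    induction p with
    | nil => rfl
    | cons c p ih => simp [mergeAt, ih]
  obtain ⟨p, x, y, q, rfl, hp⟩ : ∃ p x y q, u = p ++ x :: y :: q ∧ p.length = j := by
    refine ⟨u.take j, u[j]'(by lia), u[j + 1]'(by lia), u.drop (j + 2), ?_, ?_⟩
    · rw [List.getElem_cons_drop, List.getElem_cons_drop, List.take_append_drop]
    · rw [List.length_take]; lia
  subst hp
  rw [hm, List.rotate_append_length_eq]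
  have h1 : mergeAt 0 ((x :: y :: q) ++ p) = (x * y :: q) ++ p := by simp [mergeAt]
  have h2 : N - p.length = (x * y :: q).length := by simp at hu ⊢; lia
  rw [h1, h2, List.rotate_append_length_eq]

theorem sum_cyclic {k A : Type*} [CommRing k] (N : ℕ) (hN : 0 < N) (φ : List A → k) (m : ℕ → List A)
    (hm : ∀ i, (m i).length = N) (hper : ∀ i, m (i + (N + 1)) = m i) :
    ∑ j ∈ range (N + 1), (-1) ^ j * ∑ i ∈ range N, (-1) ^ (i * (N - i)) * φ ((m j).rotate (N - j + i))
      = ∑ i ∈ range (N + 1), (-1) ^ (i * (N + 1 - i)) *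
          ∑ j ∈ range N, (-1) ^ j * φ ((m (i + j)).rotate (N - j)) := by
  have key : ∀ x y : ℕ, Even (x + y) → ((-1 : k)) ^ x = (-1) ^ y := by
    intro x y h
    rcases Nat.even_or_odd x with hx | hx
    · rw [hx.neg_one_pow, (Nat.even_add.1 h |>.1 hx).neg_one_pow]
    · have hy : Odd y := by
        rw [← Nat.not_even_iff_odd] at hx ⊢
        exact fun hy => hx ((Nat.even_add.1 h).2 hy)
      rw [hx.neg_one_pow, hy.neg_one_pow]
  obtain ⟨M, rfl⟩ : ∃ M, N = M + 1 := ⟨N - 1, by lia⟩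
  set F : ℕ → ℕ → k := fun a c => (-1) ^ ((M + 1) * a + M * c) * φ ((m a).rotate c) with hF
  have F1 : ∀ a c, F (a + (M + 1 + 1)) c = F a c := by
    intro a c
    simp only [hF, hper]
    rw [key _ ((M + 1) * a + M * c)]
    rcases Nat.even_or_odd M with h | h <;> simp [parity_simps, h]
  have F2 : ∀ a c, F a (c + (M + 1)) = F a c := by
    intro a c
    simp only [hF]
    rw [key _ ((M + 1) * a + M * c)]
    · congr 2
      rw [← List.rotate_mod, hm, Nat.add_mod_right, ← hm a, List.rotate_mod]
    · rcases Nat.even_or_odd M with h | h <;> simp [parity_simps, h]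
  have L1 : ∀ j ∈ range (M + 1 + 1), (-1) ^ j * ∑ i ∈ range (M + 1),
      (-1) ^ (i * (M + 1 - i)) * φ ((m j).rotate (M + 1 - j + i)) = ∑ c ∈ range (M + 1), F j c := by
    intro j hj
    rw [← sum_shift (F j) (F2 j) (M + 1 - j), mul_sum]
    refine sum_congr rfl fun i hi => ?_
    rw [mem_range] at hi hj
    obtain ⟨r, hr⟩ : ∃ r, M + 1 = i + r := ⟨M + 1 - i, by lia⟩
    obtain ⟨q, hq⟩ : ∃ q, M + 1 = j + q := ⟨M + 1 - j, by lia⟩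
    simp only [hF]
    rw [← mul_assoc, ← pow_add, add_comm i (M + 1 - j)]
    congr 1
    apply key
    have h1 : M + 1 - i = r := by lia
    have h2 : M + 1 - j = q := by lia
    rw [h1, h2]
    have h3 : (Even M ↔ ¬ (Even i ↔ Even r)) := by
      have := congrArg Even hr; simp [parity_simps] at this; grind
    have h4 : (Even M ↔ ¬ (Even j ↔ Even q)) := by
      have := congrArg Even hq; simp [parity_simps] at this; grind
    simp [parity_simps]
    grind
  have R1 : ∑ i ∈ range (M + 1 + 1), (-1) ^ (i * (M + 1 + 1 - i)) *
      ∑ j ∈ range (M + 1), (-1) ^ j * φ ((m (i + j)).rotate (M + 1 - j))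
      = ∑ i ∈ range (M + 1 + 1), ∑ j ∈ range (M + 1), F (i + j) (M + 1 - j) := by
    refine sum_congr rfl fun i hi => ?_
    rw [mul_sum]
    refine sum_congr rfl fun j hj => ?_
    rw [mem_range] at hi hj
    obtain ⟨r, hr⟩ : ∃ r, M + 1 + 1 = i + r := ⟨M + 1 + 1 - i, by lia⟩
    obtain ⟨q, hq⟩ : ∃ q, M + 1 = j + q := ⟨M + 1 - j, by lia⟩
    simp only [hF]
    rw [← mul_assoc, ← pow_add]
    congr 1
    apply key
    have h1 : M + 1 + 1 - i = r := by lia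
    have h2 : M + 1 - j = q := by lia
    rw [h1, h2]
    have h3 : (Even M ↔ (Even i ↔ Even r)) := by
      have := congrArg Even hr; simp [parity_simps] at this; grind
    have h4 : (Even M ↔ ¬ (Even j ↔ Even q)) := by
      have := congrArg Even hq; simp [parity_simps] at this; grind
    simp [parity_simps]
    grind
  rw [sum_congr rfl L1, R1, sum_comm, sum_comm (s := range (M + 1 + 1))]
  rw [← sum_shift (fun c => ∑ a ∈ range (M + 1 + 1), F a c) (fun c => by
    simp only [F2]) 1, ← sum_range_reflect]
  refine sum_congr rfl fun j hj => ?_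
  rw [mem_range] at hj
  rw [sum_shift (fun a => F a _) (fun a => F1 a _)]
  refine sum_congr rfl fun a _ => ?_
  congr 1
  lia

theorem eps_betaFun (f : WordFun A) (P : List A → k)
    (hP : ∀ a w, P (a :: w) = ε (a * f w)) (u : List A) (N : ℕ) (hu : u.length = N + 1) :
    ε (betaFun f u) = P u - ∑ j ∈ range N, (-1) ^ j * ε (f (mergeAt j u))
      + (-1) ^ (N + 1) * P (u.rotate N) := by
  have hs : ∀ (m : ℕ) (a : A), ε ((-1) ^ m * a) = (-1) ^ m * ε a := by
    intro m a
    rcases Nat.even_or_odd m with h | h <;> simp [h.neg_one_pow]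
  cases u with
  | nil => simp at hu
  | cons a w =>
    have hw : w.length = N := by simpa using hu
    have e : (a :: w).rotate N = (a :: w).getLast (List.cons_ne_nil a w) :: (a :: w).dropLast := by
      conv_lhs => rw [← List.dropLast_append_getLast (List.cons_ne_nil a w)]
      have : N = (a :: w).dropLast.length := by simp [hw]
      rw [this, List.rotate_append_length_eq]
      rfl
    simp only [betaFun, map_add, map_sum, hs]
    rw [e, hP, hP, hw, sub_eq_add_neg, ← sum_neg_distrib, mul_comm (f _)]
    congr 2
    refine sum_congr rfl fun j _ => ?_
    ring

theorem betaFun_deltaFun (hb : ∀ a, a = ∑ j, ε (a * b' j) • b j)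
    (hε : ∀ a, (∀ c, ε (c * a) = 0) → a = 0) {f : WordFun A} (h : IsLin k f) :
    betaFun (deltaFun ε b b' f) = deltaFun ε b b' (betaFun f) := by
  have hs : ∀ (m : ℕ) (a : A), ε ((-1) ^ m * a) = (-1) ^ m * ε a := by
    intro m a
    rcases Nat.even_or_odd m with h | h <;> simp [h.neg_one_pow]
  funext l
  rw [← sub_eq_zero]
  apply hε
  intro c
  rw [mul_sub, map_sub, sub_eq_zero, eps_deltaFun ε b b' hb h.betaFun]
  cases l with
  | nil => simp [betaFun, mul_comm]
  | cons a w =>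
    obtain ⟨N, hN⟩ : ∃ N, N = w.length + 1 := ⟨_, rfl⟩
    set W : List A := c :: a :: w with hW
    have hWl : W.length = N + 1 := by simp [hW, hN]
    let P : List A → k := fun u => match u with
      | [] => 0
      | a :: w => ε (a * f w)
    have hR : ∑ i ∈ range (N + 1), (-1) ^ (i * (N + 1 - i)) * ε (betaFun f (W.rotate i))
        = - ∑ i ∈ range (N + 1), (-1) ^ (i * (N + 1 - i)) *
          ∑ j ∈ range N, (-1) ^ j * ε (f (mergeAt j (W.rotate i))) := by
      have key : ∀ i ≤ N + 1, ((-1 : k)) ^ (i * (N + 1 - i)) = (-1) ^ (N * i) := by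
        intro i hi
        obtain ⟨r, hr⟩ : ∃ r, N + 1 = i + r := ⟨N + 1 - i, by lia⟩
        rw [hr, Nat.add_sub_cancel_left]
        have h3 : (Even N ↔ ¬ (Even i ↔ Even r)) := by
          have := congrArg Even hr; simp [parity_simps] at this; grind
        rw [neg_one_pow_eq_pow_mod_two, neg_one_pow_eq_pow_mod_two (n := N * i)]
        congr 1
        have : Even (i * r) ↔ Even (N * i) := by simp [parity_simps]; grind
        rw [Nat.even_iff, Nat.even_iff] at this
        lia
      have c1 := sum_shift (N := N + 1) (fun i => (-1) ^ (N * i) * P (W.rotate i)) (fun i => by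
        have e1 : W.rotate (i + (N + 1)) = W.rotate i := by
          rw [← List.rotate_mod, hWl, Nat.add_mod_right, ← hWl, List.rotate_mod]
        have e2 : ((-1 : k)) ^ (N * (i + (N + 1))) = (-1) ^ (N * i) := by
          rw [mul_add, pow_add, (Nat.even_mul_succ_self N).neg_one_pow, mul_one]
        rw [e1, e2]) N
      have c2 : ∀ i ∈ range (N + 1), (-1) ^ (i * (N + 1 - i)) * ε (betaFun f (W.rotate i))
          = (-1) ^ (N * i) * P (W.rotate i) - (-1) ^ (N * (i + N)) * P (W.rotate (i + N))
            - (-1) ^ (i * (N + 1 - i)) *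
              ∑ j ∈ range N, (-1) ^ j * ε (f (mergeAt j (W.rotate i))) := by
        intro i hi
        rw [mem_range] at hi
        rw [eps_betaFun ε f P (fun _ _ => rfl) (W.rotate i) N (by rw [List.length_rotate, hWl]),
          key i hi.le, List.rotate_rotate]
        have e2 : ((-1 : k)) ^ (N * (i + N)) = (-1) ^ (N * i) * (-1) ^ N := by
          rw [mul_add, pow_add]
          congr 1
          rcases Nat.even_or_odd N with h | h
          · rw [h.neg_one_pow, (h.mul_left N).neg_one_pow]
          · rw [h.neg_one_pow, (h.mul h).neg_one_pow]
        rw [e2]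
        ring
      rw [sum_congr rfl c2, sum_sub_distrib, sum_sub_distrib, c1]
      ring
    have hlen : (a :: w).length = N := by simp [hN]
    rw [hlen, hR]
    have hml : ∀ (j : ℕ) (l : List A), j + 1 < l.length →
        (mergeAt j l).length + 1 = l.length := by
      intro j
      induction j with
      | zero => intro l hl; match l with
        | [] => simp at hl
        | [a] => simp at hl
        | a :: b :: l => simp [mergeAt]
      | succ j ih => intro l hl; match l with
        | [] => simp at hl
        | a :: l => simpa [mergeAt] using ih l (by simpa using hl)
    let H : List A → k := fun m => ∑ i ∈ range N, (-1) ^ (i * (N - i)) * ε (f (m.rotate i))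
    have hH : ∀ (e : A) (v : List A), v.length + 1 = N →
        ε (e * deltaFun ε b b' f v) = (-1) ^ N * H (e :: v) := by
      intro e v hv
      rw [eps_deltaFun ε b b' hb h, hv]
    have hH' : ∀ v : List A, v.length + 1 = N →
        ε (a * c * deltaFun ε b b' f v) = (-1) ^ N * H ((c * a) :: v) := by
      intro v hv
      rw [mul_comm a c, hH _ v hv]
    have hper : ∀ i, mergeAt 0 (W.rotate (i + (N + 1))) = mergeAt 0 (W.rotate i) := by
      intro i
      rw [← List.rotate_mod, hWl, Nat.add_mod_right, ← hWl, List.rotate_mod]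
    have main := sum_cyclic (k := k) N (by lia) (fun u => ε (f u)) (fun i => mergeAt 0 (W.rotate i))
      (fun i => by
        have := hml 0 (W.rotate i) (by rw [List.length_rotate, hWl]; lia)
        rw [List.length_rotate, hWl] at this
        lia) hper
    have hR2 : ∀ i ∈ range (N + 1), (-1) ^ (i * (N + 1 - i)) *
          ∑ j ∈ range N, (-1) ^ j * ε (f ((mergeAt 0 (W.rotate (i + j))).rotate (N - j)))
        = (-1) ^ (i * (N + 1 - i)) *
          ∑ j ∈ range N, (-1) ^ j * ε (f (mergeAt j (W.rotate i))) := by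
      intro i _
      congr 1
      refine sum_congr rfl fun j hj => ?_
      rw [mergeAt_rotate j (W.rotate i) N (by rw [List.length_rotate, hWl]) (mem_range.1 hj),
        List.rotate_rotate]
    rw [sum_congr rfl hR2] at main
    rw [← main, sum_range_succ]
    have hL : ∀ j ∈ range N, (-1) ^ j * ∑ i ∈ range N, (-1) ^ (i * (N - i)) *
          ε (f ((mergeAt 0 (W.rotate j)).rotate (N - j + i)))
        = (-1) ^ j * H (mergeAt j W) := by
      intro j hj
      rw [mergeAt_rotate j W N hWl (mem_range.1 hj)]
      simp only [H, List.rotate_rotate]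
    rw [sum_congr rfl hL]
    have hlast : mergeAt 0 (W.rotate N) =
        ((a :: w).getLast (List.cons_ne_nil a w) * c) :: (a :: w).dropLast := by
      have : W = (c :: (a :: w).dropLast) ++ [(a :: w).getLast (List.cons_ne_nil a w)] := by
        rw [List.cons_append, List.dropLast_append_getLast]
      have e2 : N = (c :: (a :: w).dropLast).length := by simp [hN]
      rw [this, e2, List.rotate_append_length_eq]
      rfl
    have hlast' : ∑ i ∈ range N, (-1) ^ (i * (N - i)) *
          ε (f ((mergeAt 0 (W.rotate N)).rotate (N - N + i)))
        = H (((a :: w).getLast (List.cons_ne_nil a w) * c) :: (a :: w).dropLast) := by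
      rw [hlast]; simp [H]
    rw [hlast']
    simp only [betaFun, mul_add, map_add, mul_sum, map_sum, mul_left_comm c, hs]
    rw [← mul_assoc, hH' w hN.symm]
    have hd : ∀ j ∈ range w.length, (-1) ^ (j + 1) * ε (c * deltaFun ε b b' f (mergeAt j (a :: w)))
        = (-1) ^ (j + 1) * ((-1) ^ N * H (mergeAt (j + 1) W)) := by
      intro j hj
      rw [mem_range] at hj
      rw [hH c _ (by rw [hml j (a :: w) (by simpa using hj), hlen])]
      rfl
    have hd2 : ε (deltaFun ε b b' f (a :: w).dropLast *
        (c * (a :: w).getLast (List.cons_ne_nil a w)))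
        = (-1) ^ N * H (((a :: w).getLast (List.cons_ne_nil a w) * c) :: (a :: w).dropLast) := by
      rw [mul_comm, mul_comm c, hH _ _ (by simp [hN])]
    rw [sum_congr rfl hd, hd2]
    rw [hN, sum_range_succ', ← hN]
    have : mergeAt 0 W = (c * a) :: w := rfl
    rw [this]
    simp only [pow_zero, one_mul, pow_succ]
    have hs3 : ∑ x ∈ range w.length, (-1) ^ x * -1 * ((-1) ^ N * H (mergeAt (x + 1) W))
        = (-1) ^ N * ∑ x ∈ range w.length, (-1) ^ x * -1 * H (mergeAt (x + 1) W) := by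
      rw [mul_sum]
      exact sum_congr rfl fun x _ => by ring
    rw [hs3]
    ring

end Delta

section TruncPoly

open Polynomial

variable (k : Type*) [Field k] (n : ℕ)

/-- The truncated polynomial algebra `k[x] / (x ^ (n + 1))`. -/
abbrev TruncPoly : Type _ := AdjoinRoot (X ^ (n + 1) : k[X])

/-- The generator `x`. -/
noncomputable abbrev gen : TruncPoly k n := AdjoinRoot.root (X ^ (n + 1) : k[X])

/-- The linear form `a ↦ (coefficient of x ^ n in a)`, which gives the Poincaré duality pairing
`⟨a, c⟩ = topCoeff (a * c)`. -/
noncomputable def topCoeff : TruncPoly k n →ₗ[k] k :=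
  Polynomial.lcoeff k n ∘ₗ AdjoinRoot.modByMonicHom (monic_X_pow (R := k) (n + 1))

/-- For `|x| = 2 m`: the part of lower (homological) degree `d`, spanned by the powers `x ^ i` with
`d = -2 m i`. -/
noncomputable def truncDeg (m d : ℤ) : Submodule k (TruncPoly k n) :=
  Submodule.span k {y | ∃ i : ℕ, d = -2 * m * i ∧ y = gen k n ^ i}

theorem gen_pow_eq_zero {i : ℕ} (h : n < i) : gen k n ^ i = 0 := by
  have : gen k n ^ (n + 1) = 0 := by
    have h1 := AdjoinRoot.mk_self (f := (X ^ (n + 1) : k[X]))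
    rwa [map_pow, AdjoinRoot.mk_X] at h1
  exact pow_eq_zero_of_le h this

theorem topCoeff_gen_pow (i : ℕ) : topCoeff k n (gen k n ^ i) = if i = n then 1 else 0 := by
  by_cases h : n < i
  · rw [gen_pow_eq_zero k n h, _root_.map_zero, if_neg (by lia)]
  · have e : gen k n ^ i = AdjoinRoot.mk (X ^ (n + 1) : k[X]) (X ^ i) := by simp
    rw [e, topCoeff, LinearMap.comp_apply, AdjoinRoot.modByMonicHom_mk,
      (modByMonic_eq_self_iff (monic_X_pow _)).2 (by
        rw [degree_X_pow, degree_X_pow]; exact_mod_cast (by lia : i < n + 1))]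
    simp [coeff_X_pow, eq_comm]

theorem topCoeff_expand (a : TruncPoly k n) :
    a = ∑ j : Fin (n + 1), topCoeff k n (a * gen k n ^ (n - (j : ℕ))) • gen k n ^ (j : ℕ) := by
  induction a using AdjoinRoot.induction_on with
  | ih p =>
    induction p using Polynomial.induction_on' with
    | add p q hp hq =>
      rw [_root_.map_add]
      conv_lhs => rw [hp, hq]
      simp only [add_mul, _root_.map_add, add_smul, sum_add_distrib]
    | monomial i c =>
      have e : AdjoinRoot.mk (X ^ (n + 1) : k[X]) (monomial i c) = c • gen k n ^ i := by
        rw [← C_mul_X_pow_eq_monomial, _root_.map_mul, map_pow, AdjoinRoot.mk_C, AdjoinRoot.mk_X,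
          Algebra.smul_def, AdjoinRoot.algebraMap_eq]
      simp only [e, smul_mul_assoc, _root_.map_smul, ← pow_add, topCoeff_gen_pow, smul_assoc,
        ← smul_sum]
      congr 1
      by_cases h : n < i
      · rw [gen_pow_eq_zero k n h, sum_eq_zero]
        intro j _
        rw [if_neg (by lia), zero_smul]
      · rw [sum_eq_single (⟨i, by lia⟩ : Fin (n + 1))]
        · rw [if_pos (by simp; lia), one_smul]
        · intro j _ hj
          rw [if_neg (by
            intro h2
            apply hj
            ext
            simp only
            lia), zero_smul]
        · simp

theorem topCoeff_nondeg (a : TruncPoly k n) (h : ∀ c, topCoeff k n (c * a) = 0) : a = 0 := by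
  rw [topCoeff_expand k n a]
  exact sum_eq_zero fun j _ => by rw [mul_comm, h, zero_smul]

/-- The operator `Δ` on the Hochschild cochains of `k[x] / (x ^ (n + 1))`, computed in the basis
`x ^ j`, `0 ≤ j ≤ n`, with the dual basis `x ^ (n - j)`. -/
noncomputable def truncDeltaFun : WordFun (TruncPoly k n) → WordFun (TruncPoly k n) :=
  deltaFun (topCoeff k n) (fun j : Fin (n + 1) => gen k n ^ (j : ℕ))
    (fun j : Fin (n + 1) => gen k n ^ (n - (j : ℕ)))

theorem truncDeltaFun_add (f g : WordFun (TruncPoly k n)) :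
    truncDeltaFun k n (f + g) = truncDeltaFun k n f + truncDeltaFun k n g :=
  deltaFun_add _ _ _ f g

theorem truncDeltaFun_smul (c : k) (f : WordFun (TruncPoly k n)) :
    truncDeltaFun k n (c • f) = c • truncDeltaFun k n f :=
  deltaFun_smul _ _ _ c f

theorem betaFun_truncDeltaFun {f : WordFun (TruncPoly k n)} (h : IsCochain k f) :
    betaFun (truncDeltaFun k n f) = truncDeltaFun k n (betaFun f) :=
  betaFun_deltaFun _ _ _ (topCoeff_expand k n) (topCoeff_nondeg k n) h.isLin

/-- `Δ` on cocycles. -/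
noncomputable def cocycleDelta :
    cocycles k (TruncPoly k n) →ₗ[k] cocycles k (TruncPoly k n) where
  toFun z := ⟨truncDeltaFun k n z, z.2.1.deltaFun _ _ _, by
    rw [betaFun_truncDeltaFun k n z.2.1, z.2.2]
    funext l
    simp [truncDeltaFun, deltaFun, wzero]⟩
  map_add' z w := Subtype.ext (truncDeltaFun_add k n z w)
  map_smul' c z := Subtype.ext (truncDeltaFun_smul k n c z)

/-- The operator `Δ` on `HH^*(A; A)`, `A = k[x] / (x ^ (n + 1))`, induced by `Δ` on cochains. -/
noncomputable def hhDelta : HH k (TruncPoly k n) →ₗ[k] HH k (TruncPoly k n) where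
  toFun := Quotient.map' (cocycleDelta k n) (by
    intro z w h
    rw [Submodule.quotientRel_def] at h ⊢
    obtain ⟨g, hg, e⟩ := h
    refine ⟨truncDeltaFun k n g, hg.deltaFun _ _ _, ?_⟩
    rw [betaFun_truncDeltaFun k n hg, e, ← map_sub]
    rfl)
  map_add' := by
    rintro ⟨z⟩ ⟨w⟩
    exact congrArg (Ideal.Quotient.mk _) ((cocycleDelta k n).map_add z w)
  map_smul' := by
    rintro c ⟨z⟩
    exact congrArg (Ideal.Quotient.mk _) ((cocycleDelta k n).map_smul c z)

theorem hhDelta_mk (z : cocycles k (TruncPoly k n)) :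
    hhDelta k n (Ideal.Quotient.mk _ z) = Ideal.Quotient.mk _ (cocycleDelta k n z) := rfl

end TruncPoly

/-- A graded algebra `H = ⨁ 𝒽 d` with an operator `Δ` is a Batalin-Vilkovisky algebra: it is graded
commutative, `Δ` has degree `1` and square zero, and it satisfies the seven-term identity. -/
structure IsBVAlgebra {k H : Type*} [CommRing k] [Ring H] [Algebra k H]
    (𝒽 : ℤ → Submodule k H) (Δ : H →ₗ[k] H) : Prop where
  internal : DirectSum.IsInternal 𝒽
  one_mem : (1 : H) ∈ 𝒽 0
  mul_mem : ∀ {i j : ℤ} {a b : H}, a ∈ 𝒽 i → b ∈ 𝒽 j → a * b ∈ 𝒽 (i + j)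
  graded_comm : ∀ {i j : ℤ} {a b : H}, a ∈ 𝒽 i → b ∈ 𝒽 j →
    a * b = (i * j).negOnePow • (b * a)
  delta_mem : ∀ {i : ℤ} {a : H}, a ∈ 𝒽 i → Δ a ∈ 𝒽 (i + 1)
  delta_delta : ∀ a : H, Δ (Δ a) = 0
  seven_term : ∀ {i j l : ℤ} {a b c : H}, a ∈ 𝒽 i → b ∈ 𝒽 j → c ∈ 𝒽 l →
    Δ (a * b * c) = Δ (a * b) * c + i.negOnePow • (a * Δ (b * c))
      + ((i - 1) * j).negOnePow • (b * Δ (a * c))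
      - Δ a * b * c - i.negOnePow • (a * Δ b * c) - (i + j).negOnePow • (a * b * Δ c)

section Model

open MvPolynomial

variable (k : Type*) [Field k] (n : ℕ)

/-- The ideal `(x ^ (n + 1), u ^ 2, x ^ n t, u x ^ n)`, with `x = X 0`, `u = X 1`, `t = X 2`. -/
noncomputable def modelIdeal : Ideal (MvPolynomial (Fin 3) k) :=
  Ideal.span {X 0 ^ (n + 1), X 1 ^ 2, X 0 ^ n * X 2, X 1 * X 0 ^ n}

/-- The graded commutative algebra `k[x, u, t] / (x ^ (n + 1), u ^ 2, x ^ n t, u x ^ n)`.  The only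
generator of odd degree is `u`, and `u ^ 2 = 0` is among the relations; so this is a quotient of
the ordinary polynomial ring. -/
abbrev Model : Type _ := MvPolynomial (Fin 3) k ⧸ modelIdeal k n

/-- The class of `x`. -/
noncomputable def modelX : Model k n := Ideal.Quotient.mk _ (X 0)

/-- The class of `u`. -/
noncomputable def modelU : Model k n := Ideal.Quotient.mk _ (X 1)

/-- The class of `t`. -/
noncomputable def modelT : Model k n := Ideal.Quotient.mk _ (X 2)

/-- The part of degree `d`, where `|x| = -2 m`, `|u| = -1` and `|t| = 2 m n + 2 (m - 1)`. -/
noncomputable def modelDeg (m d : ℤ) : Submodule k (Model k n) :=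
  (weightedHomogeneousSubmodule k ![-2 * m, -1, 2 * m * n + 2 * (m - 1)] d).map
    (Ideal.Quotient.mkₐ k (modelIdeal k n)).toLinearMap

end Model

end Hochschild

/-!
# The Hochschild cohomology of `k[x] / (x ^ (n + 1))` as a Batalin–Vilkovisky algebra

**Generators.** The class `u` is represented by the one-argument cocycle `U`, the Euler derivation
`x ^ i ↦ i x ^ i`, and `t` by the two-argument cocycle `T`, which divides `x ^ i * x ^ j` by
`x ^ (n + 1)`.  The relations hold by explicit coboundaries (`exists_betaFun_cochU_sq`,
`exists_betaFun_commutator`, `exists_betaFun_gen_pow_smul_cochT`).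

**Periodicity.** Let `contract f` be the cochain `w ↦ ∑ₛ x ^ (n - s) f [x, x ^ s, w]`.  A cochain
`f` of length at least two whose differential is a multiple of `T` differs from `T ∪ contract f`
by the coboundary of the explicit cochain `homot f` (`sub_betaFun_homot`).  Since one-argument
cocycles are multiples of `U` (`shift_smul_cochU`), each class has the form `a + u q + t h` with
`a, q ∈ A`, where `h` is the class of the contraction (`hh_decomposition`).  The same statement,
applied to the cochain that bounds such a sum, shows that `a`, `q` and `h` are unique up to
the annihilators of `u` and `t` (`hh_injectivity`).  As cochains have bounded length, induction
identifies the cohomology with `k[x, u, t] / (x ^ (n + 1), u ^ 2, x ^ n t, u x ^ n)`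
(`exists_modelEquiv`), and the gradings correspond because contraction is homogeneous
(`map_modelDeg`).

**The operator.** `Δ` lowers the length by one, and `i` contractions recover the coefficient of
`t ^ i`.  For degree reasons `Δ (t ^ i x ^ l) = 0` (`hhDelta_hhT_pow_mul`), and
`Δ (t ^ i u x ^ l)` is a multiple of `t ^ i x ^ l`.  The factor is a sum over the `2 i + 1`
rotations of the words `[y, x, x ^ s₁, …, x, x ^ sᵢ]`, where `y` is a power of `x`: one rotation
contributes `n - l`, and the others contribute `l + 1` and `n - l` alternately
(`coef_contract_iterate_delta`), up to a common sign.

**The Batalin–Vilkovisky identity.** By these formulas `Δ` vanishes on the subalgebra generated by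
`x` and `t`, and on this subalgebra `p ↦ Δ (u p) + n p` is a derivation (`delta_modelU_mul`).
As `u ^ 2 = 0`, this implies the seven-term identity (`isBVAlgebra_model`).
-/

namespace Hochschild

open Finset

/-! ### Words and cochains -/

section Words

variable {k A : Type*} [CommRing k] [CommRing A] [Algebra k A]

instance : IsScalarTower k A (WordFun A) :=
  ⟨fun c a f => funext fun l => smul_assoc c a (f l)⟩

theorem IsCochain.elem_smul {f : WordFun A} (hf : IsCochain k f) (a : A) :
    IsCochain k (a • f) where
  map_add u v b c := by simp only [wsmul, hf.map_add, smul_add]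
  map_smul u v c b := by simp only [wsmul, hf.map_smul, smul_comm c a]
  map_one u v := by simp [wsmul, hf.map_one]
  bounded := by
    obtain ⟨N, hN⟩ := hf.bounded
    exact ⟨N, fun l hl => by rw [wsmul, hN l hl, smul_zero]⟩

theorem IsCochain.sub {f g : WordFun A} (hf : IsCochain k f) (hg : IsCochain k g) :
    IsCochain k (f - g) := by
  have := hf.add (hg.smul (-1 : k))
  rwa [neg_one_smul, ← sub_eq_add_neg] at this

/-- The one-argument cochain given by a linear map. -/
def ofLin (D : A →ₗ[k] A) : WordFun A := fun l => match l with
  | [a] => D a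
  | _ => 0

/-- The two-argument cochain given by a bilinear map. -/
def ofBilin (B : A →ₗ[k] A →ₗ[k] A) : WordFun A := fun l => match l with
  | [a, b] => B a b
  | _ => 0

theorem isCochain_ofLin (D : A →ₗ[k] A) (h : D 1 = 0) : IsCochain k (ofLin D) where
  map_add u v a b := by
    match u, v with
    | [], [] => simp [ofLin]
    | [], c :: v => simp [ofLin]
    | [c], v => simp [ofLin]
    | c :: d :: u, v => simp [ofLin]
  map_smul u v a b := by
    match u, v with
    | [], [] => simp [ofLin]
    | [], c :: v => simp [ofLin]
    | [c], v => simp [ofLin]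
    | c :: d :: u, v => simp [ofLin]
  map_one u v := by
    match u, v with
    | [], [] => simp [ofLin, h]
    | [], c :: v => simp [ofLin]
    | [c], v => simp [ofLin]
    | c :: d :: u, v => simp [ofLin]
  bounded := ⟨2, fun l hl => by
    match l with
    | [] => simp at hl
    | [a] => simp at hl
    | a :: b :: l => rfl⟩

theorem isCochain_ofBilin (B : A →ₗ[k] A →ₗ[k] A) (h : ∀ a, B 1 a = 0) (h' : ∀ a, B a 1 = 0) :
    IsCochain k (ofBilin B) where
  map_add u v a b := by
    match u, v with
    | [], [] => simp [ofBilin]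
    | [], [c] => simp [ofBilin]
    | [], c :: d :: v => simp [ofBilin]
    | [c], [] => simp [ofBilin]
    | [c], d :: v => simp [ofBilin]
    | c :: d :: u, v => simp [ofBilin]
  map_smul u v a b := by
    match u, v with
    | [], [] => simp [ofBilin]
    | [], [c] => simp [ofBilin]
    | [], c :: d :: v => simp [ofBilin]
    | [c], [] => simp [ofBilin]
    | [c], d :: v => simp [ofBilin]
    | c :: d :: u, v => simp [ofBilin]
  map_one u v := by
    match u, v with
    | [], [] => simp [ofBilin]
    | [], [c] => simp [ofBilin, h]
    | [], c :: d :: v => simp [ofBilin]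
    | [c], [] => simp [ofBilin, h']
    | [c], d :: v => simp [ofBilin]
    | c :: d :: u, v => simp [ofBilin]
  bounded := ⟨3, fun l hl => by
    match l with
    | [] => simp at hl
    | [a] => simp at hl
    | [a, b] => simp at hl
    | a :: b :: c :: l => rfl⟩

theorem ofBilin_mul_nil (B : A →ₗ[k] A →ₗ[k] A) (f : WordFun A) : (ofBilin B * f) [] = 0 := by
  simp [wmul_nil, ofBilin]

theorem ofBilin_mul_single (B : A →ₗ[k] A →ₗ[k] A) (f : WordFun A) (a : A) :
    (ofBilin B * f) [a] = 0 := by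
  simp [wmul_cons, wmul_nil, ofBilin, pre]

theorem ofBilin_mul_cons_cons (B : A →ₗ[k] A →ₗ[k] A) (f : WordFun A) (a b : A) (l : List A) :
    (ofBilin B * f) (a :: b :: l) = B a b * f l := by
  have h : pre b (pre a (ofBilin B)) = B a b • (1 : WordFun A) := by
    funext w
    cases w <;> simp [pre, ofBilin, wsmul, wone_nil, wone_cons]
  rw [wmul_cons, wmul_cons, h, smul_mul_assoc, one_mul]
  simp [ofBilin, pre, wsmul]

theorem ofLin_mul_nil (D : A →ₗ[k] A) (f : WordFun A) : (ofLin D * f) [] = 0 := by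
  simp [wmul_nil, ofLin]

theorem ofLin_mul_cons (D : A →ₗ[k] A) (f : WordFun A) (a : A) (l : List A) :
    (ofLin D * f) (a :: l) = D a * f l := by
  have h : pre a (ofLin D) = D a • (1 : WordFun A) := by
    funext w
    cases w <;> simp [pre, ofLin, wsmul, wone_nil, wone_cons]
  rw [wmul_cons, h, smul_mul_assoc, one_mul]
  simp [ofLin, wsmul]

theorem sg_ofBilin (B : A →ₗ[k] A →ₗ[k] A) : sg (ofBilin B) = ofBilin B := by
  funext l
  match l with
  | [] => simp [sg, ofBilin]
  | [a] => simp [sg, ofBilin]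
  | [a, b] => simp [sg, ofBilin]
  | a :: b :: c :: l => simp [sg, ofBilin]

theorem length_mergeAt (j : ℕ) (l : List A) (h : j + 1 < l.length) :
    (mergeAt j l).length + 1 = l.length := by
  induction j generalizing l with
  | zero => match l with
    | [] => simp at h
    | [a] => simp at h
    | a :: b :: l => simp [mergeAt]
  | succ j ih => match l with
    | [] => simp at h
    | a :: l => simpa [mergeAt] using ih l (by simpa using h)

/-- The value of `βf` on words of length `p + 1` only involves `f` on words of length `p`. -/
theorem betaFun_congr {f g : WordFun A} {p : ℕ} (h : ∀ l : List A, l.length = p → f l = g l)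
    (l : List A) (hl : l.length = p + 1) : betaFun f l = betaFun g l := by
  cases l with
  | nil => rfl
  | cons a w =>
    have hw : w.length = p := by simpa using hl
    simp only [betaFun]
    rw [h w hw, h (a :: w).dropLast (by simpa using hw)]
    congr 2
    refine sum_congr rfl fun j hj => ?_
    rw [mem_range] at hj
    have := length_mergeAt j (a :: w) (by simpa using hj)
    rw [h _ (by simp only [List.length_cons] at this; lia)]

/-- The component of a cochain on words of length `p`. -/
def lengthPart (p : ℕ) (f : WordFun A) : WordFun A := fun l => if l.length = p then f l else 0

theorem betaFun_zero : betaFun (0 : WordFun A) = 0 := by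
  have := betaFun_smul (0 : A) (0 : WordFun A)
  rwa [zero_smul, zero_smul] at this

theorem betaFun_neg (f : WordFun A) : betaFun (-f) = -betaFun f := by
  have := betaFun_smul (-1 : A) f
  rwa [neg_one_smul, neg_one_smul] at this

theorem betaFun_sub (f g : WordFun A) : betaFun (f - g) = betaFun f - betaFun g := by
  rw [sub_eq_add_neg, betaFun_add, betaFun_neg, sub_eq_add_neg]

theorem betaFun_lengthPart (p : ℕ) (f : WordFun A) :
    betaFun (lengthPart p f) = lengthPart (p + 1) (betaFun f) := by
  funext l
  by_cases hl : l.length = p + 1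
  · rw [lengthPart, if_pos hl]
    exact betaFun_congr (fun w hw => by rw [lengthPart, if_pos hw]) l hl
  · rw [lengthPart, if_neg hl]
    cases l with
    | nil => rfl
    | cons a w =>
      rw [betaFun_congr (g := 0) (p := w.length) (fun v hv => ?_) _ rfl, betaFun_zero, wzero]
      rw [lengthPart, if_neg, wzero]
      simp only [List.length_cons] at hl
      lia

theorem IsCochain.lengthPart {f : WordFun A} (hf : IsCochain k f) (p : ℕ) :
    IsCochain k (lengthPart p f) where
  map_add u v a b := by
    simp only [Hochschild.lengthPart, List.length_append, List.length_cons]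
    split_ifs
    · exact hf.map_add u v a b
    · simp
  map_smul u v a b := by
    simp only [Hochschild.lengthPart, List.length_append, List.length_cons]
    split_ifs
    · exact hf.map_smul u v a b
    · simp
  map_one u v := by simp [Hochschild.lengthPart, hf.map_one]
  bounded := by
    obtain ⟨N, hN⟩ := hf.bounded
    exact ⟨N, fun l hl => by simp [Hochschild.lengthPart, hN l hl]⟩

/-- The differential in terms of the part that involves the first letter and of the part that only
involves the cochain `pre a f`. -/
theorem betaFun_cons_cons (f : WordFun A) (a b : A) (l : List A) :
    betaFun f (a :: b :: l) = a * f (b :: l) - f ((a * b) :: l)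
      - (del (pre a f) - sg (pre a f) * (iota : WordFun A)) (b :: l) := by
  have e : pre a (iota : WordFun A) = a • 1 := by
    funext w; cases w <;> simp [pre, iota, wsmul, wone_nil, wone_cons]
  rw [betaFun_eq, add_sub_assoc, wadd, right_cons, wmul_cons, e, smul_mul_assoc, one_mul, wsmul]
  simp [iota]
  ring

theorem betaFun_single (f : WordFun A) (a : A) : betaFun f [a] = 0 := by
  simp [betaFun, mul_comm]

theorem betaFun_pair (f : WordFun A) (a b : A) :
    betaFun f [a, b] = a * f [b] - f [a * b] + f [a] * b := by
  simp [betaFun, mergeAt]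
  ring

theorem betaFun_triple (f : WordFun A) (a b c : A) :
    betaFun f [a, b, c] = a * f [b, c] - f [a * b, c] + f [a, b * c] - f [a, b] * c := by
  simp [betaFun, mergeAt, sum_range_succ]
  ring

/-- The product with a left factor supported on words of length `u.length`. -/
theorem mul_append {f : WordFun A} (g : WordFun A) {u : List A}
    (hf : ∀ l : List A, l.length ≠ u.length → f l = 0) (v : List A) :
    (f * g) (u ++ v) = f u * g v := by
  induction u generalizing f with
  | nil =>
    cases v with
    | nil => rw [List.nil_append, wmul_nil]
    | cons b v =>
      have : pre b f = 0 := funext fun l => hf _ (by simp)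
      rw [List.nil_append, wmul_cons, this, zero_mul, wzero, add_zero]
  | cons a u ih =>
    rw [List.cons_append, wmul_cons, hf [] (by simp), zero_mul, zero_add,
      ih (f := pre a f) fun l hl => hf (a :: l) (by simpa using hl)]
    rfl

end Words

/-! ### The cocycles `U` and `T` and their relations -/

section Trunc

variable (k : Type*) [Field k] (n : ℕ)

/-- The coefficient of `x ^ j` in an element of `k[x] / (x ^ (n + 1))`, for `j ≤ n`. -/
noncomputable def coef (j : ℕ) : TruncPoly k n →ₗ[k] k :=
  topCoeff k n ∘ₗ LinearMap.mulRight k (gen k n ^ (n - j))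

variable {n}

theorem coef_gen_pow {i j : ℕ} (hj : j ≤ n) :
    coef k n j (gen k n ^ i) = if i = j then 1 else 0 := by
  rw [coef, LinearMap.comp_apply, LinearMap.mulRight_apply, ← pow_add, topCoeff_gen_pow]
  congr 1
  simp only [eq_iff_iff]
  lia

theorem sum_coef (a : TruncPoly k n) :
    a = ∑ j ∈ range (n + 1), coef k n j a • gen k n ^ j := by
  conv_lhs => rw [topCoeff_expand k n a]
  rw [← Fin.sum_univ_eq_sum_range (fun j => coef k n j a • gen k n ^ j) (n + 1)]
  rfl

variable {M : Type*} [AddCommGroup M] [Module k M]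

variable (n) in
/-- The linear map on `k[x] / (x ^ (n + 1))` with `x ^ j ↦ v j` for `j ≤ n`. -/
noncomputable def monoLin (v : ℕ → M) : TruncPoly k n →ₗ[k] M :=
  ∑ j ∈ range (n + 1), (coef k n j).smulRight (v j)

theorem monoLin_apply (v : ℕ → M) (a : TruncPoly k n) :
    monoLin k n v a = ∑ j ∈ range (n + 1), coef k n j a • v j := by
  simp [monoLin]

theorem monoLin_gen_pow (v : ℕ → M) {i : ℕ} (hi : i ≤ n) :
    monoLin k n v (gen k n ^ i) = v i := by
  rw [monoLin_apply, sum_eq_single i]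
  · rw [coef_gen_pow k hi, if_pos rfl, one_smul]
  · intro j hj hji
    rw [coef_gen_pow k (by simpa [Nat.lt_succ_iff] using hj), if_neg hji.symm, zero_smul]
  · intro h
    simp at h
    lia

theorem monoLin_gen_pow_of_zero (v : ℕ → M) (hv : ∀ i, n < i → v i = 0) (i : ℕ) :
    monoLin k n v (gen k n ^ i) = v i := by
  by_cases hi : i ≤ n
  · exact monoLin_gen_pow k v hi
  · rw [gen_pow_eq_zero k n (by lia), map_zero, hv i (by lia)]

theorem monoLin_one (v : ℕ → M) : monoLin k n v 1 = v 0 := by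
  simpa using monoLin_gen_pow k v (Nat.zero_le n)

variable {k} in
theorem lin_ext {f g : TruncPoly k n →ₗ[k] M}
    (h : ∀ i ≤ n, f (gen k n ^ i) = g (gen k n ^ i)) : f = g := by
  ext a
  rw [sum_coef k a, map_sum, map_sum]
  refine sum_congr rfl fun i hi => ?_
  rw [map_smul, map_smul, h i (by simpa [Nat.lt_succ_iff] using hi)]

variable {k}

/-- A multilinear word function as a linear function of the first letter. -/
def IsLin.consLin {f : WordFun (TruncPoly k n)} (hf : IsLin k f) (l : List (TruncPoly k n)) :
    TruncPoly k n →ₗ[k] TruncPoly k n where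
  toFun a := f (a :: l)
  map_add' := hf.map_add [] l
  map_smul' := hf.map_smul [] l

theorem IsLin.cons_ext {f g : WordFun (TruncPoly k n)} (hf : IsLin k f) (hg : IsLin k g)
    (l : List (TruncPoly k n)) (h : ∀ i ≤ n, f (gen k n ^ i :: l) = g (gen k n ^ i :: l))
    (a : TruncPoly k n) : f (a :: l) = g (a :: l) :=
  LinearMap.congr_fun (lin_ext (f := hf.consLin l) (g := hg.consLin l) h) a

variable (k n)

/-- The quotient of `x ^ i * x ^ j` by `x ^ (n + 1)`, for `i, j ≤ n`: it is `x ^ (i + j - n - 1)`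
if this exponent is nonnegative, and `0` otherwise. -/
noncomputable def tau (i j : ℕ) : TruncPoly k n :=
  if n + 1 ≤ i + j then gen k n ^ (i + j - (n + 1)) else 0

/-- The bilinear map with values `tau i j` on `(x ^ i, x ^ j)`. -/
noncomputable def tBilin : TruncPoly k n →ₗ[k] TruncPoly k n →ₗ[k] TruncPoly k n :=
  monoLin k n fun i => monoLin k n fun j => tau k n i j

/-- The Euler derivation `x ^ i ↦ i x ^ i`. -/
noncomputable def euler : TruncPoly k n →ₗ[k] TruncPoly k n :=
  monoLin k n fun i => (i : k) • gen k n ^ i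

/-- The two-argument cocycle that represents the generator `t`. -/
noncomputable def cochT : WordFun (TruncPoly k n) := ofBilin (tBilin k n)

/-- The one-argument cocycle that represents the generator `u`. -/
noncomputable def cochU : WordFun (TruncPoly k n) := ofLin (euler k n)

variable {n}

theorem tBilin_gen {i j : ℕ} (hi : i ≤ n) (hj : j ≤ n) :
    tBilin k n (gen k n ^ i) (gen k n ^ j) = tau k n i j := by
  rw [tBilin, monoLin_gen_pow k _ hi, monoLin_gen_pow k _ hj]

theorem tBilin_gen_left {i j : ℕ} (hi : n < i) :
    tBilin k n (gen k n ^ i) (gen k n ^ j) = 0 := by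
  rw [gen_pow_eq_zero k n hi, map_zero, LinearMap.zero_apply]

theorem tBilin_gen_right {i j : ℕ} (hj : n < j) :
    tBilin k n (gen k n ^ i) (gen k n ^ j) = 0 := by
  rw [gen_pow_eq_zero k n hj, map_zero]

theorem tBilin_x (b : TruncPoly k n) :
    tBilin k n (gen k n) b = algebraMap k _ (if n = 0 then 0 else coef k n n b) := by
  rcases Nat.eq_zero_or_pos n with rfl | hn
  · rw [if_pos rfl, map_zero, ← pow_one (gen k 0), gen_pow_eq_zero k 0 one_pos, map_zero,
      LinearMap.zero_apply]
  · rw [if_neg hn.ne', Algebra.algebraMap_eq_smul_one]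
    refine LinearMap.congr_fun (lin_ext (g := (coef k n n).smulRight 1) fun i hi => ?_) b
    have := tBilin_gen k (i := 1) (j := i) hn hi
    rw [pow_one] at this
    rw [this, LinearMap.smulRight_apply, coef_gen_pow k le_rfl, tau]
    by_cases h : i = n
    · subst h
      rw [if_pos (by lia), if_pos rfl, one_smul, show 1 + i - (i + 1) = 0 by lia, pow_zero]
    · rw [if_neg (by lia), if_neg h, zero_smul]

theorem tBilin_one_left (a : TruncPoly k n) : tBilin k n 1 a = 0 := by
  refine LinearMap.congr_fun (lin_ext (g := 0) fun i hi => ?_) a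
  have := tBilin_gen k (i := 0) (j := i) (Nat.zero_le n) hi
  rw [pow_zero] at this
  rw [this, tau, if_neg (by lia)]
  rfl

theorem tBilin_one_right (a : TruncPoly k n) : tBilin k n a 1 = 0 := by
  refine LinearMap.congr_fun (lin_ext (f := (tBilin k n).flip 1) (g := 0) fun i hi => ?_) a
  have := tBilin_gen k (i := i) (j := 0) hi (Nat.zero_le n)
  rw [pow_zero] at this
  rw [LinearMap.flip_apply, this, tau, if_neg (by lia)]
  rfl

theorem euler_gen (i : ℕ) : euler k n (gen k n ^ i) = (i : k) • gen k n ^ i := by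
  refine monoLin_gen_pow_of_zero k _ (fun i hi => ?_) i
  rw [gen_pow_eq_zero k n hi, smul_zero]

theorem euler_one : euler k n 1 = 0 := by
  simpa using euler_gen k (n := n) 0

theorem euler_mul (a b : TruncPoly k n) :
    euler k n (a * b) = a * euler k n b + euler k n a * b := by
  refine LinearMap.congr_fun (lin_ext (f := euler k n ∘ₗ LinearMap.mulRight k b)
    (g := LinearMap.mulRight k (euler k n b) + LinearMap.mulRight k b ∘ₗ euler k n)
    fun i hi => ?_) a
  refine LinearMap.congr_fun (lin_ext
    (f := euler k n ∘ₗ LinearMap.mulLeft k (gen k n ^ i))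
    (g := LinearMap.mulLeft k (gen k n ^ i) ∘ₗ euler k n
      + LinearMap.mulLeft k (euler k n (gen k n ^ i))) fun j hj => ?_) b
  simp only [LinearMap.comp_apply, LinearMap.add_apply, LinearMap.mulLeft_apply, euler_gen,
    ← pow_add, mul_smul_comm, smul_mul_assoc, ← add_smul, Nat.cast_add]
  rw [add_comm (i : k)]

theorem isCochain_cochU : IsCochain k (cochU k n) := isCochain_ofLin _ (euler_one k)

theorem isCochain_cochT : IsCochain k (cochT k n) :=
  isCochain_ofBilin _ (tBilin_one_left k) (tBilin_one_right k)

/-- The differential of a one-argument cochain is the two-argument cochain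
`(a, b) ↦ a * D b - D (a * b) + D a * b`. -/
theorem betaFun_ofLin_eq_ofBilin {A : Type*} [CommRing A] [Algebra k A] (D : A →ₗ[k] A)
    (B : A →ₗ[k] A →ₗ[k] A) (h : ∀ a b, B a b = a * D b - D (a * b) + D a * b) :
    betaFun (ofLin D) = ofBilin B := by
  funext l
  match l with
  | [] => rfl
  | [a] => rw [betaFun_single]; rfl
  | [a, b] => rw [betaFun_pair]; exact (h a b).symm
  | a :: b :: c :: l =>
    rw [betaFun_congr (g := 0) (p := l.length + 2) _ _ rfl, betaFun_zero]
    · rfl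
    · intro w hw
      match w with
      | a :: b :: w => rfl

theorem betaFun_cochU : betaFun (cochU k n) = 0 := by
  rw [cochU, betaFun_ofLin_eq_ofBilin k _ 0 fun a b => ?_]
  · funext l
    match l with
    | [] => rfl
    | [a] => rfl
    | [a, b] => rfl
    | a :: b :: c :: l => rfl
  · rw [euler_mul]
    simp

/-- The coboundary of a linear map can be computed on monomials. -/
theorem coboundary_ext (D : TruncPoly k n →ₗ[k] TruncPoly k n)
    (B : TruncPoly k n →ₗ[k] TruncPoly k n →ₗ[k] TruncPoly k n)
    (h : ∀ i ≤ n, ∀ j ≤ n, B (gen k n ^ i) (gen k n ^ j) =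
      gen k n ^ i * D (gen k n ^ j) - D (gen k n ^ (i + j)) + D (gen k n ^ i) * gen k n ^ j)
    (a b : TruncPoly k n) : B a b = a * D b - D (a * b) + D a * b := by
  refine LinearMap.congr_fun (lin_ext (f := B.flip b)
    (g := LinearMap.mulRight k (D b) - D ∘ₗ LinearMap.mulRight k b + LinearMap.mulRight k b ∘ₗ D)
    fun i hi => ?_) a
  refine LinearMap.congr_fun (lin_ext (f := B (gen k n ^ i))
    (g := LinearMap.mulLeft k (gen k n ^ i) ∘ₗ D - D ∘ₗ LinearMap.mulLeft k (gen k n ^ i)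
      + LinearMap.mulLeft k (D (gen k n ^ i))) fun j hj => ?_) b
  simpa [← pow_add] using h i hi j hj

/-- `T` is a cocycle: `x ^ (n + 1) * T (a, b)` measures by how much the lift of `a * b` to `k[x]`
differs from the product of the lifts of `a` and `b`. -/
theorem cochT_cocycle (a b c : TruncPoly k n) :
    a * tBilin k n b c - tBilin k n (a * b) c + tBilin k n a (b * c) - tBilin k n a b * c = 0 := by
  have key : betaFun (cochT k n) [a, b, c] = (0 : WordFun (TruncPoly k n)) [a, b, c] := by
    have hl := (isCochain_cochT k (n := n)).isLin.betaFun
    have h0 : IsLin k (0 : WordFun (TruncPoly k n)) :=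
      ⟨fun _ _ _ _ => by simp [wzero], fun _ _ _ _ => by simp [wzero]⟩
    refine hl.cons_ext h0 _ (fun i hi => ?_) a
    refine (hl.pre _).cons_ext (h0.pre _) _ (fun j hj => ?_) b
    refine ((hl.pre _).pre _).cons_ext ((h0.pre _).pre _) _ (fun l hl => ?_) c
    change betaFun (cochT k n) [_, _, _] = 0
    rw [betaFun_triple]
    simp only [cochT, ofBilin, ← pow_add]
    rw [tBilin_gen k hj hl, tBilin_gen k hi hj]
    by_cases h1 : i + j ≤ n <;> by_cases h2 : j + l ≤ n
    · rw [tBilin_gen k h1 hl, tBilin_gen k hi h2]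
      simp only [tau, if_neg (show ¬ n + 1 ≤ i + j by lia), if_neg (show ¬ n + 1 ≤ j + l by lia),
        add_assoc]
      ring
    · rw [tBilin_gen k h1 hl, tBilin_gen_right k (by lia)]
      simp only [tau, if_neg (show ¬ n + 1 ≤ i + j by lia), if_pos (show n + 1 ≤ j + l by lia),
        if_pos (show n + 1 ≤ i + j + l by lia), ← pow_add]
      rw [show i + (j + l - (n + 1)) = i + j + l - (n + 1) by lia]
      ring
    · rw [tBilin_gen_left k (by lia), tBilin_gen k hi h2]
      simp only [tau, if_pos (show n + 1 ≤ i + j by lia), if_neg (show ¬ n + 1 ≤ j + l by lia),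
        if_pos (show n + 1 ≤ i + (j + l) by lia), ← pow_add]
      rw [show i + j - (n + 1) + l = i + (j + l) - (n + 1) by lia]
      ring
    · rw [tBilin_gen_left k (by lia), tBilin_gen_right k (by lia)]
      simp only [tau, if_pos (show n + 1 ≤ i + j by lia), if_pos (show n + 1 ≤ j + l by lia),
        ← pow_add]
      rw [show i + (j + l - (n + 1)) = i + j - (n + 1) + l by lia]
      ring
  rw [betaFun_triple] at key
  exact key

theorem betaFun_ofBilin_of_length {A : Type*} [CommRing A] [Algebra k A] (B : A →ₗ[k] A →ₗ[k] A)
    (l : List A) (hl : l.length ≠ 3) : betaFun (ofBilin B) l = 0 := by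
  cases l with
  | nil => rfl
  | cons a l =>
    rw [betaFun_congr (g := 0) (p := l.length) _ _ rfl, betaFun_zero]
    · rfl
    · intro w hw
      match w with
      | [] => rfl
      | [a] => rfl
      | [a, b] => simp at hw hl; lia
      | a :: b :: c :: w => rfl

theorem betaFun_cochT : betaFun (cochT k n) = 0 := by
  funext l
  by_cases hl : l.length = 3
  · match l with
    | [a, b, c] =>
      rw [betaFun_triple]
      exact cochT_cocycle k a b c
  · exact betaFun_ofBilin_of_length k _ l hl

/-- `u ^ 2 = 0`: the square of `U` is the coboundary of `x ^ i ↦ -(i choose 2) x ^ i`. -/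
theorem exists_betaFun_cochU_sq [CharZero k] :
    ∃ g, IsCochain k g ∧ betaFun g = cochU k n * cochU k n := by
  let D := monoLin k n (fun i : ℕ => (-((i : k) * (i - 1) / 2)) • gen k n ^ i)
  have hD : ∀ i : ℕ, D (gen k n ^ i) = (-((i : k) * (i - 1) / 2)) • gen k n ^ i :=
    monoLin_gen_pow_of_zero k _ fun i hi => by rw [gen_pow_eq_zero k n hi, smul_zero]
  refine ⟨ofLin D, isCochain_ofLin _ (by simpa using hD 0), ?_⟩
  let B : TruncPoly k n →ₗ[k] TruncPoly k n →ₗ[k] TruncPoly k n :=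
    (LinearMap.mul k (TruncPoly k n)).compl₁₂ (euler k n) (euler k n)
  have hB : ∀ a b, B a b = euler k n a * euler k n b := fun a b => rfl
  rw [betaFun_ofLin_eq_ofBilin k D B (coboundary_ext k D B fun i hi j hj => ?_)]
  · funext l
    match l with
    | [] => rw [cochU, ofLin_mul_nil]; rfl
    | [a] => rw [cochU, ofLin_mul_cons]; simp [ofLin, ofBilin]
    | [a, b] => rw [cochU, ofLin_mul_cons]; rfl
    | a :: b :: c :: l => rw [cochU, ofLin_mul_cons]; simp [ofLin, ofBilin]
  · simp only [hB, euler_gen, hD, mul_smul_comm, smul_mul_assoc, ← pow_add, smul_smul, ← sub_smul,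
      ← add_smul]
    congr 1
    push_cast
    ring

/-- `u` and `t` commute: the difference is the coboundary of the composite of the Euler derivation
with `T`. -/
theorem exists_betaFun_commutator :
    ∃ g, IsCochain k g ∧ betaFun g = cochT k n * cochU k n - cochU k n * cochT k n := by
  let B : TruncPoly k n →ₗ[k] TruncPoly k n →ₗ[k] TruncPoly k n :=
    (tBilin k n).compr₂ (euler k n)
  have hB : ∀ a b, B a b = euler k n (tBilin k n a b) := fun a b => rfl
  refine ⟨ofBilin B, isCochain_ofBilin _ (fun a => by rw [hB, tBilin_one_left, map_zero])
    (fun a => by rw [hB, tBilin_one_right, map_zero]), ?_⟩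
  funext l
  match l with
  | [] => rw [wsub, cochT, cochU, ofLin_mul_nil, ofBilin_mul_nil, sub_zero]; rfl
  | [a] =>
    rw [wsub, cochT, cochU, ofLin_mul_cons, ofBilin_mul_single, betaFun_single]
    simp [ofBilin]
  | [a, b] =>
    rw [wsub, cochT, cochU, ofLin_mul_cons, ofBilin_mul_cons_cons,
      betaFun_ofBilin_of_length k _ _ (by simp)]
    simp [ofBilin, ofLin]
  | [a, b, c] =>
    rw [wsub, cochT, cochU, ofLin_mul_cons, ofBilin_mul_cons_cons, betaFun_triple]
    simp only [ofBilin, ofLin, hB]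
    have h := congrArg (euler k n) (cochT_cocycle k a b c)
    simp only [map_add, map_sub, map_zero, euler_mul] at h
    linear_combination h
  | a :: b :: c :: d :: l =>
    rw [wsub, cochT, cochU, ofLin_mul_cons, ofBilin_mul_cons_cons,
      betaFun_ofBilin_of_length k _ _ (by simp)]
    simp [ofBilin, ofLin]

/-- `x ^ n t = 0`: up to the factor `n + 1`, it is the coboundary of `x ^ i ↦ i x ^ (i - 1)`. -/
theorem exists_betaFun_gen_pow_smul_cochT [CharZero k] :
    ∃ g, IsCochain k g ∧ betaFun g = gen k n ^ n • cochT k n := by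
  let v : ℕ → TruncPoly k n := fun i => ((i : k) / (n + 1)) • gen k n ^ (i - 1)
  refine ⟨ofLin (monoLin k n v), isCochain_ofLin _ (by simp [monoLin_one, v]), ?_⟩
  let B := (tBilin k n).compr₂ (LinearMap.mulLeft k (gen k n ^ n))
  have hB : ∀ a b, B a b = gen k n ^ n * tBilin k n a b := fun a b => rfl
  rw [betaFun_ofLin_eq_ofBilin k _ B (coboundary_ext k (monoLin k n v) B fun i hi j hj => ?_)]
  · funext l
    match l with
    | [] => simp [ofBilin, cochT, wsmul]
    | [a] => simp [ofBilin, cochT, wsmul]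
    | [a, b] => simp [ofBilin, cochT, wsmul, hB]
    | a :: b :: c :: l => simp [ofBilin, cochT, wsmul]
  · rw [hB, tBilin_gen k hi hj, monoLin_gen_pow k v hi, monoLin_gen_pow k v hj]
    have e1 : gen k n ^ i * v j = ((j : k) / (n + 1)) • gen k n ^ (i + j - 1) := by
      rcases Nat.eq_zero_or_pos j with rfl | h
      · simp [v]
      · rw [mul_smul_comm, ← pow_add, show i + (j - 1) = i + j - 1 by lia]
    have e2 : v i * gen k n ^ j = ((i : k) / (n + 1)) • gen k n ^ (i + j - 1) := by
      rcases Nat.eq_zero_or_pos i with rfl | h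
      · simp [v]
      · rw [smul_mul_assoc, ← pow_add, show i - 1 + j = i + j - 1 by lia]
    rw [e1, e2]
    by_cases h : i + j ≤ n
    · rw [monoLin_gen_pow k v h, tau, if_neg (by lia), mul_zero, ← sub_smul, ← add_smul]
      rw [show (j : k) / (n + 1) - ((i + j : ℕ) : k) / (n + 1) + i / (n + 1) = 0 by
        push_cast; ring, zero_smul]
    · rw [gen_pow_eq_zero k n (i := i + j) (by lia), map_zero, tau, if_pos (by lia), ← pow_add,
        sub_zero, ← add_smul]
      by_cases h2 : i + j = n + 1
      · rw [h2, show n + (n + 1 - (n + 1)) = n by lia, show n + 1 - 1 = n by lia]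
        have h3 : (i : k) + j = n + 1 := by exact_mod_cast h2
        have h4 : (n : k) + 1 ≠ 0 := by exact_mod_cast Nat.succ_ne_zero n
        rw [← add_div, add_comm (j : k), h3, div_self h4, one_smul]
      · rw [gen_pow_eq_zero k n (by lia : n < n + (i + j - (n + 1))),
          gen_pow_eq_zero k n (by lia : n < i + j - 1), smul_zero]

end Trunc

/-! ### Contraction and the decomposition of cocycles -/

section NormalForm

variable {k : Type*} [Field k] {n : ℕ}

/-- The contraction of a cochain with the cycle `∑ₛ x ^ (n - s) [x | x ^ s]`.  For `n > 0` it is a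
left inverse of the multiplication by `T`; on cocycles of length at least two it is also a right
inverse up to coboundaries. -/
noncomputable def contract (f : WordFun (TruncPoly k n)) : WordFun (TruncPoly k n) := fun w =>
  ∑ s ∈ range (n + 1), gen k n ^ (n - s) * f (gen k n :: gen k n ^ s :: w)

/-- The cochain `g` with `g [x, …] = 0` for which `βg` and `f` agree on the words
`[x, x ^ i, …]` with `i < n`. -/
noncomputable def homot (f : WordFun (TruncPoly k n)) : WordFun (TruncPoly k n) := fun l =>
  match l with
  | [] => 0
  | a :: w => -monoLin k n (fun i => ∑ s ∈ range i,
      gen k n ^ (i - 1 - s) * f (gen k n :: gen k n ^ s :: w)) a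

theorem IsCochain.contract {f : WordFun (TruncPoly k n)} (hf : IsCochain k f) :
    IsCochain k (contract f) where
  map_add u v a b := by
    simp only [Hochschild.contract, ← sum_add_distrib, ← mul_add]
    exact sum_congr rfl fun s _ =>
      congrArg _ (hf.map_add (gen k n :: gen k n ^ s :: u) v a b)
  map_smul u v a b := by
    simp only [Hochschild.contract, smul_sum, ← mul_smul_comm]
    exact sum_congr rfl fun s _ =>
      congrArg _ (hf.map_smul (gen k n :: gen k n ^ s :: u) v a b)
  map_one u v := by
    refine sum_eq_zero fun s _ => ?_
    have := hf.map_one (gen k n :: gen k n ^ s :: u) v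
    simp only [List.cons_append] at this
    rw [this, mul_zero]
  bounded := by
    obtain ⟨N, hN⟩ := hf.bounded
    exact ⟨N, fun l hl => sum_eq_zero fun s _ => by
      rw [hN _ (by simp only [List.length_cons]; lia), mul_zero]⟩

theorem homot_cons_gen (f : WordFun (TruncPoly k n)) {i : ℕ} (hi : i ≤ n)
    (w : List (TruncPoly k n)) :
    homot f (gen k n ^ i :: w) = -∑ s ∈ range i,
      gen k n ^ (i - 1 - s) * f (gen k n :: gen k n ^ s :: w) := by
  rw [homot, monoLin_gen_pow k _ hi]

theorem IsCochain.homot {f : WordFun (TruncPoly k n)} (hf : IsCochain k f) :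
    IsCochain k (homot f) where
  map_add u v a b := by
    cases u with
    | nil => simp [Hochschild.homot, add_comm]
    | cons c u =>
      have := fun s => hf.map_add (gen k n :: gen k n ^ s :: u) v a b
      simp only [List.cons_append] at this
      simp only [Hochschild.homot, List.cons_append, this, monoLin_apply, mul_add, sum_add_distrib,
        smul_add, neg_add]
  map_smul u v a b := by
    cases u with
    | nil => simp [Hochschild.homot]
    | cons c u =>
      have := fun s => hf.map_smul (gen k n :: gen k n ^ s :: u) v a b
      simp only [List.cons_append] at this
      simp only [Hochschild.homot, List.cons_append, this, monoLin_apply, mul_smul_comm, ← smul_sum,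
        smul_comm _ a, smul_neg]
  map_one u v := by
    cases u with
    | nil => simp [Hochschild.homot, monoLin_one]
    | cons c u =>
      have := fun s => hf.map_one (gen k n :: gen k n ^ s :: u) v
      simp only [List.cons_append] at this
      simp [Hochschild.homot, this, monoLin_apply]
  bounded := by
    obtain ⟨N, hN⟩ := hf.bounded
    refine ⟨N + 1, fun l hl => ?_⟩
    cases l with
    | nil => rfl
    | cons c l =>
      have := fun s => hN (gen k n :: gen k n ^ s :: l) (by
        simp only [List.length_cons] at hl ⊢; lia)
      simp [Hochschild.homot, this, monoLin_apply]

/-- For `n > 0` this holds because `f` is normalized: the sum that defines `homot f [x, …]` has the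
single term `f [x, 1, …]`. -/
theorem pre_gen_homot {f : WordFun (TruncPoly k n)} (hf : IsCochain k f) :
    pre (gen k n) (homot f) = 0 := by
  funext w
  rcases Nat.eq_zero_or_pos n with rfl | hn
  · have : gen k 0 = 0 := by rw [← pow_one (gen k 0), gen_pow_eq_zero k 0 one_pos]
    simp [pre, homot, this, wzero]
  · have := homot_cons_gen f (i := 1) hn w
    rw [pow_one] at this
    have h1 := hf.map_one [gen k n] w
    simp only [List.cons_append, List.nil_append] at h1
    rw [pre, this]
    simp [h1, wzero]

/-- On the words that start with `x`, the cochain `f - β (homot f)` agrees with `T ∪ contract f`, as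
`T (x, b)` is the coefficient of `x ^ n` in `b`. -/
theorem sub_betaFun_homot_gen {f : WordFun (TruncPoly k n)} (hf : IsCochain k f)
    (b : TruncPoly k n) (w : List (TruncPoly k n)) :
    (f - betaFun (homot f)) (gen k n :: b :: w) = coef k n n b • contract f w := by
  refine LinearMap.congr_fun (lin_ext
    (f := ((hf.sub hf.homot.betaFun).isLin.pre (gen k n)).consLin w)
    (g := (coef k n n).smulRight (contract f w)) fun i hi => ?_) b
  change (f - betaFun (homot f)) (gen k n :: gen k n ^ i :: w) = _
  have e0 : ∀ v : List (TruncPoly k n), (del (0 : WordFun (TruncPoly k n))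
      - sg (0 : WordFun (TruncPoly k n)) * (iota : WordFun (TruncPoly k n))) v = 0 := by
    intro v
    have e1 : sg (0 : WordFun (TruncPoly k n)) = 0 := by funext l; simp [sg, wzero]
    rw [e1, zero_mul, sub_zero]
    simp [del, wzero]
  have e2 : gen k n * homot f (gen k n ^ i :: w)
      = -∑ s ∈ range i, gen k n ^ (i - s) * f (gen k n :: gen k n ^ s :: w) := by
    rw [homot_cons_gen f hi, mul_neg, mul_sum]
    congr 1
    refine sum_congr rfl fun s hs => ?_
    rw [mem_range] at hs
    rw [← mul_assoc, ← pow_succ', show i - 1 - s + 1 = i - s by lia]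
  rw [wsub, betaFun_cons_cons, pre_gen_homot hf, e0, ← pow_succ', e2, LinearMap.smulRight_apply,
    coef_gen_pow k le_rfl]
  by_cases h : i = n
  · subst h
    rw [gen_pow_eq_zero k i (Nat.lt_succ_self i), if_pos rfl, one_smul, contract, sum_range_succ]
    have := (hf.homot.isLin.consLin w).map_zero
    change homot f (0 :: w) = 0 at this
    rw [this]
    simp [add_comm]
  · rw [if_neg h, zero_smul, homot_cons_gen f (by lia), sum_range_succ]
    simp

/-- The cochain `f - β (homot f)` is `T ∪ contract f` as soon as `βf` is a multiple of `T`.  Both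
sides agree on the words that start with `x`, and the value of `βf` on `[x, x ^ i, x ^ j, …]`
determines their values on `[x ^ (i + 1), x ^ j, …]` from those on `[x ^ i, x ^ j, …]`. -/
theorem sub_betaFun_homot {f : WordFun (TruncPoly k n)} (hf : IsCochain k f) (h0 : f [] = 0)
    (h1 : ∀ a, f [a] = 0) (r : WordFun (TruncPoly k n)) (hr : betaFun f = cochT k n * r) :
    f - betaFun (homot f) = cochT k n * contract f := by
  have hf' := hf.sub hf.homot.betaFun
  have hT := (isCochain_cochT k (n := n)).mul hf.contract
  have hx := sub_betaFun_homot_gen hf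
  have hb : betaFun (f - betaFun (homot f)) = cochT k n * r := by
    rw [betaFun_sub, betaFun_betaFun, sub_zero, hr]
  set f' := f - betaFun (homot f) with hf'_def
  have step : ∀ j ≤ n, ∀ w, ∀ i ≤ n,
      f' (gen k n ^ i :: gen k n ^ j :: w) = tau k n i j * contract f w := by
    intro j hj w i
    induction i with
    | zero =>
      intro _
      rw [pow_zero, tau, if_neg (by lia), zero_mul]
      exact hf'.map_one [] _
    | succ i ih =>
      intro hi
      have e := congrFun hb (gen k n :: gen k n ^ i :: gen k n ^ j :: w)
      have e1 : pre (gen k n ^ i) (pre (gen k n) f') = 0 := by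
        funext v
        change f' (gen k n :: gen k n ^ i :: v) = 0
        rw [hx, coef_gen_pow k le_rfl, if_neg (by lia), zero_smul]
      have e2 : (del (0 : WordFun (TruncPoly k n)) - sg (0 : WordFun (TruncPoly k n)) *
          (iota : WordFun (TruncPoly k n))) (gen k n ^ j :: w) = 0 := by
        have : sg (0 : WordFun (TruncPoly k n)) = 0 := by funext l; simp [sg, wzero]
        rw [this, zero_mul, sub_zero]
        simp [del, wzero]
      rw [betaFun_cons_cons, right_cons, e1, e2, cochT, ofBilin_mul_cons_cons, tBilin_x,
        ih (by lia), ← pow_add, ← pow_succ', coef_gen_pow k le_rfl, if_neg (by lia : i ≠ n)] at e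
      have e3 : pre (gen k n) f' (gen k n ^ (i + j) :: w)
          = (if i + j = n then 1 else 0 : k) • contract f w := by
        change f' (gen k n :: gen k n ^ (i + j) :: w) = _
        rw [hx, coef_gen_pow k le_rfl]
      rw [e3] at e
      have e4 : tau k n (i + 1) j = gen k n * tau k n i j
          + algebraMap k _ (if i + j = n then 1 else 0) := by
        simp only [tau]
        by_cases c1 : i + j = n
        · rw [if_pos (by lia), if_neg (by lia), if_pos c1, show i + 1 + j - (n + 1) = 0 by lia]
          simp
        · by_cases c2 : n + 1 ≤ i + j
          · rw [if_pos (by lia), if_pos c2, if_neg c1, ← pow_succ',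
              show i + 1 + j - (n + 1) = i + j - (n + 1) + 1 by lia]
            simp
          · rw [if_neg (by lia), if_neg c2, if_neg c1]
            simp
      rw [Algebra.smul_def] at e
      rw [e4]
      simp only [ite_self, map_zero] at e
      linear_combination -e
  funext l
  match l with
  | [] => rw [cochT, ofBilin_mul_nil, hf'_def, wsub, h0]; simp [betaFun]
  | [a] => rw [cochT, ofBilin_mul_single, hf'_def, wsub, h1, betaFun_single, sub_zero]
  | a :: b :: w =>
    refine hf'.isLin.cons_ext hT.isLin _ (fun i hi => ?_) a
    refine (hf'.isLin.pre _).cons_ext (hT.isLin.pre _) _ (fun j hj => ?_) b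
    change f' _ = (cochT k n * contract f) _
    rw [step j hj w i hi, cochT, ofBilin_mul_cons_cons, tBilin_gen k hi hj]

theorem betaFun_cochT_mul (f : WordFun (TruncPoly k n)) :
    betaFun (cochT k n * f) = cochT k n * betaFun f := by
  rw [betaFun_mul, betaFun_cochT, zero_mul, zero_add]
  congr 1
  exact sg_ofBilin _

theorem tBilin_x_gen_pow (hn : 0 < n) : tBilin k n (gen k n) (gen k n ^ n) = 1 := by
  rw [tBilin_x, if_neg hn.ne', coef_gen_pow k le_rfl, if_pos rfl, map_one]

theorem cochT_mul_injective (hn : 0 < n) {f g : WordFun (TruncPoly k n)}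
    (h : cochT k n * f = cochT k n * g) : f = g := by
  funext w
  have := congrFun h (gen k n :: gen k n ^ n :: w)
  rwa [cochT, ofBilin_mul_cons_cons, ofBilin_mul_cons_cons, tBilin_x_gen_pow hn, one_mul,
    one_mul] at this

theorem betaFun_contract_of_eq (hn : 0 < n) {f : WordFun (TruncPoly k n)} (hf : IsCochain k f)
    (h0 : f [] = 0) (h1 : ∀ a, f [a] = 0) (r : WordFun (TruncPoly k n))
    (hr : betaFun f = cochT k n * r) : betaFun (contract f) = r := by
  apply cochT_mul_injective hn
  rw [← betaFun_cochT_mul, ← sub_betaFun_homot hf h0 h1 r hr, betaFun_sub, betaFun_betaFun,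
    sub_zero, hr]

/-- The part of a cochain on words with at least two letters. -/
noncomputable def tailPart (f : WordFun (TruncPoly k n)) : WordFun (TruncPoly k n) :=
  f - lengthPart 0 f - lengthPart 1 f

theorem tailPart_nil (f : WordFun (TruncPoly k n)) : tailPart f [] = 0 := by
  simp [tailPart, wsub, lengthPart]

theorem tailPart_single (f : WordFun (TruncPoly k n)) (a : TruncPoly k n) :
    tailPart f [a] = 0 := by
  simp [tailPart, wsub, lengthPart]

theorem tailPart_cons_cons (f : WordFun (TruncPoly k n)) (a b : TruncPoly k n)
    (w : List (TruncPoly k n)) : tailPart f (a :: b :: w) = f (a :: b :: w) := by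
  simp [tailPart, wsub, lengthPart]

theorem contract_tailPart (f : WordFun (TruncPoly k n)) : contract (tailPart f) = contract f := by
  funext w
  simp only [contract, tailPart_cons_cons]

theorem IsCochain.tailPart {f : WordFun (TruncPoly k n)} (hf : IsCochain k f) :
    IsCochain k (tailPart f) :=
  (hf.sub (hf.lengthPart 0)).sub (hf.lengthPart 1)

theorem betaFun_tailPart (f : WordFun (TruncPoly k n)) :
    betaFun (tailPart f) = betaFun f - lengthPart 1 (betaFun f) - lengthPart 2 (betaFun f) := by
  rw [tailPart, betaFun_sub, betaFun_sub, betaFun_lengthPart, betaFun_lengthPart]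

theorem lengthPart_zero_fun (p : ℕ) : lengthPart p (0 : WordFun (TruncPoly k n)) = 0 := by
  funext l
  simp [lengthPart, wzero]

/-- On `k[x] / (x)` there are no nonzero normalized cochains of positive length. -/
theorem IsCochain.cons_eq_zero {f : WordFun (TruncPoly k 0)} (hf : IsCochain k f)
    (a : TruncPoly k 0) (w : List (TruncPoly k 0)) : f (a :: w) = 0 := by
  have h0 : IsLin k (0 : WordFun (TruncPoly k 0)) :=
    ⟨fun _ _ _ _ => by simp [wzero], fun _ _ _ _ => by simp [wzero]⟩
  refine hf.isLin.cons_ext h0 w (fun i hi => ?_) a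
  obtain rfl : i = 0 := by lia
  rw [pow_zero]
  exact hf.map_one [] w

theorem betaFun_contract {z : WordFun (TruncPoly k n)} (hz : IsCochain k z)
    (h : betaFun z = 0) : betaFun (contract z) = 0 := by
  rcases Nat.eq_zero_or_pos n with rfl | hn
  · have : contract z = 0 := by
      funext w
      simp [contract, hz.cons_eq_zero, wzero]
    rw [this, betaFun_zero]
  · rw [← contract_tailPart]
    refine betaFun_contract_of_eq hn hz.tailPart (tailPart_nil z) (tailPart_single z) 0 ?_
    rw [betaFun_tailPart, h, lengthPart_zero_fun, lengthPart_zero_fun, sub_zero, sub_zero, mul_zero]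

variable (k n) in
/-- The division by `x`: `x ^ i ↦ x ^ (i - 1)` for `i > 0`, and `1 ↦ 0`. -/
noncomputable def shift : TruncPoly k n →ₗ[k] TruncPoly k n :=
  monoLin k n fun i => if i = 0 then 0 else gen k n ^ (i - 1)

theorem gen_mul_shift {c : TruncPoly k n} (hc : coef k n 0 c = 0) :
    gen k n * shift k n c = c := by
  have h : gen k n * shift k n c = c - coef k n 0 c • 1 := by
    refine LinearMap.congr_fun (lin_ext (f := LinearMap.mulLeft k (gen k n) ∘ₗ shift k n)
      (g := LinearMap.id - (coef k n 0).smulRight 1) fun i hi => ?_) c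
    simp only [LinearMap.comp_apply, LinearMap.sub_apply, LinearMap.smulRight_apply,
      LinearMap.mulLeft_apply, LinearMap.id_apply, coef_gen_pow k (Nat.zero_le n), shift,
      monoLin_gen_pow k _ hi]
    by_cases h : i = 0
    · subst h
      simp
    · rw [if_neg h, if_neg h, zero_smul, sub_zero, ← pow_succ', Nat.sub_add_cancel (by lia)]
  rw [h, hc, zero_smul, sub_zero]

theorem gen_pow_n_mul (c : TruncPoly k n) : gen k n ^ n * c = coef k n 0 c • gen k n ^ n := by
  refine LinearMap.congr_fun (lin_ext (f := LinearMap.mulLeft k (gen k n ^ n))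
    (g := (coef k n 0).smulRight (gen k n ^ n)) fun i hi => ?_) c
  rw [LinearMap.mulLeft_apply, LinearMap.smulRight_apply, coef_gen_pow k (Nat.zero_le n), ← pow_add]
  by_cases h : i = 0
  · subst h
    simp
  · rw [gen_pow_eq_zero k n (by lia), if_neg h, zero_smul]

/-- The values on powers of `x` of a map that satisfies the Leibniz rule for the products
`x * x ^ i` with `i < n`. -/
theorem gen_mul_apply_gen_pow {D : TruncPoly k n → TruncPoly k n} {c : TruncPoly k n}
    (h1 : D 1 = 0)
    (h : ∀ i < n, D (gen k n ^ (i + 1)) = gen k n * D (gen k n ^ i) + c * gen k n ^ i)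
    (i : ℕ) (hi : i ≤ n) : gen k n * D (gen k n ^ i) = (i : k) • (gen k n ^ i * c) := by
  induction i with
  | zero => simp [h1]
  | succ i ih =>
    rw [h i (by lia), mul_add, ih (by lia), Nat.cast_succ, add_smul, one_smul, mul_smul_comm]
    congr 1
    · rw [pow_succ' (gen k n) i, mul_assoc]
    · ring

/-- The one-argument part of a cocycle is a derivation `D`.  As
`(n + 1) x ^ n D x = D (x ^ (n + 1))` vanishes, `D x` is divisible by `x`, and
`D` is a multiple of the Euler derivation. -/
theorem shift_smul_cochU [CharZero k] {z : WordFun (TruncPoly k n)} (hz : IsCochain k z)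
    (h : betaFun z = 0) : lengthPart 1 z = shift k n (z [gen k n]) • cochU k n := by
  have h1 : z [1] = 0 := hz.map_one [] []
  have hs : ∀ a b, z [a * b] = a * z [b] + z [a] * b := by
    intro a b
    have := congrFun h [a, b]
    rw [betaFun_pair, wzero] at this
    linear_combination -this
  have hs' : ∀ i, z [gen k n ^ (i + 1)]
      = gen k n * z [gen k n ^ i] + z [gen k n] * gen k n ^ i := by
    intro i
    rw [pow_succ', hs]
  have hc : coef k n 0 (z [gen k n]) = 0 := by
    have e := hs' n
    rw [gen_mul_apply_gen_pow (D := fun a => z [a]) h1 (fun i _ => hs' i) n le_rfl,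
      gen_pow_eq_zero k n (Nat.lt_succ_self n), mul_comm (z _), gen_pow_n_mul, smul_smul,
      ← add_smul] at e
    have hz0 : z [0] = 0 := (hz.isLin.consLin []).map_zero
    have e' := congrArg (coef k n n) e
    rw [hz0, map_zero, map_smul, coef_gen_pow k le_rfl, if_pos rfl, smul_eq_mul, mul_one] at e'
    have h4 : (n : k) + 1 ≠ 0 := by exact_mod_cast Nat.succ_ne_zero n
    have e2 : ((n : k) + 1) * coef k n 0 (z [gen k n]) = 0 := by linear_combination -e'
    exact (mul_eq_zero.1 e2).resolve_left h4
  set q := shift k n (z [gen k n]) with hq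
  have hq' : gen k n * q = z [gen k n] := gen_mul_shift hc
  funext l
  match l with
  | [] => simp [lengthPart, wsmul, cochU, ofLin]
  | [a] =>
    refine (hz.lengthPart 1).isLin.cons_ext ((isCochain_cochU k).elem_smul q).isLin []
      (fun i hi => ?_) a
    change z [gen k n ^ i] = q * euler k n (gen k n ^ i)
    rw [euler_gen]
    clear hi
    induction i with
    | zero => simp [h1]
    | succ i ih =>
      rw [hs', ih, ← hq', Nat.cast_succ, add_smul, one_smul, pow_succ' (gen k n) i, mul_add,
        mul_smul_comm, mul_smul_comm, mul_smul_comm]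
      congr 1
      · congr 1; ring
      · ring
  | a :: b :: l => simp [lengthPart, wsmul, cochU, ofLin]

theorem lengthPart_zero_eq (z : WordFun (TruncPoly k n)) :
    lengthPart 0 z = z [] • (1 : WordFun (TruncPoly k n)) := by
  funext l
  cases l with
  | nil => simp [lengthPart, wsmul, wone_nil]
  | cons a l => simp [lengthPart, wsmul, wone_cons]

/-- Up to a coboundary, a cocycle is the sum of a multiple of `1`, a multiple of `U`, and the
product of `T` with its contraction. -/
theorem cocycle_decomposition [CharZero k] {z : WordFun (TruncPoly k n)} (hz : IsCochain k z)
    (h : betaFun z = 0) : ∃ g, IsCochain k g ∧ z = z [] • (1 : WordFun (TruncPoly k n))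
      + shift k n (z [gen k n]) • cochU k n + cochT k n * contract z + betaFun g := by
  refine ⟨homot (tailPart z), hz.tailPart.homot, ?_⟩
  have e : betaFun (tailPart z) = cochT k n * 0 := by
    rw [betaFun_tailPart, h, lengthPart_zero_fun, lengthPart_zero_fun, sub_zero, sub_zero, mul_zero]
  rw [← shift_smul_cochU hz h, ← lengthPart_zero_eq, ← contract_tailPart z,
    ← sub_betaFun_homot hz.tailPart (tailPart_nil z) (tailPart_single z) 0 e]
  rw [tailPart]
  abel

/-- The decomposition of a cocycle is unique up to the relations `u x ^ n = 0` and `x ^ n t = 0`. -/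
theorem of_decomposition_coboundary {a q : TruncPoly k n} {h g : WordFun (TruncPoly k n)}
    (hh : IsCochain k h) (hg : IsCochain k g)
    (e : a • (1 : WordFun (TruncPoly k n)) + q • cochU k n + cochT k n * h = betaFun g) :
    a = 0 ∧ gen k n * q = 0 ∧ ∃ (c : k) (g' : WordFun (TruncPoly k n)), IsCochain k g' ∧
      h = (c • gen k n ^ n) • (1 : WordFun (TruncPoly k n)) + betaFun g' := by
  have hone : ∀ (b : TruncPoly k n) (l : List (TruncPoly k n)),
      (1 : WordFun (TruncPoly k n)) (b :: l) = 0 := wone_cons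
  have e0 := congrFun e []
  have e1 := congrFun e [gen k n]
  have hgen : euler k n (gen k n) = gen k n := by simpa using euler_gen k (n := n) 1
  simp only [wadd, wsmul, wone_nil, cochT, ofBilin_mul_nil, ofBilin_mul_single, cochU, ofLin,
    betaFun_single, hone, hgen, smul_eq_mul, mul_zero, mul_one, add_zero, zero_add] at e0 e1
  refine ⟨e0, by rw [mul_comm, e1], ?_⟩
  -- For `n = 0` every normalized cochain lives on the empty word, where `A = k`.
  rcases Nat.eq_zero_or_pos n with rfl | hn
  · refine ⟨coef k 0 0 (h []), 0, ?_, ?_⟩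
    · have := hg.smul (0 : k)
      rwa [zero_smul] at this
    · rw [betaFun_zero, add_zero]
      funext l
      cases l with
      | nil =>
        rw [wsmul, wone_nil, smul_eq_mul, mul_one]
        conv_lhs => rw [sum_coef k (h [])]
        simp
      | cons b l => rw [hh.cons_eq_zero, wsmul, hone, smul_zero]
  -- The part of `g` on words of length at least two bounds `T ∪ (h - h [])`; dividing by `T` shows
  -- that `h - h []` is a coboundary.
  have hr : betaFun (tailPart g)
      = cochT k n * (h - h [] • (1 : WordFun (TruncPoly k n))) := by
    rw [betaFun_tailPart]
    funext l
    match l with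
    | [] => rw [cochT, ofBilin_mul_nil]; simp [wsub, lengthPart, betaFun]
    | [b] => rw [cochT, ofBilin_mul_single]; simp [wsub, lengthPart]
    | [b, c] =>
      rw [cochT, ofBilin_mul_cons_cons]
      simp [wsub, lengthPart, wsmul, wone_nil]
    | b :: c :: d :: l =>
      rw [← e, cochT, ofBilin_mul_cons_cons]
      simp [wsub, wadd, lengthPart, wsmul, hone, cochU, ofLin, ofBilin_mul_cons_cons]
  -- The part of `g` on words of length one is a derivation up to `h [] T`; evaluating it on
  -- `x ^ (n + 1) = 0` shows that `h []` is a multiple of `x ^ n`.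
  have hpair : ∀ b c, b * g [c] - g [b * c] + g [b] * c = tBilin k n b c * h [] := by
    intro b c
    have := congrFun e [b, c]
    simp only [wadd, wsmul, cochT, ofBilin_mul_cons_cons, cochU, ofLin, betaFun_pair, hone,
      smul_zero, zero_add] at this
    exact this.symm
  have hs : ∀ i, g [gen k n ^ (i + 1)] = gen k n * g [gen k n ^ i] + g [gen k n] * gen k n ^ i
      - (if i = n then 1 else 0 : k) • h [] := by
    intro i
    have := hpair (gen k n) (gen k n ^ i)
    rw [tBilin_x, if_neg hn.ne', coef_gen_pow k le_rfl, ← Algebra.smul_def, ← pow_succ'] at this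
    linear_combination -this
  have hD := gen_mul_apply_gen_pow (D := fun a => g [a]) (hg.map_one [] [])
    (fun i hi => by rw [hs, if_neg hi.ne, zero_smul, sub_zero]) n le_rfl
  have hg0 : g [0] = 0 := (hg.isLin.consLin []).map_zero
  have hn' := hs n
  rw [gen_pow_eq_zero k n (Nat.lt_succ_self n), hg0, if_pos rfl, one_smul, hD,
    mul_comm (g _), gen_pow_n_mul, smul_smul, ← add_smul] at hn'
  refine ⟨(n : k) * coef k n 0 (g [gen k n]) + coef k n 0 (g [gen k n]), contract (tailPart g),
    hg.tailPart.contract, ?_⟩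
  rw [betaFun_contract_of_eq hn hg.tailPart (tailPart_nil g) (tailPart_single g) _ hr,
    ← sub_eq_zero.1 hn'.symm]
  abel

end NormalForm

/-! ### Degrees -/

section Degree

variable {k : Type*} [Field k] {n : ℕ} {m : ℤ}

theorem gen_pow_mem_truncDeg {d : ℤ} {i : ℕ} (h : d = -2 * m * i) :
    gen k n ^ i ∈ truncDeg k n m d :=
  Submodule.subset_span ⟨i, h, rfl⟩

/-- Membership of the image of a homogeneous element only has to be checked on monomials. -/
theorem map_mem_of_truncDeg {M : Type*} [AddCommGroup M] [Module k M] (S : Submodule k M)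
    (D : TruncPoly k n →ₗ[k] M) {d : ℤ}
    (h : ∀ i ≤ n, d = -2 * m * i → D (gen k n ^ i) ∈ S) {a : TruncPoly k n}
    (ha : a ∈ truncDeg k n m d) : D a ∈ S := by
  refine Submodule.span_le (p := S.comap D).2 ?_ ha
  rintro _ ⟨i, hi, rfl⟩
  by_cases hin : i ≤ n
  · exact h i hin hi
  · rw [gen_pow_eq_zero k n (by lia)]
    exact Submodule.zero_mem _

theorem mul_mem_truncDeg {d e : ℤ} {a b : TruncPoly k n} (ha : a ∈ truncDeg k n m d)
    (hb : b ∈ truncDeg k n m e) : a * b ∈ truncDeg k n m (d + e) := by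
  refine map_mem_of_truncDeg (truncDeg k n m (d + e)) (LinearMap.mulRight k b) (fun i _ hi => ?_) ha
  refine map_mem_of_truncDeg (truncDeg k n m (d + e)) (LinearMap.mulLeft k (gen k n ^ i))
    (fun j _ hj => ?_) hb
  rw [LinearMap.mulLeft_apply, ← pow_add]
  exact gen_pow_mem_truncDeg (by rw [hi, hj]; push_cast; ring)

theorem topCoeff_eq_zero_of_mem {d : ℤ} {a : TruncPoly k n} (ha : a ∈ truncDeg k n m d)
    (hd : d ≠ -2 * m * n) : topCoeff k n a = 0 := by
  have := map_mem_of_truncDeg (⊥ : Submodule k k) (topCoeff k n) (fun i _ hi => ?_) ha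
  · simpa using this
  · rw [topCoeff_gen_pow, if_neg (by rintro rfl; exact hd hi)]
    exact Submodule.zero_mem _

theorem HasDegree.pre {A : Type*} [CommRing A] [Algebra k A] {𝒜 : ℤ → Submodule k A} {d i : ℤ}
    {f : WordFun A} (hf : HasDegree k 𝒜 d f) {a : A} (ha : a ∈ 𝒜 i) :
    HasDegree k 𝒜 (d + (i + 1)) (pre a f) := by
  intro l e h
  have := hf (a :: l) (i :: e) (List.Forall₂.cons ha h)
  rwa [List.map_cons, List.sum_cons, ← add_assoc] at this

theorem HasDegree.mul {d d' : ℤ} {f g : WordFun (TruncPoly k n)}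
    (hf : HasDegree k (truncDeg k n m) d f) (hg : HasDegree k (truncDeg k n m) d' g) :
    HasDegree k (truncDeg k n m) (d + d') (f * g) := by
  intro l e h
  induction h generalizing f d with
  | nil =>
    have := mul_mem_truncDeg (hf [] [] .nil) (hg [] [] .nil)
    simpa [wmul_nil] using this
  | @cons a i l e ha h ih =>
    rw [wmul_cons]
    refine Submodule.add_mem _ ?_ ?_
    · have := mul_mem_truncDeg (hf [] [] .nil) (hg (a :: l) (i :: e) (.cons ha h))
      simpa [add_assoc] using this
    · have := ih (hf.pre ha)
      rwa [show d + (i + 1) + d' + (e.map (fun i => i + 1)).sum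
        = d + d' + ((i :: e).map (fun i => i + 1)).sum by
          rw [List.map_cons, List.sum_cons]; ring] at this

theorem hasDegree_smul_one {d : ℤ} {a : TruncPoly k n} (ha : a ∈ truncDeg k n m d) :
    HasDegree k (truncDeg k n m) d (a • (1 : WordFun (TruncPoly k n))) := by
  intro l e h
  cases h with
  | nil => simpa [wsmul, wone_nil] using ha
  | cons _ _ =>
    rw [wsmul, wone_cons, smul_zero]
    exact Submodule.zero_mem _

theorem hasDegree_cochU : HasDegree k (truncDeg k n m) (-1) (cochU k n) := by
  intro l e h
  match l, e, h with
  | [], _, _ => exact Submodule.zero_mem _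
  | [a], [i], .cons ha _ =>
    refine map_mem_of_truncDeg _ (euler k n) (fun j _ hj => ?_) ha
    rw [euler_gen]
    exact Submodule.smul_mem _ _ (gen_pow_mem_truncDeg (by simp [hj]))
  | a :: b :: l, _, _ => exact Submodule.zero_mem _

theorem hasDegree_cochT :
    HasDegree k (truncDeg k n m) (2 * m * n + 2 * (m - 1)) (cochT k n) := by
  intro l e h
  match l, e, h with
  | [], _, _ => exact Submodule.zero_mem _
  | [a], _, _ => exact Submodule.zero_mem _
  | [a, b], [i, j], .cons ha (.cons hb _) =>
    refine map_mem_of_truncDeg _ ((tBilin k n).flip b) (fun r hr hi => ?_) ha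
    refine map_mem_of_truncDeg _ (tBilin k n (gen k n ^ r)) (fun s hs hj => ?_) hb
    rw [tBilin_gen k hr hs, tau]
    split_ifs with h
    · refine gen_pow_mem_truncDeg ?_
      obtain ⟨p, hp⟩ := Nat.exists_eq_add_of_le h
      rw [hp, Nat.add_sub_cancel_left, hi, hj]
      have hp' : (r : ℤ) + s = n + 1 + p := by exact_mod_cast hp
      simp
      linear_combination -2 * m * hp'
    · exact Submodule.zero_mem _
  | a :: b :: c :: l, _, _ => exact Submodule.zero_mem _

theorem HasDegree.contract {d : ℤ} {f : WordFun (TruncPoly k n)}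
    (hf : HasDegree k (truncDeg k n m) d f) :
    HasDegree k (truncDeg k n m) (d - (2 * m * n + 2 * (m - 1))) (contract f) := by
  intro l e h
  refine Submodule.sum_mem _ fun s hs => ?_
  rw [mem_range] at hs
  have h1 : gen k n ∈ truncDeg k n m (-2 * m) := by
    have := gen_pow_mem_truncDeg (k := k) (n := n) (m := m) (d := -2 * m) (i := 1) (by simp)
    rwa [pow_one] at this
  have := mul_mem_truncDeg (gen_pow_mem_truncDeg (k := k) (n := n) (m := m) (i := n - s) rfl)
    (hf (gen k n :: gen k n ^ s :: l) _ (.cons h1 (.cons (gen_pow_mem_truncDeg rfl) h)))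
  convert this using 1
  rw [List.map_cons, List.sum_cons, List.map_cons, List.sum_cons,
    Nat.cast_sub (Nat.lt_succ_iff.1 hs)]
  ring_nf

theorem forall₂_rotate {α β : Type*} {R : α → β → Prop} {l : List α} {e : List β}
    (h : List.Forall₂ R l e) (i : ℕ) : List.Forall₂ R (l.rotate i) (e.rotate i) := by
  induction i generalizing l e with
  | zero => simpa using h
  | succ i ih =>
    cases h with
    | nil => simp
    | cons ha h =>
      rw [List.rotate_cons_succ, List.rotate_cons_succ]
      exact ih (List.rel_append h (.cons ha .nil))

/-- `⟨1, -⟩` vanishes on all degrees but `-2 m n`, so the coefficient of `x ^ (n - j)` in `Δ f`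
vanishes on words of the wrong degree. -/
theorem HasDegree.truncDeltaFun {d : ℤ} {f : WordFun (TruncPoly k n)}
    (hf : HasDegree k (truncDeg k n m) d f) :
    HasDegree k (truncDeg k n m) (d + 1) (truncDeltaFun k n f) := by
  intro l e h
  rw [Hochschild.truncDeltaFun, deltaFun]
  refine Submodule.sum_mem _ fun j _ => ?_
  have hj : (j : ℕ) ≤ n := Nat.lt_succ_iff.1 j.2
  by_cases hd : d + ((-2 * m * (j : ℕ) + 1) + (e.map (fun i => i + 1)).sum) = -2 * m * n
  · refine Submodule.smul_mem _ _ (gen_pow_mem_truncDeg ?_)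
    push_cast [hj]
    linear_combination hd
  · rw [sum_eq_zero, mul_zero, zero_smul]
    · exact Submodule.zero_mem _
    · intro i _
      have h1 := hf _ _ (forall₂_rotate (R := fun a i => a ∈ truncDeg k n m i) (List.Forall₂.cons
        (gen_pow_mem_truncDeg (k := k) (n := n) (m := m) (i := j) rfl) h) i)
      rw [topCoeff_eq_zero_of_mem h1, mul_zero]
      rwa [List.map_rotate, (List.rotate_perm _ _).sum_eq, List.map_cons, List.sum_cons]

theorem shift_mem_truncDeg {d : ℤ} {a : TruncPoly k n} (ha : a ∈ truncDeg k n m d) :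
    shift k n a ∈ truncDeg k n m (d + 2 * m) := by
  refine map_mem_of_truncDeg _ (shift k n) (fun i hi hd => ?_) ha
  rw [shift, monoLin_gen_pow k _ hi]
  split_ifs with h
  · exact Submodule.zero_mem _
  · refine gen_pow_mem_truncDeg ?_
    rw [hd]
    push_cast [Nat.pos_of_ne_zero h]
    ring

end Degree

/-! ### Classes and the structure of the Hochschild cohomology -/

section Cohomology

variable (k : Type*) [Field k] (n : ℕ)

/-- The algebra `A`, as cochains on the empty word. -/
noncomputable def constCocycle : TruncPoly k n →ₐ[k] cocycles k (TruncPoly k n) :=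
  (IsScalarTower.toAlgHom k (TruncPoly k n) (WordFun (TruncPoly k n))).codRestrict _ fun a => by
    rw [IsScalarTower.coe_toAlgHom', Algebra.algebraMap_eq_smul_one]
    exact ⟨isCochain_one.elem_smul a, by rw [betaFun_smul, betaFun_one, smul_zero]⟩

theorem coe_constCocycle (a : TruncPoly k n) :
    (constCocycle k n a : WordFun (TruncPoly k n)) = a • (1 : WordFun (TruncPoly k n)) :=
  Algebra.algebraMap_eq_smul_one a

/-- `U` as a cocycle. -/
noncomputable def cocycleU : cocycles k (TruncPoly k n) :=
  ⟨cochU k n, isCochain_cochU k, betaFun_cochU k⟩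

/-- `T` as a cocycle. -/
noncomputable def cocycleT : cocycles k (TruncPoly k n) :=
  ⟨cochT k n, isCochain_cochT k, betaFun_cochT k⟩

/-- The algebra homomorphism from `A` to its Hochschild cohomology. -/
noncomputable def hhConst : TruncPoly k n →ₐ[k] HH k (TruncPoly k n) :=
  (Ideal.Quotient.mkₐ k (coboundaries k (TruncPoly k n))).comp (constCocycle k n)

theorem hhConst_apply (a : TruncPoly k n) :
    hhConst k n a = Ideal.Quotient.mk _ (constCocycle k n a) := rfl

/-- The class of `U`. -/
noncomputable def hhU : HH k (TruncPoly k n) := Ideal.Quotient.mk _ (cocycleU k n)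

/-- The class of `T`. -/
noncomputable def hhT : HH k (TruncPoly k n) := Ideal.Quotient.mk _ (cocycleT k n)

variable {k n}

/-- The contraction of a cocycle. -/
noncomputable def contractCocycle (z : cocycles k (TruncPoly k n)) : cocycles k (TruncPoly k n) :=
  ⟨contract z, z.2.1.contract, betaFun_contract z.2.1 z.2.2⟩

theorem mk_eq_mk_of_coboundary {z w : cocycles k (TruncPoly k n)} {g : WordFun (TruncPoly k n)}
    (hg : IsCochain k g) (h : (z : WordFun (TruncPoly k n)) = w + betaFun g) :
    (Ideal.Quotient.mk (coboundaries k (TruncPoly k n)) z) = Ideal.Quotient.mk _ w := by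
  rw [Ideal.Quotient.eq]
  refine ⟨g, hg, ?_⟩
  rw [AddSubgroupClass.coe_sub, h, add_sub_cancel_left]

/-- Every class has the form `a + u q + t h`, with explicit `a`, `q` and `h`. -/
theorem hh_decomposition [CharZero k] (z : cocycles k (TruncPoly k n)) :
    (Ideal.Quotient.mk _ z : HH k (TruncPoly k n)) =
      hhConst k n ((z : WordFun (TruncPoly k n)) [])
      + hhU k n * hhConst k n (shift k n ((z : WordFun (TruncPoly k n)) [gen k n]))
      + hhT k n * Ideal.Quotient.mk _ (contractCocycle z) := by
  obtain ⟨g, hg, e⟩ := cocycle_decomposition z.2.1 z.2.2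
  rw [hhConst_apply, hhConst_apply, hhU, hhT, ← map_mul, ← map_mul, ← map_add, ← map_add]
  refine mk_eq_mk_of_coboundary hg (e.trans ?_)
  simp only [Subalgebra.coe_add, Subalgebra.coe_mul, coe_constCocycle, mul_smul_comm, mul_one]
  rfl

/-- A class `a + u q + t h` vanishes only if `u q` and `t h` vanish by `u x ^ n = 0` and
`x ^ n t = 0`. -/
theorem hh_injectivity {a q : TruncPoly k n} {h : HH k (TruncPoly k n)}
    (e : hhConst k n a + hhU k n * hhConst k n q + hhT k n * h = 0) :
    a = 0 ∧ gen k n * q = 0 ∧ ∃ c : k, h = hhConst k n (c • gen k n ^ n) := by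
  obtain ⟨z, rfl⟩ := Ideal.Quotient.mk_surjective h
  rw [hhConst_apply, hhConst_apply, hhU, hhT, ← map_mul, ← map_mul, ← map_add, ← map_add,
    Ideal.Quotient.eq_zero_iff_mem] at e
  obtain ⟨g, hg, e⟩ := e
  simp only [Subalgebra.coe_add, Subalgebra.coe_mul, coe_constCocycle, mul_smul_comm, mul_one] at e
  obtain ⟨h1, h2, c, g', hg', h3⟩ := of_decomposition_coboundary z.2.1 hg e.symm
  exact ⟨h1, h2, c, mk_eq_mk_of_coboundary hg' (h3.trans (by
    rw [← coe_constCocycle]; rfl))⟩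

theorem hhU_sq [CharZero k] : hhU k n * hhU k n = 0 := by
  obtain ⟨g, hg, e⟩ := exists_betaFun_cochU_sq k (n := n)
  rw [hhU, ← map_mul, Ideal.Quotient.eq_zero_iff_mem]
  exact ⟨g, hg, e⟩

theorem hhT_mul_hhConst [CharZero k] : hhT k n * hhConst k n (gen k n ^ n) = 0 := by
  obtain ⟨g, hg, e⟩ := exists_betaFun_gen_pow_smul_cochT k (n := n)
  rw [hhT, hhConst_apply, ← map_mul, Ideal.Quotient.eq_zero_iff_mem]
  refine ⟨g, hg, ?_⟩
  rw [e, Subalgebra.coe_mul, coe_constCocycle, mul_smul_comm, mul_one]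
  rfl

theorem hhT_mul_hhU : hhT k n * hhU k n = hhU k n * hhT k n := by
  obtain ⟨g, hg, e⟩ := exists_betaFun_commutator k (n := n)
  rw [hhT, hhU, ← map_mul, ← map_mul, Ideal.Quotient.eq]
  exact ⟨g, hg, e⟩

theorem hhConst_mul (a : TruncPoly k n) (h : HH k (TruncPoly k n)) :
    hhConst k n a * h = h * hhConst k n a := by
  obtain ⟨z, rfl⟩ := Ideal.Quotient.mk_surjective h
  rw [hhConst_apply, ← map_mul, ← map_mul]
  congr 1
  apply Subtype.ext
  rw [Subalgebra.coe_mul, Subalgebra.coe_mul, coe_constCocycle, mul_smul_comm, smul_mul_assoc,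
    mul_one, one_mul]

theorem gen_pow_smul_cochU : gen k n ^ n • cochU k n = 0 := by
  funext l
  match l with
  | [] => simp [wsmul, wzero, cochU, ofLin]
  | [a] =>
    change gen k n ^ n * euler k n a = 0
    refine LinearMap.congr_fun (lin_ext (f := LinearMap.mulLeft k (gen k n ^ n) ∘ₗ euler k n)
      (g := 0) fun i hi => ?_) a
    rw [LinearMap.comp_apply, LinearMap.mulLeft_apply, euler_gen, mul_smul_comm, ← pow_add]
    rcases Nat.eq_zero_or_pos i with rfl | h
    · simp
    · rw [gen_pow_eq_zero k n (by lia), smul_zero, LinearMap.zero_apply]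
  | a :: b :: l => simp [wsmul, wzero, cochU, ofLin]

theorem hhU_mul_hhConst : hhU k n * hhConst k n (gen k n ^ n) = 0 := by
  rw [hhU, hhConst_apply, ← map_mul, ← map_zero (Ideal.Quotient.mk _)]
  congr 1
  apply Subtype.ext
  rw [Subalgebra.coe_mul, coe_constCocycle, mul_smul_comm, mul_one]
  exact gen_pow_smul_cochU

/-- A property of classes that is stable under `h ↦ a + u q + t h` holds for all classes. -/
theorem hh_induction [CharZero k] {P : HH k (TruncPoly k n) → Prop} (h0 : P 0)
    (h : ∀ (a q : TruncPoly k n) (c : HH k (TruncPoly k n)), P c →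
      P (hhConst k n a + hhU k n * hhConst k n q + hhT k n * c)) (c : HH k (TruncPoly k n)) :
    P c := by
  obtain ⟨z, rfl⟩ := Ideal.Quotient.mk_surjective c
  obtain ⟨N, hN⟩ := z.2.1.bounded
  induction N generalizing z with
  | zero =>
    have : z = 0 := Subtype.ext (funext fun l => hN l (Nat.zero_le _))
    rw [this, map_zero]
    exact h0
  | succ N ih =>
    rw [hh_decomposition]
    refine h _ _ _ (ih _ fun l hl => ?_)
    change contract (z : WordFun (TruncPoly k n)) l = 0
    rw [contract]
    refine sum_eq_zero fun s _ => ?_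
    rw [hN _ (by simp only [List.length_cons]; lia), mul_zero]

/-- The Hochschild cohomology is generated by `A`, `u` and `t`, which commute with each other. -/
theorem hh_mul_comm [CharZero k] (a b : HH k (TruncPoly k n)) : a * b = b * a := by
  have hU : ∀ c : HH k (TruncPoly k n), hhU k n * c = c * hhU k n := by
    refine hh_induction (by simp) fun a q c hc => ?_
    rw [mul_add, mul_add, add_mul, add_mul, hhConst_mul, ← mul_assoc (hhU k n) (hhT k n),
      ← hhT_mul_hhU, mul_assoc, hc, mul_assoc, mul_assoc, hhConst_mul]
  have hT : ∀ c : HH k (TruncPoly k n), hhT k n * c = c * hhT k n := by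
    refine hh_induction (by simp) fun a q c hc => ?_
    rw [mul_add, mul_add, add_mul, add_mul, hhConst_mul, ← mul_assoc (hhT k n) (hhU k n),
      hhT_mul_hhU, mul_assoc, mul_assoc, hhConst_mul, mul_assoc, hc]
  revert a
  refine hh_induction (by simp) fun a q c hc => ?_
  rw [add_mul, add_mul, mul_add, mul_add, hhConst_mul, mul_assoc, mul_assoc, hc, hhConst_mul,
    ← mul_assoc, hU, ← mul_assoc, hT, mul_assoc, mul_assoc]

end Cohomology

/-! ### The isomorphism with the model -/

section ModelRing

open MvPolynomial

variable {k : Type*} [Field k] {n : ℕ}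

theorem exists_modelHom_of_commRing {H : Type*} [CommRing H] [Algebra k H] {x u t : H}
    (hx : x ^ (n + 1) = 0) (hu : u ^ 2 = 0) (ht : x ^ n * t = 0) (hux : u * x ^ n = 0) :
    ∃ Φ : Model k n →ₐ[k] H, Φ (modelX k n) = x ∧ Φ (modelU k n) = u ∧ Φ (modelT k n) = t := by
  have h : ∀ a ∈ modelIdeal k n, aeval (R := k) ![x, u, t] a = 0 := by
    intro a ha
    have : modelIdeal k n ≤ RingHom.ker (aeval (R := k) ![x, u, t]) := by
      rw [modelIdeal, Ideal.span_le]
      rintro _ (rfl | rfl | rfl | rfl) <;> simp [hx, hu, ht, hux]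
    exact this ha
  refine ⟨Ideal.Quotient.liftₐ _ (aeval ![x, u, t]) h, ?_, ?_, ?_⟩
  · exact (Ideal.Quotient.lift_mk _ _ h).trans (by simp)
  · exact (Ideal.Quotient.lift_mk _ _ h).trans (by simp)
  · exact (Ideal.Quotient.lift_mk _ _ h).trans (by simp)

/-- The version of `exists_modelHom_of_commRing` for a ring that is only known to be commutative by
a proof, such as the Hochschild cohomology. -/
theorem exists_modelHom {H : Type*} [Ring H] [Algebra k H] (hc : ∀ a b : H, a * b = b * a)
    {x u t : H} (hx : x ^ (n + 1) = 0) (hu : u ^ 2 = 0) (ht : x ^ n * t = 0)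
    (hux : u * x ^ n = 0) :
    ∃ Φ : Model k n →ₐ[k] H, Φ (modelX k n) = x ∧ Φ (modelU k n) = u ∧ Φ (modelT k n) = t := by
  let _ : CommRing H := { ‹Ring H› with mul_comm := hc }
  exact exists_modelHom_of_commRing hx hu ht hux

variable (k n) in
theorem model_relations : modelX k n ^ (n + 1) = 0 ∧ modelU k n ^ 2 = 0 ∧
    modelX k n ^ n * modelT k n = 0 ∧ modelU k n * modelX k n ^ n = 0 := by
  have h : ∀ a ∈ ({X 0 ^ (n + 1), X 1 ^ 2, X 0 ^ n * X 2, X 1 * X 0 ^ n} :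
      Set (MvPolynomial (Fin 3) k)), Ideal.Quotient.mk (modelIdeal k n) a = 0 := fun a ha =>
    Ideal.Quotient.eq_zero_iff_mem.2 (Ideal.subset_span ha)
  refine ⟨?_, ?_, ?_, ?_⟩
  · exact h _ (by simp)
  · exact h _ (by simp)
  · exact h _ (by simp)
  · exact h _ (by simp)

variable (k n) in
/-- The homomorphism from `k[x] / (x ^ (n + 1))` to the model. -/
noncomputable def modelConst : TruncPoly k n →ₐ[k] Model k n :=
  AdjoinRoot.liftAlgHom _ (Algebra.ofId k _) (modelX k n) (by
    simpa using (model_relations k n).1)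

theorem modelConst_gen : modelConst k n (gen k n) = modelX k n := by
  simp [modelConst]

/-- The elements `a₀ + u q₀ + t (a₁ + u q₁ + t (… + t a_N))` of the model, where `aᵢ` and `qᵢ` are
polynomials in `x`. -/
def IsNormalForm : ℕ → Model k n → Prop
  | 0, y => ∃ a, y = modelConst k n a
  | N + 1, y => ∃ a q y', IsNormalForm N y' ∧
      y = modelConst k n a + modelU k n * modelConst k n q + modelT k n * y'

theorem IsNormalForm.const (N : ℕ) (a : TruncPoly k n) : IsNormalForm N (modelConst k n a) := by
  induction N generalizing a with
  | zero => exact ⟨a, rfl⟩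
  | succ N ih => exact ⟨a, 0, _, ih 0, by simp⟩

theorem IsNormalForm.add {N : ℕ} {y z : Model k n} (hy : IsNormalForm N y)
    (hz : IsNormalForm N z) : IsNormalForm N (y + z) := by
  induction N generalizing y z with
  | zero =>
    obtain ⟨a, rfl⟩ := hy
    obtain ⟨b, rfl⟩ := hz
    exact ⟨a + b, (map_add _ _ _).symm⟩
  | succ N ih =>
    obtain ⟨a, q, y', hy', rfl⟩ := hy
    obtain ⟨b, r, z', hz', rfl⟩ := hz
    exact ⟨a + b, q + r, _, ih hy' hz', by simp only [map_add]; ring⟩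

theorem IsNormalForm.const_mul {N : ℕ} {y : Model k n} (hy : IsNormalForm N y)
    (b : TruncPoly k n) : IsNormalForm N (modelConst k n b * y) := by
  induction N generalizing y with
  | zero =>
    obtain ⟨a, rfl⟩ := hy
    exact ⟨b * a, (map_mul _ _ _).symm⟩
  | succ N ih =>
    obtain ⟨a, q, y', hy', rfl⟩ := hy
    exact ⟨b * a, b * q, _, ih hy', by simp only [map_mul]; ring⟩

theorem IsNormalForm.mono {N M : ℕ} {y : Model k n} (hy : IsNormalForm N y) (h : N ≤ M) :
    IsNormalForm M y := by
  induction N generalizing y M with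
  | zero =>
    obtain ⟨a, rfl⟩ := hy
    exact .const M a
  | succ N ih =>
    obtain ⟨M, rfl⟩ := Nat.exists_eq_add_of_le' (show 1 ≤ M by lia)
    obtain ⟨a, q, y', hy', rfl⟩ := hy
    exact ⟨a, q, y', ih hy' (by lia), rfl⟩

theorem IsNormalForm.t_mul {N : ℕ} {y : Model k n} (hy : IsNormalForm N y) :
    IsNormalForm (N + 1) (modelT k n * y) :=
  ⟨0, 0, y, hy, by simp⟩

theorem IsNormalForm.u_mul {N : ℕ} {y : Model k n} (hy : IsNormalForm N y) :
    IsNormalForm (N + 1) (modelU k n * y) := by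
  induction N generalizing y with
  | zero =>
    obtain ⟨a, rfl⟩ := hy
    exact ⟨0, a, _, .const 0 0, by simp⟩
  | succ N ih =>
    obtain ⟨a, q, y', hy', rfl⟩ := hy
    refine ⟨0, a, _, ih hy', ?_⟩
    rw [map_zero]
    linear_combination modelConst k n q * (model_relations k n).2.1

theorem exists_isNormalForm (y : Model k n) : ∃ N, IsNormalForm N y := by
  obtain ⟨p, rfl⟩ := Ideal.Quotient.mk_surjective y
  induction p using MvPolynomial.induction_on with
  | C a =>
    refine ⟨0, algebraMap k _ a, ?_⟩
    rw [AlgHom.commutes]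
    rfl
  | add p q hp hq =>
    obtain ⟨N, hN⟩ := hp
    obtain ⟨M, hM⟩ := hq
    rw [map_add]
    exact ⟨N + M, (hN.mono (by lia)).add (hM.mono (by lia))⟩
  | mul_X p i hp =>
    obtain ⟨N, hN⟩ := hp
    rw [map_mul, mul_comm]
    fin_cases i
    · refine ⟨N, ?_⟩
      have := hN.const_mul (gen k n)
      rwa [modelConst_gen] at this
    · exact ⟨N + 1, hN.u_mul⟩
    · exact ⟨N + 1, hN.t_mul⟩

section Iso

variable (Φ : Model k n →ₐ[k] HH k (TruncPoly k n))

theorem map_modelConst (hX : Φ (modelX k n) = hhConst k n (gen k n)) (a : TruncPoly k n) :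
    Φ (modelConst k n a) = hhConst k n a := by
  have : Φ.comp (modelConst k n) = hhConst k n := by
    apply AdjoinRoot.algHom_ext
    change Φ (modelConst k n (gen k n)) = hhConst k n (gen k n)
    rw [modelConst_gen, hX]
  exact DFunLike.congr_fun this a

/-- By `hh_injectivity`, an element of the kernel can be rewritten as an element of lower degree
in `t`, using the relations of the model. -/
theorem modelHom_injective (hX : Φ (modelX k n) = hhConst k n (gen k n))
    (hU : Φ (modelU k n) = hhU k n) (hT : Φ (modelT k n) = hhT k n) : Function.Injective Φ := by
  have hC := map_modelConst Φ hX
  have key : ∀ N (y : Model k n), IsNormalForm N y → Φ y = 0 → y = 0 := by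
    have hzero : ∀ a : TruncPoly k n, hhConst k n a = 0 → a = 0 := fun a ha =>
      (hh_injectivity (a := a) (q := 0) (h := 0) (by
        rw [map_zero, mul_zero, mul_zero, add_zero, add_zero, ha])).1
    intro N
    induction N with
    | zero =>
      rintro _ ⟨a, rfl⟩ h
      rw [hC] at h
      rw [hzero a h, map_zero]
    | succ N ih =>
      rintro _ ⟨a, q, y, hy, rfl⟩ h
      rw [map_add, map_add, map_mul, map_mul, hC, hC, hU, hT] at h
      obtain ⟨ha, hq, c, hc⟩ := hh_injectivity h
      have h1 : y - modelConst k n (c • gen k n ^ n) = 0 := by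
        refine ih _ ?_ (by rw [map_sub, hC, hc, sub_self])
        rw [sub_eq_add_neg, ← map_neg]
        exact hy.add (.const _ _)
      have hq' : modelU k n * modelConst k n q = 0 := by
        have e : q = coef k n n q • gen k n ^ n := by
          conv_lhs => rw [sum_coef k q]
          refine sum_eq_single n (fun j hj hjn => ?_) (by simp)
          have hj' : j < n := by rw [mem_range] at hj; lia
          have e2 : coef k n j q = coef k n (j + 1) (gen k n * q) := by
            rw [coef, coef, LinearMap.comp_apply, LinearMap.comp_apply, LinearMap.mulRight_apply,
              LinearMap.mulRight_apply, mul_comm (gen k n), mul_assoc, ← pow_succ',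
              show n - (j + 1) + 1 = n - j by lia]
          rw [e2, hq, map_zero, zero_smul]
        rw [e, map_smul, map_pow, modelConst_gen, mul_smul_comm, (model_relations k n).2.2.2,
          smul_zero]
      rw [ha, map_zero, hq', zero_add, zero_add, sub_eq_zero.1 h1, map_smul, map_pow,
        modelConst_gen, mul_smul_comm, mul_comm, (model_relations k n).2.2.1, smul_zero]
  rw [injective_iff_map_eq_zero]
  intro y h
  obtain ⟨N, hN⟩ := exists_isNormalForm y
  exact key N y hN h

theorem modelHom_surjective [CharZero k] (hX : Φ (modelX k n) = hhConst k n (gen k n))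
    (hU : Φ (modelU k n) = hhU k n) (hT : Φ (modelT k n) = hhT k n) : Function.Surjective Φ := by
  intro c
  induction c using hh_induction with
  | h0 => exact ⟨0, map_zero _⟩
  | h a q c hc =>
    obtain ⟨y, rfl⟩ := hc
    refine ⟨modelConst k n a + modelU k n * modelConst k n q + modelT k n * y, ?_⟩
    rw [map_add, map_add, map_mul, map_mul, map_modelConst Φ hX, map_modelConst Φ hX, hU, hT]

end Iso

theorem exists_modelEquiv (k : Type*) [Field k] [CharZero k] (n : ℕ) :
    ∃ Φ : Model k n ≃ₐ[k] HH k (TruncPoly k n), Φ (modelX k n) = hhConst k n (gen k n) ∧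
      Φ (modelU k n) = hhU k n ∧ Φ (modelT k n) = hhT k n := by
  obtain ⟨Φ, hX, hU, hT⟩ := exists_modelHom (k := k) (n := n) (H := HH k (TruncPoly k n))
    hh_mul_comm (x := hhConst k n (gen k n)) (u := hhU k n) (t := hhT k n)
    (by rw [← map_pow, gen_pow_eq_zero k n (Nat.lt_succ_self n), map_zero])
    (by rw [sq, hhU_sq])
    (by rw [← map_pow, hhConst_mul, hhT_mul_hhConst])
    (by rw [← map_pow, hhU_mul_hhConst])
  exact ⟨AlgEquiv.ofBijective Φ ⟨modelHom_injective Φ hX hU hT, modelHom_surjective Φ hX hU hT⟩,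
    hX, hU, hT⟩

/-! ### The grading of the model -/

section Grading

variable {m : ℤ}

theorem modelT_mul_modelU_mul_modelX_mem (i j l : ℕ) :
    modelT k n ^ i * modelU k n ^ j * modelX k n ^ l ∈
      modelDeg k n m ((2 * m * n + 2 * (m - 1)) * i - j - 2 * m * l) := by
  refine ⟨X 2 ^ i * X 1 ^ j * X 0 ^ l, ?_, rfl⟩
  rw [SetLike.mem_coe, mem_weightedHomogeneousSubmodule]
  have := (((isWeightedHomogeneous_X k ![-2 * m, -1, 2 * m * n + 2 * (m - 1)] (2 : Fin 3)).pow
    i).mul ((isWeightedHomogeneous_X k ![-2 * m, -1, 2 * m * n + 2 * (m - 1)] (1 : Fin 3)).pow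
    j)).mul ((isWeightedHomogeneous_X k ![-2 * m, -1, 2 * m * n + 2 * (m - 1)] (0 : Fin 3)).pow l)
  convert this using 1
  simp
  ring

/-- The homogeneous parts of the model are spanned by monomials. -/
theorem modelDeg_le {d : ℤ} (S : Submodule k (Model k n))
    (h : ∀ i j l : ℕ, d = (2 * m * n + 2 * (m - 1)) * i - j - 2 * m * l →
      modelT k n ^ i * modelU k n ^ j * modelX k n ^ l ∈ S) : modelDeg k n m d ≤ S := by
  rintro _ ⟨p, hp, rfl⟩
  rw [SetLike.mem_coe, mem_weightedHomogeneousSubmodule] at hp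
  rw [p.as_sum, map_sum]
  refine Submodule.sum_mem _ fun s hs => ?_
  have hw := hp (mem_support_iff.1 hs)
  have e : monomial s (coeff s p)
      = coeff s p • (X 2 ^ s 2 * X 1 ^ s 1 * X 0 ^ s 0 : MvPolynomial (Fin 3) k) := by
    rw [monomial_eq, Finsupp.prod_fintype _ _ (by simp), Fin.prod_univ_three, smul_eq_C_mul]
    ring
  rw [e, map_smul]
  refine Submodule.smul_mem _ _ (h (s 2) (s 1) (s 0) ?_)
  rw [← hw, Finsupp.weight_apply, Finsupp.sum_fintype _ _ (by simp), Fin.sum_univ_three]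
  simp
  ring

theorem modelDeg_mul_mem {d e : ℤ} {a b : Model k n} (ha : a ∈ modelDeg k n m d)
    (hb : b ∈ modelDeg k n m e) : a * b ∈ modelDeg k n m (d + e) := by
  obtain ⟨p, hp, rfl⟩ := ha
  obtain ⟨q, hq, rfl⟩ := hb
  exact ⟨p * q, IsWeightedHomogeneous.mul hp hq, map_mul (Ideal.Quotient.mk _) p q⟩

theorem modelConst_mem {d : ℤ} {a : TruncPoly k n} (ha : a ∈ truncDeg k n m d) :
    modelConst k n a ∈ modelDeg k n m d := by
  refine map_mem_of_truncDeg (modelDeg k n m d) (modelConst k n).toLinearMap (fun i _ hi => ?_) ha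
  have := modelT_mul_modelU_mul_modelX_mem (k := k) (n := n) (m := m) 0 0 i
  rw [pow_zero, pow_zero, one_mul, one_mul] at this
  rw [AlgHom.toLinearMap_apply, map_pow, modelConst_gen, hi]
  convert this using 1
  simp

theorem modelU_mem : modelU k n ∈ modelDeg k n m (-1) := by
  have := modelT_mul_modelU_mul_modelX_mem (k := k) (n := n) (m := m) 0 1 0
  simpa using this

theorem modelT_mem : modelT k n ∈ modelDeg k n m (2 * m * n + 2 * (m - 1)) := by
  have := modelT_mul_modelU_mul_modelX_mem (k := k) (n := n) (m := m) 1 0 0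
  simpa using this

/-- The ideal of relations contains the homogeneous components of its elements, as its generators
are homogeneous. -/
theorem modelIdeal_isHomogeneous (d : ℤ) {p : MvPolynomial (Fin 3) k} (hp : p ∈ modelIdeal k n) :
    weightedHomogeneousComponent ![-2 * m, -1, 2 * m * n + 2 * (m - 1)] d p ∈ modelIdeal k n := by
  let _ := weightedGradedAlgebra k ![-2 * m, -1, 2 * m * n + 2 * (m - 1)]
  refine weightedHomogeneousComponent_mem_of_mem k _ ?_ hp d
  refine Ideal.homogeneous_span _ _ ?_
  have hX := isWeightedHomogeneous_X k ![-2 * m, -1, 2 * m * n + 2 * (m - 1)]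
  rintro _ (rfl | rfl | rfl | rfl)
  · exact ⟨_, (hX 0).pow (n + 1)⟩
  · exact ⟨_, (hX 1).pow 2⟩
  · exact ⟨_, ((hX 0).pow n).mul (hX 2)⟩
  · exact ⟨_, (hX 1).mul ((hX 0).pow n)⟩

theorem modelDeg_isInternal : DirectSum.IsInternal (modelDeg k n m) := by
  set w : Fin 3 → ℤ := ![-2 * m, -1, 2 * m * n + 2 * (m - 1)] with hw
  refine DirectSum.isInternal_submodule_of_iSupIndep_of_iSup_eq_top ?_ ?_
  · rw [iSupIndep_def]
    intro d
    rw [Submodule.disjoint_def]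
    rintro _ ⟨p, hp, rfl⟩ h
    simp only [modelDeg, ← Submodule.map_iSup] at h
    obtain ⟨q, hq, e⟩ := h
    have hq0 : weightedHomogeneousComponent w d q = 0 := by
      have : (⨆ e, ⨆ (_ : e ≠ d), weightedHomogeneousSubmodule k w e)
          ≤ LinearMap.ker (weightedHomogeneousComponent (R := k) w d) :=
        iSup₂_le fun e he r hr => LinearMap.mem_ker.2
          (IsWeightedHomogeneous.weightedHomogeneousComponent_ne d hr he.symm)
      exact this hq
    have hpd : weightedHomogeneousComponent w d p = p :=
      IsWeightedHomogeneous.weightedHomogeneousComponent_same hp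
    have hpq : p - q ∈ modelIdeal k n := Ideal.Quotient.eq.1 e.symm
    have := modelIdeal_isHomogeneous (m := m) d hpq
    rw [map_sub, hpd, hq0, sub_zero] at this
    exact Ideal.Quotient.eq_zero_iff_mem.2 this
  · rw [eq_top_iff]
    rintro y -
    obtain ⟨p, rfl⟩ := Ideal.Quotient.mk_surjective y
    rw [← sum_weightedHomogeneousComponent w p,
      finsum_eq_sum _ (weightedHomogeneousComponent_finsupp p), map_sum]
    refine Submodule.sum_mem _ fun d _ => ?_
    exact Submodule.mem_iSup_of_mem d ⟨_, weightedHomogeneousComponent_mem w p d, rfl⟩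

/-- The isomorphism identifies the gradings: the terms of the decomposition of a homogeneous cocycle
are homogeneous. -/
theorem map_modelDeg [CharZero k] (Φ : Model k n ≃ₐ[k] HH k (TruncPoly k n))
    (hX : Φ (modelX k n) = hhConst k n (gen k n))
    (hU : Φ (modelU k n) = hhU k n) (hT : Φ (modelT k n) = hhT k n) (d : ℤ) :
    (modelDeg k n m d).map Φ.toLinearMap = HHdeg k (truncDeg k n m) d := by
  have hC := map_modelConst Φ.toAlgHom hX
  have mul_mem : ∀ {d e : ℤ} {a b : HH k (TruncPoly k n)}, a ∈ HHdeg k (truncDeg k n m) d →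
      b ∈ HHdeg k (truncDeg k n m) e → a * b ∈ HHdeg k (truncDeg k n m) (d + e) := by
    rintro d e _ _ ⟨z, hz, rfl⟩ ⟨w, hw, rfl⟩
    exact ⟨z * w, hz.mul hw, map_mul _ _ _⟩
  have hone : (1 : TruncPoly k n) ∈ truncDeg k n m 0 := by
    simpa using gen_pow_mem_truncDeg (k := k) (n := n) (m := m) (d := 0) (i := 0) (by simp)
  have pow_mem : ∀ {d : ℤ} {a : HH k (TruncPoly k n)} (i : ℕ), a ∈ HHdeg k (truncDeg k n m) d →
      a ^ i ∈ HHdeg k (truncDeg k n m) (i * d) := by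
    intro d a i ha
    induction i with
    | zero =>
      rw [pow_zero, Nat.cast_zero, zero_mul]
      exact ⟨constCocycle k n 1, by rw [coe_constCocycle]; exact hasDegree_smul_one hone,
        by rw [map_one, map_one]⟩
    | succ i ih =>
      have := mul_mem ih ha
      rw [pow_succ a i]
      convert this using 1
      push_cast
      ring_nf
  apply le_antisymm
  · rw [Submodule.map_le_iff_le_comap]
    refine modelDeg_le _ fun i j l e => ?_
    have hx : hhConst k n (gen k n) ∈ HHdeg k (truncDeg k n m) (-2 * m) := by
      refine ⟨constCocycle k n (gen k n), ?_, rfl⟩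
      rw [coe_constCocycle]
      refine hasDegree_smul_one ?_
      simpa using gen_pow_mem_truncDeg (k := k) (n := n) (m := m) (d := -2 * m) (i := 1) (by simp)
    have := mul_mem (mul_mem (pow_mem i ⟨cocycleT k n, hasDegree_cochT, rfl⟩)
      (pow_mem j ⟨cocycleU k n, hasDegree_cochU, rfl⟩)) (pow_mem l hx)
    rw [Submodule.mem_comap, AlgEquiv.toLinearMap_apply, map_mul, map_mul, map_pow, map_pow,
      map_pow, hX, hU, hT]
    rw [e, show (2 * m * n + 2 * (m - 1)) * i - j - 2 * m * l
      = i * (2 * m * n + 2 * (m - 1)) + j * (-1) + l * (-2 * m) by ring]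
    exact this
  · rintro _ ⟨z, hz, rfl⟩
    obtain ⟨N, hN⟩ := z.2.1.bounded
    induction N generalizing z d with
    | zero =>
      have : z = 0 := Subtype.ext (funext fun l => hN l (Nat.zero_le _))
      rw [this, map_zero]
      exact Submodule.zero_mem _
    | succ N ih =>
      obtain ⟨y, hy, e⟩ := ih (d - (2 * m * n + 2 * (m - 1))) (contractCocycle z) hz.contract
        (fun l hl => by
          change contract (z : WordFun (TruncPoly k n)) l = 0
          rw [contract]
          refine sum_eq_zero fun s _ => ?_
          rw [hN _ (by simp only [List.length_cons]; lia), mul_zero])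
      have h0 : (z : WordFun (TruncPoly k n)) [] ∈ truncDeg k n m d := by
        simpa using hz [] [] .nil
      have h1 : shift k n ((z : WordFun (TruncPoly k n)) [gen k n]) ∈ truncDeg k n m (d + 1) := by
        have hx : gen k n ∈ truncDeg k n m (-2 * m) := by
          simpa using gen_pow_mem_truncDeg (k := k) (n := n) (m := m) (d := -2 * m) (i := 1)
            (by simp)
        have := shift_mem_truncDeg (hz [gen k n] [-2 * m] (.cons hx .nil))
        convert this using 1
        simp
        ring_nf
      refine ⟨modelConst k n ((z : WordFun (TruncPoly k n)) []) + modelU k n *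
        modelConst k n (shift k n ((z : WordFun (TruncPoly k n)) [gen k n])) + modelT k n * y,
        ?_, ?_⟩
      · refine Submodule.add_mem _ (Submodule.add_mem _ (modelConst_mem h0) ?_) ?_
        · have := modelDeg_mul_mem modelU_mem (modelConst_mem h1)
          rwa [show -1 + (d + 1) = d by ring] at this
        · have := modelDeg_mul_mem modelT_mem hy
          rwa [add_sub_cancel] at this
      · rw [hh_decomposition, ← e, ← hC, ← hC, ← hU, ← hT]
        simp

end Grading

end ModelRing

/-! ### The Batalin–Vilkovisky identity in the model -/

section BV

variable {k : Type*} [Field k] {n : ℕ} {m : ℤ}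

/-- Transport of a Batalin–Vilkovisky structure along an isomorphism of algebras. -/
theorem IsBVAlgebra.map {H H' : Type*} [Ring H] [Algebra k H] [Ring H'] [Algebra k H']
    {𝒽 : ℤ → Submodule k H} {Δ : H →ₗ[k] H} (h : IsBVAlgebra 𝒽 Δ) (Φ : H ≃ₐ[k] H')
    {𝒽' : ℤ → Submodule k H'} (h𝒽 : ∀ d, (𝒽 d).map Φ.toLinearMap = 𝒽' d) {Δ' : H' →ₗ[k] H'}
    (hΔ : ∀ a, Δ' (Φ a) = Φ (Δ a)) : IsBVAlgebra 𝒽' Δ' := by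
  obtain rfl : (fun d => (𝒽 d).map Φ.toLinearMap) = 𝒽' := funext h𝒽
  have hsmul : ∀ (c : ℤˣ) (a : H), Φ (c • a) = c • Φ a := fun c a => by
    rw [Units.smul_def, Units.smul_def, map_zsmul]
  have hmem : ∀ {d : ℤ} {a : H}, a ∈ 𝒽 d → Φ a ∈ (𝒽 d).map Φ.toLinearMap := fun ha => ⟨_, ha, rfl⟩
  constructor
  · refine DirectSum.isInternal_submodule_of_iSupIndep_of_iSup_eq_top ?_ ?_
    · exact h.internal.submodule_iSupIndep.map_orderIso (Submodule.orderIsoMapComap Φ.toLinearEquiv)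
    · change (⨆ d, (𝒽 d).map Φ.toLinearMap) = ⊤
      rw [← Submodule.map_iSup, h.internal.submodule_iSup_eq_top, Submodule.map_top,
        LinearMap.range_eq_top]
      exact Φ.surjective
  · have := hmem h.one_mem
    rwa [map_one] at this
  · rintro i j _ _ ⟨a, ha, rfl⟩ ⟨b, hb, rfl⟩
    have := hmem (h.mul_mem ha hb)
    rwa [map_mul] at this
  · rintro i j _ _ ⟨a, ha, rfl⟩ ⟨b, hb, rfl⟩
    have := congrArg Φ (h.graded_comm ha hb)
    rwa [hsmul, map_mul, map_mul] at this
  · rintro i _ ⟨a, ha, rfl⟩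
    have := hmem (h.delta_mem ha)
    rwa [← hΔ] at this
  · intro a
    obtain ⟨a, rfl⟩ := Φ.surjective a
    rw [hΔ, hΔ, h.delta_delta, map_zero]
  · rintro i j l _ _ _ ⟨a, ha, rfl⟩ ⟨b, hb, rfl⟩ ⟨c, hc, rfl⟩
    have := congrArg Φ (h.seven_term ha hb hc)
    simp only [map_add, map_sub, hsmul, map_mul, ← hΔ] at this
    exact this

variable (k n) in
/-- The subalgebra of the model generated by `x` and `t`, as a subspace. -/
noncomputable def evenPart : Submodule k (Model k n) :=
  Submodule.span k (Set.range fun p : ℕ × ℕ => modelT k n ^ p.1 * modelX k n ^ p.2)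

theorem evenPart_mul_mem {p q : Model k n} (hp : p ∈ evenPart k n) (hq : q ∈ evenPart k n) :
    p * q ∈ evenPart k n := by
  induction hp, hq using Submodule.span_induction₂ with
  | mem_mem p q hp hq =>
    obtain ⟨⟨i, l⟩, rfl⟩ := hp
    obtain ⟨⟨i', l'⟩, rfl⟩ := hq
    exact Submodule.subset_span ⟨(i + i', l + l'), by simp only; ring⟩
  | zero_left => rw [zero_mul]; exact Submodule.zero_mem _
  | zero_right => rw [mul_zero]; exact Submodule.zero_mem _
  | add_left _ _ _ _ _ _ h1 h2 => rw [add_mul]; exact Submodule.add_mem _ h1 h2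
  | add_right _ _ _ _ _ _ h1 h2 => rw [mul_add]; exact Submodule.add_mem _ h1 h2
  | smul_left _ _ _ _ _ h => rw [smul_mul_assoc]; exact Submodule.smul_mem _ _ h
  | smul_right _ _ _ _ _ h => rw [mul_smul_comm]; exact Submodule.smul_mem _ _ h

theorem modelU_pow_eq_zero {j : ℕ} (hj : 2 ≤ j) : modelU k n ^ j = 0 :=
  pow_eq_zero_of_le hj (model_relations k n).2.1

/-- The parity of the degree is the parity of the exponent of `u`. -/
theorem mem_evenPart_of_even {d : ℤ} (hd : Even d) {a : Model k n} (ha : a ∈ modelDeg k n m d) :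
    a ∈ evenPart k n := by
  refine modelDeg_le (m := m) (evenPart k n) (fun i j l e => ?_) ha
  obtain ⟨r, hr⟩ := hd
  obtain rfl | hj : j = 0 ∨ 2 ≤ j := by
    have : j ≠ 1 := by
      rintro rfl
      have h2 : r + r - 2 * (m * n * i + (m - 1) * i - m * l) = -1 := by
        rw [← hr, e]; push_cast; ring
      lia
    lia
  · rw [pow_zero, mul_one]
    exact Submodule.subset_span ⟨(i, l), rfl⟩
  · rw [modelU_pow_eq_zero hj, mul_zero, zero_mul]
    exact Submodule.zero_mem _

theorem exists_modelU_mul_of_odd {d : ℤ} (hd : Odd d) {a : Model k n}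
    (ha : a ∈ modelDeg k n m d) : ∃ p ∈ evenPart k n, a = modelU k n * p := by
  have : modelDeg k n m d ≤ (evenPart k n).map (LinearMap.mulLeft k (modelU k n)) := by
    refine modelDeg_le (m := m) _ fun i j l e => ?_
    obtain ⟨r, hr⟩ := hd
    obtain rfl | hj : j = 1 ∨ 2 ≤ j := by
      have : j ≠ 0 := by
        rintro rfl
        have h2 : 2 * r + 1 - 2 * (m * n * i + (m - 1) * i - m * l) = 0 := by
          rw [← hr, e]; push_cast; ring
        lia
      lia
    · exact ⟨_, Submodule.subset_span ⟨(i, l), rfl⟩, by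
        rw [LinearMap.mulLeft_apply]; ring⟩
    · rw [modelU_pow_eq_zero hj, mul_zero, zero_mul]
      exact Submodule.zero_mem _
  obtain ⟨p, hp, e⟩ := this ha
  exact ⟨p, hp, e.symm⟩

variable {Δ : Model k n →ₗ[k] Model k n}

theorem delta_evenPart
    (h0 : ∀ i l : ℕ, Δ (modelT k n ^ i * modelX k n ^ l) = 0)
    {p : Model k n} (hp : p ∈ evenPart k n) : Δ p = 0 := by
  refine Submodule.span_le (p := LinearMap.ker Δ).2 ?_ hp
  rintro _ ⟨⟨i, l⟩, rfl⟩
  exact h0 i l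

/-- `p ↦ Δ (u p) + n p` is a derivation of the subalgebra generated by `x` and `t`. -/
theorem delta_modelU_mul
    (h1 : ∀ i l : ℕ, Δ (modelT k n ^ i * modelU k n * modelX k n ^ l)
      = (-((i : k) + 1) * n - i + l) • (modelT k n ^ i * modelX k n ^ l))
    {p q : Model k n} (hp : p ∈ evenPart k n) (hq : q ∈ evenPart k n) :
    Δ (modelU k n * (p * q)) = Δ (modelU k n * p) * q + p * Δ (modelU k n * q)
      + (n : k) • (p * q) := by
  induction hp, hq using Submodule.span_induction₂ with
  | mem_mem p q hp hq =>
    obtain ⟨⟨i, l⟩, rfl⟩ := hp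
    obtain ⟨⟨i', l'⟩, rfl⟩ := hq
    have e : ∀ i l : ℕ, Δ (modelU k n * (modelT k n ^ i * modelX k n ^ l))
        = (-((i : k) + 1) * n - i + l) • (modelT k n ^ i * modelX k n ^ l) := fun i l => by
      rw [← h1]; congr 1; ring
    have e2 : modelT k n ^ i * modelX k n ^ l * (modelT k n ^ i' * modelX k n ^ l')
        = modelT k n ^ (i + i') * modelX k n ^ (l + l') := by ring
    simp only [e, e2, smul_mul_assoc, mul_smul_comm, ← add_smul]
    congr 1
    push_cast
    ring
  | zero_left => simp
  | zero_right => simp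
  | add_left _ _ _ _ _ _ h1 h2 => simp only [add_mul, mul_add, map_add, smul_add, h1, h2]; ring
  | add_right _ _ _ _ _ _ h1 h2 => simp only [mul_add, map_add, smul_add, h1, h2]; ring
  | smul_left _ _ _ _ _ h =>
    simp only [smul_mul_assoc, mul_smul_comm, map_smul, h, smul_add, smul_comm (n : k)]
  | smul_right _ _ _ _ _ h =>
    simp only [mul_smul_comm, map_smul, h, smul_add, smul_comm (n : k)]

/-- In each of the eight combinations of parities, `Δ` vanishes on the even part `E`, products of
two elements of `u E` vanish, and what remains of the seven-term identity is the derivation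
property `delta_modelU_mul`. -/
theorem isBVAlgebra_model
    (h0 : ∀ i l : ℕ, Δ (modelT k n ^ i * modelX k n ^ l) = 0)
    (h1 : ∀ i l : ℕ, Δ (modelT k n ^ i * modelU k n * modelX k n ^ l)
      = (-((i : k) + 1) * n - i + l) • (modelT k n ^ i * modelX k n ^ l))
    (m : ℤ) : IsBVAlgebra (modelDeg k n m) Δ := by
  have hu : modelU k n * modelU k n = 0 := by rw [← sq]; exact (model_relations k n).2.1
  have huu : ∀ p q : Model k n, modelU k n * p * (modelU k n * q) = 0 := fun p q => by
    linear_combination p * q * hu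
  have D0 : ∀ {p : Model k n}, p ∈ evenPart k n → Δ p = 0 := delta_evenPart h0
  have D1 : ∀ {p q : Model k n}, p ∈ evenPart k n → q ∈ evenPart k n → _ :=
    fun hp hq => delta_modelU_mul h1 hp hq
  have M := @evenPart_mul_mem k _ n
  refine ⟨modelDeg_isInternal, ?_, modelDeg_mul_mem, ?_, ?_, ?_, ?_⟩
  · simpa using modelT_mul_modelU_mul_modelX_mem (k := k) (n := n) (m := m) 0 0 0
  · intro i j a b ha hb
    rcases Int.even_or_odd i with hi | hi
    · rw [Int.negOnePow_even _ (hi.mul_right j), one_smul, mul_comm]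
    rcases Int.even_or_odd j with hj | hj
    · rw [Int.negOnePow_even _ (hj.mul_left i), one_smul, mul_comm]
    obtain ⟨p, -, rfl⟩ := exists_modelU_mul_of_odd hi ha
    obtain ⟨q, -, rfl⟩ := exists_modelU_mul_of_odd hj hb
    rw [huu, huu, smul_zero]
  · intro d a ha
    refine modelDeg_le (m := m) ((modelDeg k n m (d + 1)).comap Δ) (fun i j l e => ?_) ha
    rw [Submodule.mem_comap]
    obtain rfl | rfl | hj : j = 0 ∨ j = 1 ∨ 2 ≤ j := by lia
    · rw [pow_zero, mul_one, h0]
      exact Submodule.zero_mem _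
    · rw [pow_one, h1]
      refine Submodule.smul_mem _ _ ?_
      have := modelT_mul_modelU_mul_modelX_mem (k := k) (n := n) (m := m) i 0 l
      rw [pow_zero, mul_one] at this
      convert this using 1
      rw [e]
      push_cast
      ring_nf
    · rw [modelU_pow_eq_zero hj, mul_zero, zero_mul, map_zero]
      exact Submodule.zero_mem _
  · have hE : ∀ {p : Model k n}, p ∈ evenPart k n → Δ (modelU k n * p) ∈ evenPart k n := by
      intro p hp
      refine Submodule.span_le
        (p := (evenPart k n).comap (Δ ∘ₗ LinearMap.mulLeft k (modelU k n))).2 ?_ hp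
      rintro _ ⟨⟨i, l⟩, rfl⟩
      change Δ (modelU k n * (modelT k n ^ i * modelX k n ^ l)) ∈ evenPart k n
      rw [show modelU k n * (modelT k n ^ i * modelX k n ^ l)
        = modelT k n ^ i * modelU k n * modelX k n ^ l by ring, h1]
      exact Submodule.smul_mem _ _ (Submodule.subset_span ⟨(i, l), rfl⟩)
    intro a
    have ha : a ∈ ⨆ d, modelDeg k n m d := by
      rw [modelDeg_isInternal.submodule_iSup_eq_top]
      exact Submodule.mem_top
    induction ha using Submodule.iSup_induction' with
    | zero => rw [map_zero, map_zero]
    | add _ _ _ _ h1 h2 => rw [map_add, map_add, h1, h2, add_zero]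
    | mem d a ha =>
      rcases Int.even_or_odd d with hd | hd
      · rw [D0 (mem_evenPart_of_even hd ha), map_zero]
      · obtain ⟨p, hp, rfl⟩ := exists_modelU_mul_of_odd hd ha
        exact D0 (hE hp)
  · intro i j l a b c ha hb hc
    have D2 : ∀ {p q : Model k n}, p ∈ evenPart k n → q ∈ evenPart k n → Δ (modelU k n * (p * q))
        = Δ (modelU k n * p) * q + p * Δ (modelU k n * q) + algebraMap k _ n * (p * q) := by
      intro p q hp hq
      exact (D1 hp hq).trans (congrArg _
        (Algebra.smul_def (A := Model k n) (n : k) (p * q)))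
    rcases Int.even_or_odd i with hi | hi <;> rcases Int.even_or_odd j with hj | hj <;>
      rcases Int.even_or_odd l with hl | hl
    · have a0 := mem_evenPart_of_even hi ha
      have b0 := mem_evenPart_of_even hj hb
      have c0 := mem_evenPart_of_even hl hc
      simp only [D0 a0, D0 b0, D0 c0, D0 (M a0 b0), D0 (M a0 c0), D0 (M b0 c0), D0 (M (M a0 b0) c0),
        mul_zero, zero_mul, smul_zero, add_zero, sub_zero]
    · have a0 := mem_evenPart_of_even hi ha
      have b0 := mem_evenPart_of_even hj hb
      obtain ⟨c, c0, rfl⟩ := exists_modelU_mul_of_odd hl hc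
      rw [Int.negOnePow_even i hi, Int.negOnePow_even _ (hj.mul_left (i - 1)),
        Int.negOnePow_even _ (hi.add hj), one_smul, one_smul, one_smul, D0 (M a0 b0), D0 a0, D0 b0,
        show a * b * (modelU k n * c) = modelU k n * (a * b * c) by ring,
        show b * (modelU k n * c) = modelU k n * (b * c) by ring,
        show a * (modelU k n * c) = modelU k n * (a * c) by ring,
        D2 (M a0 b0) c0, D2 b0 c0, D2 a0 c0, D2 a0 b0]
      simp only [mul_zero, zero_mul, one_smul]
      ring
    · have a0 := mem_evenPart_of_even hi ha
      obtain ⟨b, b0, rfl⟩ := exists_modelU_mul_of_odd hj hb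
      have c0 := mem_evenPart_of_even hl hc
      rw [Int.negOnePow_even i hi, Int.negOnePow_odd _ ((hi.sub_odd odd_one).mul hj),
        Int.negOnePow_odd _ (hi.add_odd hj), one_smul, one_smul, D0 (M a0 c0), D0 a0, D0 c0,
        show a * (modelU k n * b) * c = modelU k n * (a * b * c) by ring,
        show a * (modelU k n * b) = modelU k n * (a * b) by ring,
        show modelU k n * b * c = modelU k n * (b * c) by ring,
        D2 (M a0 b0) c0, D2 b0 c0, D2 a0 b0]
      simp only [mul_zero, zero_mul, smul_zero]
      ring
    · have a0 := mem_evenPart_of_even hi ha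
      obtain ⟨b, b0, rfl⟩ := exists_modelU_mul_of_odd hj hb
      obtain ⟨c, c0, rfl⟩ := exists_modelU_mul_of_odd hl hc
      rw [Int.negOnePow_even i hi, Int.negOnePow_odd _ ((hi.sub_odd odd_one).mul hj),
        Int.negOnePow_odd _ (hi.add_odd hj), one_smul, one_smul, D0 a0, huu,
        show a * (modelU k n * b) * (modelU k n * c) = a * (modelU k n * b * (modelU k n * c)) by
          ring, huu,
        show a * (modelU k n * b) = modelU k n * (a * b) by ring,
        show a * (modelU k n * c) = modelU k n * (a * c) by ring,
        D2 a0 c0, D2 a0 b0]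
      simp only [mul_zero, zero_mul, map_zero, Units.neg_smul, one_smul]
      ring
    · obtain ⟨a, a0, rfl⟩ := exists_modelU_mul_of_odd hi ha
      have b0 := mem_evenPart_of_even hj hb
      have c0 := mem_evenPart_of_even hl hc
      rw [Int.negOnePow_even _ (hj.mul_left (i - 1)), one_smul, D0 (M b0 c0), D0 b0, D0 c0,
        show modelU k n * a * b * c = modelU k n * (a * b * c) by ring,
        show modelU k n * a * b = modelU k n * (a * b) by ring,
        show modelU k n * a * c = modelU k n * (a * c) by ring,
        D2 (M a0 b0) c0, D2 a0 c0, D2 a0 b0]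
      simp only [mul_zero, zero_mul, smul_zero]
      ring
    · obtain ⟨a, a0, rfl⟩ := exists_modelU_mul_of_odd hi ha
      have b0 := mem_evenPart_of_even hj hb
      obtain ⟨c, c0, rfl⟩ := exists_modelU_mul_of_odd hl hc
      rw [Int.negOnePow_odd i hi, Int.negOnePow_even _ (hj.mul_left (i - 1)),
        Int.negOnePow_odd _ (hi.add_even hj), one_smul, D0 b0, huu,
        show modelU k n * a * b = modelU k n * (a * b) by ring, huu,
        show b * (modelU k n * c) = modelU k n * (b * c) by ring,
        D2 b0 c0, D2 a0 b0]
      simp only [mul_zero, zero_mul, map_zero, smul_zero, Units.neg_smul, one_smul]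
      ring
    · obtain ⟨a, a0, rfl⟩ := exists_modelU_mul_of_odd hi ha
      obtain ⟨b, b0, rfl⟩ := exists_modelU_mul_of_odd hj hb
      have c0 := mem_evenPart_of_even hl hc
      rw [Int.negOnePow_odd i hi, Int.negOnePow_even _ ((hi.sub_odd odd_one).mul_right j),
        Int.negOnePow_even _ (hi.add_odd hj), one_smul, one_smul, D0 c0, huu,
        show modelU k n * b * c = modelU k n * (b * c) by ring,
        show modelU k n * a * c = modelU k n * (a * c) by ring,
        D2 b0 c0, D2 a0 c0]
      simp only [mul_zero, zero_mul, map_zero, Units.neg_smul, one_smul]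
      ring
    · obtain ⟨a, a0, rfl⟩ := exists_modelU_mul_of_odd hi ha
      obtain ⟨b, b0, rfl⟩ := exists_modelU_mul_of_odd hj hb
      obtain ⟨c, c0, rfl⟩ := exists_modelU_mul_of_odd hl hc
      have e1 : Δ (modelU k n * a) * (modelU k n * b) * (modelU k n * c) = 0 := by
        rw [mul_assoc, huu, mul_zero]
      have e2 : modelU k n * a * Δ (modelU k n * b) * (modelU k n * c) = 0 := by
        rw [mul_assoc (modelU k n), huu]
      simp only [huu, e1, e2, map_zero, mul_zero, zero_mul, smul_zero, add_zero, sub_zero]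

end BV

/-! ### The operator on classes without `u` -/

section DeltaFormula

variable {k : Type*} [Field k] {n : ℕ}

/-- A cochain that vanishes on the words of length different from `p`. -/
def IsSupportedAt (p : ℕ) (f : WordFun (TruncPoly k n)) : Prop :=
  ∀ w : List (TruncPoly k n), w.length ≠ p → f w = 0

theorem isSupportedAt_one : IsSupportedAt 0 (1 : WordFun (TruncPoly k n)) := fun w hw => by
  cases w with
  | nil => simp at hw
  | cons a w => exact wone_cons a w

theorem isSupportedAt_cochU : IsSupportedAt 1 (cochU k n) := fun w hw => by
  match w with
  | [] => rfl
  | [a] => simp at hw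
  | a :: b :: w => rfl

theorem IsSupportedAt.cochT_mul {p : ℕ} {f : WordFun (TruncPoly k n)} (hf : IsSupportedAt p f) :
    IsSupportedAt (p + 2) (cochT k n * f) := fun w hw => by
  match w with
  | [] => exact ofBilin_mul_nil _ f
  | [a] => exact ofBilin_mul_single _ f a
  | a :: b :: w =>
    rw [cochT, ofBilin_mul_cons_cons, hf w (by simpa using hw), mul_zero]

theorem IsSupportedAt.cochT_pow_mul {p : ℕ} {f : WordFun (TruncPoly k n)} (hf : IsSupportedAt p f)
    (i : ℕ) : IsSupportedAt (2 * i + p) (cochT k n ^ i * f) := by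
  induction i with
  | zero => simpa using hf
  | succ i ih =>
    rw [pow_succ' (cochT k n) i, mul_assoc, show 2 * (i + 1) + p = 2 * i + p + 2 by ring]
    exact ih.cochT_mul

theorem isSupportedAt_cochT_pow (i : ℕ) : IsSupportedAt (2 * i) (cochT k n ^ i) := by
  simpa using isSupportedAt_one.cochT_pow_mul (k := k) (n := n) i

theorem IsSupportedAt.elem_smul {p : ℕ} {f : WordFun (TruncPoly k n)} (hf : IsSupportedAt p f)
    (a : TruncPoly k n) : IsSupportedAt p (a • f) := fun w hw => by
  rw [wsmul, hf w hw, smul_zero]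

theorem IsSupportedAt.contract {p : ℕ} {f : WordFun (TruncPoly k n)}
    (hf : IsSupportedAt (p + 2) f) : IsSupportedAt p (contract f) := fun w hw => by
  rw [Hochschild.contract]
  refine sum_eq_zero fun s _ => ?_
  rw [hf _ (by simpa using hw), mul_zero]

theorem IsSupportedAt.contract_iterate {p r : ℕ} {f : WordFun (TruncPoly k n)}
    (hf : IsSupportedAt (2 * r + p) f) : IsSupportedAt p (Hochschild.contract^[r] f) := by
  induction r generalizing f with
  | zero => simpa using hf
  | succ r ih =>
    rw [Function.iterate_succ_apply]
    refine ih (IsSupportedAt.contract ?_)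
    rwa [show 2 * r + p + 2 = 2 * (r + 1) + p by ring]

theorem IsSupportedAt.truncDeltaFun {p : ℕ} {f : WordFun (TruncPoly k n)}
    (hf : IsSupportedAt (p + 1) f) : IsSupportedAt p (truncDeltaFun k n f) := fun w hw => by
  rw [Hochschild.truncDeltaFun, deltaFun]
  refine sum_eq_zero fun j _ => ?_
  rw [sum_eq_zero, mul_zero, zero_smul]
  intro i _
  rw [hf _ (by simpa using hw), map_zero, mul_zero]

theorem HasDegree.contract_iterate {m d : ℤ} {f : WordFun (TruncPoly k n)}
    (hf : HasDegree k (truncDeg k n m) d f) (r : ℕ) :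
    HasDegree k (truncDeg k n m) (d - r * (2 * m * n + 2 * (m - 1)))
      (Hochschild.contract^[r] f) := by
  induction r generalizing f d with
  | zero => simpa using hf
  | succ r ih =>
    rw [Function.iterate_succ_apply]
    have := ih hf.contract
    convert this using 1
    push_cast
    ring

theorem coe_contractCocycle_iterate (z : cocycles k (TruncPoly k n)) (r : ℕ) :
    ((contractCocycle^[r] z : cocycles k (TruncPoly k n)) : WordFun (TruncPoly k n))
      = contract^[r] (z : WordFun (TruncPoly k n)) := by
  induction r generalizing z with
  | zero => rfl
  | succ r ih =>
    rw [Function.iterate_succ_apply, Function.iterate_succ_apply, ih]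
    rfl

/-- On cocycles of length at least two, the first two terms of `hh_decomposition` vanish. -/
theorem mk_eq_hhT_pow_mul [CharZero k] {r p : ℕ} (z : cocycles k (TruncPoly k n))
    (hz : IsSupportedAt (2 * r + p) (z : WordFun (TruncPoly k n))) :
    (Ideal.Quotient.mk _ z : HH k (TruncPoly k n)) =
      hhT k n ^ r * Ideal.Quotient.mk _ (contractCocycle^[r] z) := by
  induction r generalizing z with
  | zero => simp
  | succ r ih =>
    have h2 : IsSupportedAt (2 * r + p + 2) (z : WordFun (TruncPoly k n)) := by
      rwa [show 2 * r + p + 2 = 2 * (r + 1) + p by ring]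
    have := ih (contractCocycle z) h2.contract
    rw [hh_decomposition, hz [] (by simp; lia), hz [gen k n] (by simp; lia), map_zero, map_zero,
      map_zero, mul_zero, zero_add, zero_add, this, ← mul_assoc, ← pow_succ',
      Function.iterate_succ_apply]

theorem mk_eq_of_isSupportedAt_one [CharZero k] (z : cocycles k (TruncPoly k n))
    (hz : IsSupportedAt 1 (z : WordFun (TruncPoly k n))) :
    (Ideal.Quotient.mk _ z : HH k (TruncPoly k n)) =
      hhU k n * hhConst k n (shift k n ((z : WordFun (TruncPoly k n)) [gen k n])) := by
  have : contractCocycle z = 0 := Subtype.ext (funext fun w => by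
    change contract (z : WordFun (TruncPoly k n)) w = 0
    rw [contract]
    exact sum_eq_zero fun s _ => by rw [hz _ (by simp), mul_zero])
  rw [hh_decomposition, this, hz [] (by simp), map_zero, map_zero, mul_zero, zero_add, add_zero]

theorem mk_eq_of_isSupportedAt_zero [CharZero k] (z : cocycles k (TruncPoly k n))
    (hz : IsSupportedAt 0 (z : WordFun (TruncPoly k n))) :
    (Ideal.Quotient.mk _ z : HH k (TruncPoly k n)) =
      hhConst k n ((z : WordFun (TruncPoly k n)) []) := by
  have : contractCocycle z = 0 := Subtype.ext (funext fun w => by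
    change contract (z : WordFun (TruncPoly k n)) w = 0
    rw [contract]
    exact sum_eq_zero fun s _ => by rw [hz _ (by simp), mul_zero])
  rw [hh_decomposition, this, hz [gen k n] (by simp), map_zero, map_zero, map_zero, mul_zero,
    mul_zero, add_zero, add_zero]

theorem hhT_pow_mul_hhConst [CharZero k] {i l : ℕ} (h : n < l ∨ n ≤ l ∧ 0 < i) :
    hhT k n ^ i * hhConst k n (gen k n ^ l) = 0 := by
  rcases h with h | ⟨h, hi⟩
  · rw [gen_pow_eq_zero k n h, map_zero, mul_zero]
  · obtain ⟨i, rfl⟩ := Nat.exists_eq_add_of_le' hi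
    obtain ⟨l, rfl⟩ := Nat.exists_eq_add_of_le h
    rw [pow_succ (hhT k n) i, pow_add (gen k n) n l, map_mul, mul_assoc, ← mul_assoc (hhT k n),
      hhT_mul_hhConst, zero_mul, mul_zero]

theorem hhU_mul_hhConst_of_le {l : ℕ} (h : n ≤ l) : hhU k n * hhConst k n (gen k n ^ l) = 0 := by
  obtain ⟨l, rfl⟩ := Nat.exists_eq_add_of_le h
  rw [pow_add (gen k n) n l, map_mul, ← mul_assoc, hhU_mul_hhConst, zero_mul]

theorem hasDegree_cochT_pow_mul {m d : ℤ} {f : WordFun (TruncPoly k n)}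
    (hf : HasDegree k (truncDeg k n m) d f) (i : ℕ) :
    HasDegree k (truncDeg k n m) (i * (2 * m * n + 2 * (m - 1)) + d) (cochT k n ^ i * f) := by
  induction i with
  | zero => simpa using hf
  | succ i ih =>
    rw [pow_succ' (cochT k n) i, mul_assoc (cochT k n)]
    have := hasDegree_cochT.mul ih
    convert this using 1
    push_cast
    ring

theorem coe_cocycleT_pow_mul (i : ℕ) (z : cocycles k (TruncPoly k n)) :
    ((cocycleT k n ^ i * z : cocycles k (TruncPoly k n)) : WordFun (TruncPoly k n))
      = cochT k n ^ i * (z : WordFun (TruncPoly k n)) := rfl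

/-- The elements `t ^ i x ^ l` lie in the kernel of `Δ`: for `l < n`, the class `Δ (t ^ i x ^ l)`
would be a multiple of `t ^ (i - 1) u x ^ (l - n - 1)`. -/
theorem hhDelta_hhT_pow_mul [CharZero k] (i l : ℕ) :
    hhDelta k n (hhT k n ^ i * hhConst k n (gen k n ^ l)) = 0 := by
  set z := cocycleT k n ^ i * constCocycle k n (gen k n ^ l) with hz
  have hz' : (z : WordFun (TruncPoly k n))
      = cochT k n ^ i * (gen k n ^ l • (1 : WordFun (TruncPoly k n))) := by
    rw [hz, coe_cocycleT_pow_mul, coe_constCocycle]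
  have hmk : hhT k n ^ i * hhConst k n (gen k n ^ l) = Ideal.Quotient.mk _ z := by
    rw [hz, map_mul (Ideal.Quotient.mk _), map_pow (Ideal.Quotient.mk _)]; rfl
  have hs : IsSupportedAt (2 * i + 0) (z : WordFun (TruncPoly k n)) := by
    rw [hz']
    exact (isSupportedAt_one.elem_smul _).cochT_pow_mul i
  rcases Nat.eq_zero_or_pos i with rfl | hi
  · have : cocycleDelta k n z = 0 := Subtype.ext (funext fun w => by
      change truncDeltaFun k n z w = 0
      rw [truncDeltaFun, deltaFun]
      refine sum_eq_zero fun j _ => ?_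
      rw [sum_eq_zero, mul_zero, zero_smul]
      intro r _
      rw [hs _ (by simp), map_zero, mul_zero])
    rw [hmk, hhDelta_mk, this, map_zero]
  by_cases hl : n ≤ l
  · rw [hhT_pow_mul_hhConst (.inr ⟨hl, hi⟩), map_zero]
  obtain ⟨i, rfl⟩ := Nat.exists_eq_add_of_le' hi
  have hF : IsSupportedAt (2 * i + 1)
      ((cocycleDelta k n z : cocycles k (TruncPoly k n)) : WordFun (TruncPoly k n)) :=
    IsSupportedAt.truncDeltaFun hs
  -- `Δ` does not depend on `m`, and for `m = 1` the degree of `x ^ j` determines `j`.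
  have hd : HasDegree k (truncDeg k n 1)
      (((i + 1 : ℕ) * (2 * 1 * n + 2 * (1 - 1)) + (-2 * 1 * l)) + 1)
      ((cocycleDelta k n z : cocycles k (TruncPoly k n)) : WordFun (TruncPoly k n)) := by
    refine HasDegree.truncDeltaFun ?_
    rw [hz']
    exact hasDegree_cochT_pow_mul (hasDegree_smul_one (gen_pow_mem_truncDeg rfl)) _
  have hG := hd.contract_iterate i
  rw [← coe_contractCocycle_iterate] at hG
  have h1 : IsSupportedAt 1 ((contractCocycle^[i] (cocycleDelta k n z) :
      cocycles k (TruncPoly k n)) : WordFun (TruncPoly k n)) := by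
    rw [coe_contractCocycle_iterate]
    exact hF.contract_iterate
  have hx : gen k n ∈ truncDeg k n 1 (-2) := by
    simpa using gen_pow_mem_truncDeg (k := k) (n := n) (m := 1) (d := -2) (i := 1) (by simp)
  have hzero : ((contractCocycle^[i] (cocycleDelta k n z) : cocycles k (TruncPoly k n)) :
      WordFun (TruncPoly k n)) [gen k n] = 0 := by
    have := hG [gen k n] [-2] (.cons hx .nil)
    have h := map_mem_of_truncDeg (⊥ : Submodule k (TruncPoly k n)) LinearMap.id
      (fun j hj e => ?_) this
    · simpa using h
    · exfalso
      simp at e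
      have : 2 * ((n : ℤ) - l) = 2 * -j := by linear_combination e
      lia
  rw [hmk, hhDelta_mk, mk_eq_hhT_pow_mul _ hF, mk_eq_of_isSupportedAt_one _ h1, hzero, map_zero,
    map_zero, mul_zero, mul_zero]

end DeltaFormula

/-! ### Sums over lists of exponents -/

section SumWords

variable {M : Type*} [AddCommMonoid M] (n : ℕ)

/-- The sum of `φ` over all lists of `i` numbers between `0` and `n`. -/
def sumLists : ℕ → (List ℕ → M) → M
  | 0, φ => φ []
  | i + 1, φ => sumLists i fun t => ∑ s ∈ range (n + 1), φ (s :: t)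

variable {n}

theorem sumLists_congr {i : ℕ} {φ ψ : List ℕ → M}
    (h : ∀ t : List ℕ, t.length = i → (∀ s ∈ t, s ≤ n) → φ t = ψ t) :
    sumLists n i φ = sumLists n i ψ := by
  induction i generalizing φ ψ with
  | zero => exact h [] rfl (by simp)
  | succ i ih =>
    refine ih fun t ht hs => sum_congr rfl fun s hsn => h _ (by simp [ht]) ?_
    rw [mem_range] at hsn
    simpa [Nat.lt_succ_iff.1 hsn] using hs

theorem sumLists_add (i : ℕ) (φ ψ : List ℕ → M) :
    sumLists n i (fun t => φ t + ψ t) = sumLists n i φ + sumLists n i ψ := by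
  induction i generalizing φ ψ with
  | zero => rfl
  | succ i ih => simp only [sumLists, sum_add_distrib, ih]

theorem sumLists_zero (i : ℕ) : sumLists n i (fun _ => (0 : M)) = 0 := by
  induction i with
  | zero => rfl
  | succ i ih => simpa [sumLists] using ih

theorem sumLists_sum {ι : Type*} (S : Finset ι) (i : ℕ) (φ : ι → List ℕ → M) :
    sumLists n i (fun t => ∑ r ∈ S, φ r t) = ∑ r ∈ S, sumLists n i (φ r) := by
  classical
  induction S using Finset.induction_on with
  | empty => simp [sumLists_zero]
  | insert a S ha ih => simp only [sum_insert ha, sumLists_add, ih]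

/-- A sum with `(n, …, n)` as the only list that contributes. -/
theorem sumLists_eq_single {q : ℕ} {φ : List ℕ → M}
    (h : ∀ t : List ℕ, t.length = q → (∀ s ∈ t, s ≤ n) → t ≠ List.replicate q n → φ t = 0) :
    sumLists n q φ = φ (List.replicate q n) := by
  induction q generalizing φ with
  | zero => rfl
  | succ q ih =>
    have hh : ∀ t : List ℕ, t.length = q → (∀ s ∈ t, s ≤ n) → ∀ s ∈ range (n + 1),
        (s ≠ n ∨ t ≠ List.replicate q n) → φ (s :: t) = 0 := by
      intro t ht hs s hsn hne
      rw [mem_range] at hsn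
      refine h _ (by simp [ht]) (by simpa [Nat.lt_succ_iff.1 hsn] using hs) ?_
      rw [List.replicate_succ]
      intro e
      rw [List.cons.injEq] at e
      tauto
    rw [sumLists, ih fun t ht hs hne => sum_eq_zero fun s hsn => hh t ht hs s hsn (.inr hne),
      List.replicate_succ, sum_eq_single_of_mem n (by simp) fun s hs hne =>
        hh _ (by simp) (fun s hs => (List.eq_of_mem_replicate hs).le) s hs (.inl hne)]

/-- A sum to which only the lists `(n, …, n, c, n, …, n)` contribute, with `c` preceded by `p` and
followed by `q` entries. -/
theorem sumLists_eq_sum {p q : ℕ} {φ : List ℕ → M}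
    (h : ∀ (t₁ t₂ : List ℕ) (c : ℕ), t₁.length = p → t₂.length = q → (∀ s ∈ t₁, s ≤ n) →
      (∀ s ∈ t₂, s ≤ n) → c ≤ n → t₁ ≠ List.replicate p n ∨ t₂ ≠ List.replicate q n →
      φ (t₁ ++ c :: t₂) = 0) :
    sumLists n (p + 1 + q) φ = ∑ c ∈ range (n + 1),
      φ (List.replicate p n ++ c :: List.replicate q n) := by
  induction p generalizing φ with
  | zero =>
    rw [Nat.zero_add, Nat.add_comm, sumLists, sumLists_eq_single]
    · simp
    · intro t ht hs hne
      refine sum_eq_zero fun c hc => ?_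
      rw [mem_range] at hc
      exact h [] t c rfl ht (by simp) hs (by lia) (.inr hne)
  | succ p ih =>
    have hp : p + 1 + 1 + q = p + 1 + q + 1 := by ring
    rw [hp, sumLists, ← sumLists_congr (φ := fun t => φ (n :: t)), ih]
    · simp [List.replicate_succ]
    · intro t₁ t₂ c h1 h2 h3 h4 hc hne
      refine h (n :: t₁) t₂ c (by simp [h1]) h2 (by simpa using h3) h4 hc (hne.imp_left ?_)
      intro hne e
      rw [List.replicate_succ, List.cons.injEq] at e
      exact hne e.2
    · intro t ht hs
      rw [sum_eq_single_of_mem n (by simp)]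
      intro s hsn hne
      rw [mem_range] at hsn
      have hpl : p < t.length := by lia
      have e : t = t.take p ++ t[p] :: t.drop (p + 1) := by
        rw [List.getElem_cons_drop, List.take_append_drop]
      rw [e]
      refine h (s :: t.take p) (t.drop (p + 1)) t[p] (by simp; lia) (by simp; lia) ?_ ?_
        (hs _ (List.getElem_mem hpl)) (.inl ?_)
      · intro a ha
        rcases List.mem_cons.1 ha with rfl | ha
        · lia
        · exact hs _ (List.mem_of_mem_take ha)
      · exact fun a ha => hs _ (List.mem_of_mem_drop ha)
      · rw [List.replicate_succ]
        intro e
        exact hne (List.cons.inj e).1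

theorem sum_range_odd (h : ℕ → M) (i : ℕ) : ∑ r ∈ range (2 * i + 1), h r
    = h 0 + ∑ r ∈ range i, (h (2 * r + 1) + h (2 * r + 2)) := by
  induction i with
  | zero => simp
  | succ i ih =>
    rw [show 2 * (i + 1) + 1 = 2 * i + 1 + 1 + 1 by ring, sum_range_succ, sum_range_succ, ih,
      sum_range_succ]
    simp only [add_assoc]

end SumWords

/-! ### Counting rotations -/

section Rotations

variable {k : Type*} [Field k] {n : ℕ}

variable (k n) in
/-- The word `[x, x ^ s₁, x, x ^ s₂, …]`. -/
noncomputable def xWord (t : List ℕ) : List (TruncPoly k n) :=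
  t.flatMap fun s => [gen k n, gen k n ^ s]

variable (k n) in
/-- The word `[x ^ s₁, x, x ^ s₂, x, …]`. -/
noncomputable def wordX (t : List ℕ) : List (TruncPoly k n) :=
  t.flatMap fun s => [gen k n ^ s, gen k n]

variable (n) in
/-- The exponent `∑ (n - s)`. -/
def defect (t : List ℕ) : ℕ := (t.map fun s => n - s).sum

theorem length_xWord (t : List ℕ) : (xWord k n t).length = 2 * t.length := by
  induction t with
  | nil => rfl
  | cons s t ih => simp only [xWord, List.flatMap_cons, List.length_append, List.length_cons,
      List.length_nil] at ih ⊢; lia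

theorem length_wordX (t : List ℕ) : (wordX k n t).length = 2 * t.length := by
  induction t with
  | nil => rfl
  | cons s t ih => simp only [wordX, List.flatMap_cons, List.length_append, List.length_cons,
      List.length_nil] at ih ⊢; lia

theorem xWord_append_single (t : List ℕ) (c : ℕ) :
    xWord k n (t ++ [c]) = gen k n :: (wordX k n t ++ [gen k n ^ c]) := by
  induction t with
  | nil => rfl
  | cons s t ih =>
    change gen k n :: gen k n ^ s :: xWord k n (t ++ [c]) = _
    rw [ih]
    rfl

theorem xWord_append (t t' : List ℕ) : xWord k n (t ++ t') = xWord k n t ++ xWord k n t' :=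
  List.flatMap_append

/-- The iterated contraction evaluates a cochain on the words `[x, x ^ s₁, x, x ^ s₂, …]`. -/
theorem topCoeff_contract_iterate (i : ℕ) (F : WordFun (TruncPoly k n)) (a : TruncPoly k n) :
    topCoeff k n (a * contract^[i] F []) = sumLists n i fun t =>
      topCoeff k n (a * gen k n ^ defect n t * F (xWord k n t)) := by
  induction i generalizing F with
  | zero => simp [sumLists, defect, xWord]
  | succ i ih =>
    rw [Function.iterate_succ_apply, ih, sumLists]
    congr 1
    funext t
    rw [contract, mul_sum, map_sum]
    refine sum_congr rfl fun s _ => congrArg _ ?_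
    have e1 : defect n (s :: t) = (n - s) + defect n t := by simp [defect]
    have e2 : xWord k n (s :: t) = gen k n :: gen k n ^ s :: xWord k n t := rfl
    rw [e1, e2, pow_add (gen k n) (n - s)]
    ring

theorem cochT_pow_xWord_replicate (hn : 0 < n) (p : ℕ) :
    (cochT k n ^ p) (xWord k n (List.replicate p n)) = 1 := by
  induction p with
  | zero => exact wone_nil
  | succ p ih =>
    rw [pow_succ' (cochT k n) p]
    refine (ofBilin_mul_cons_cons _ _ _ _ _).trans ?_
    rw [tBilin_x_gen_pow hn, one_mul]
    exact ih

theorem tBilin_gen_pow_x (hn : 0 < n) (s : ℕ) :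
    tBilin k n (gen k n ^ s) (gen k n) = if s = n then 1 else 0 := by
  by_cases h : s ≤ n
  · have := tBilin_gen k (n := n) (i := s) (j := 1) h hn
    rw [pow_one] at this
    rw [this, tau]
    by_cases hs : s = n
    · subst hs
      simp
    · rw [if_neg (by lia), if_neg hs]
  · have := tBilin_gen_left k (n := n) (i := s) (j := 1) (by lia)
    rw [pow_one] at this
    rw [this, if_neg (by lia)]

theorem cochT_pow_wordX_replicate (hn : 0 < n) (p : ℕ) :
    (cochT k n ^ p) (wordX k n (List.replicate p n)) = 1 := by
  induction p with
  | zero => exact wone_nil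
  | succ p ih =>
    rw [pow_succ' (cochT k n) p]
    refine (ofBilin_mul_cons_cons _ _ _ _ _).trans ?_
    rw [tBilin_gen_pow_x hn, if_pos rfl, one_mul]
    exact ih

theorem cochT_pow_xWord_eq_zero (hn : 0 < n) {p : ℕ} {t : List ℕ} (ht : t.length = p)
    (h : t ≠ List.replicate p n) : (cochT k n ^ p) (xWord k n t) = 0 := by
  induction p generalizing t with
  | zero => exact absurd (List.length_eq_zero_iff.1 ht) h
  | succ p ih =>
    cases t with
    | nil => simp at ht
    | cons s t =>
      rw [pow_succ' (cochT k n) p]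
      refine (ofBilin_mul_cons_cons _ _ _ _ _).trans ?_
      change tBilin k n (gen k n) (gen k n ^ s) * (cochT k n ^ p) (xWord k n t) = 0
      by_cases hs : s = n
      · rw [ih (by simpa using ht) (by
          rintro rfl; exact h (by rw [hs, List.replicate_succ])), mul_zero]
      · rw [tBilin_x, if_neg hn.ne', coef_gen_pow k le_rfl, if_neg hs, map_zero, zero_mul]

theorem cochT_pow_wordX_eq_zero (hn : 0 < n) {p : ℕ} {t : List ℕ} (ht : t.length = p)
    (h : t ≠ List.replicate p n) : (cochT k n ^ p) (wordX k n t) = 0 := by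
  induction p generalizing t with
  | zero => exact absurd (List.length_eq_zero_iff.1 ht) h
  | succ p ih =>
    cases t with
    | nil => simp at ht
    | cons s t =>
      rw [pow_succ' (cochT k n) p]
      refine (ofBilin_mul_cons_cons _ _ _ _ _).trans ?_
      change tBilin k n (gen k n ^ s) (gen k n) * (cochT k n ^ p) (wordX k n t) = 0
      by_cases hs : s = n
      · rw [ih (by simpa using ht) (by
          rintro rfl; exact h (by rw [hs, List.replicate_succ])), mul_zero]
      · rw [tBilin_gen_pow_x hn, if_neg hs, zero_mul]

theorem cochT_pow_mul_append (f : WordFun (TruncPoly k n)) {i : ℕ} {u : List (TruncPoly k n)}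
    (hu : u.length = 2 * i) (v : List (TruncPoly k n)) :
    (cochT k n ^ i * f) (u ++ v) = (cochT k n ^ i) u * f v :=
  mul_append f (fun l hl => isSupportedAt_cochT_pow i l (hu ▸ hl)) v

theorem cochT_pow_mul_cochU_split (p q : ℕ) : cochT k n ^ (p + 1 + q) * cochU k n
    = cochT k n ^ q * (cochT k n * (cochT k n ^ p * cochU k n)) := by
  rw [show p + 1 + q = q + 1 + p by ring, pow_add (cochT k n) (q + 1) p,
    pow_succ (cochT k n) q]
  simp only [mul_assoc]

theorem defect_replicate (q : ℕ) : defect n (List.replicate q n) = 0 := by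
  simp [defect]

theorem defect_replicate_append (p q c : ℕ) :
    defect n (List.replicate p n ++ c :: List.replicate q n) = n - c := by
  simp [defect]

variable {l : ℕ}

/-- In this rotation the first letter is evaluated by `U`, and only the list `(n, …, n)`
contributes. -/
theorem sumLists_rotation_one (hl : l < n) (i : ℕ) :
    sumLists n i (fun t => topCoeff k n ((gen k n ^ l • (cochT k n ^ i * cochU k n))
      ((gen k n ^ (n - l + defect n t) :: xWord k n t).rotate 1))) = (n : k) - l := by
  have hn : 0 < n := by lia
  have e : ∀ t : List ℕ, t.length = i → (cochT k n ^ i * cochU k n)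
      ((gen k n ^ (n - l + defect n t) :: xWord k n t).rotate 1)
      = (cochT k n ^ i) (xWord k n t) * euler k n (gen k n ^ (n - l + defect n t)) := by
    intro t ht
    rw [List.rotate_cons_succ, List.rotate_zero,
      cochT_pow_mul_append _ (by rw [length_xWord, ht])]
    rfl
  rw [sumLists_eq_single]
  · rw [wsmul, e _ (by simp), cochT_pow_xWord_replicate hn, defect_replicate, euler_gen, one_mul,
      add_zero, smul_eq_mul, mul_smul_comm, ← pow_add, map_smul, topCoeff_gen_pow,
      if_pos (by lia), smul_eq_mul, mul_one, Nat.cast_sub hl.le]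
  · intro t ht _ hne
    rw [wsmul, e t ht, cochT_pow_xWord_eq_zero hn ht hne, zero_mul, smul_zero, map_zero]

/-- In this rotation `U` is evaluated at `x ^ c` for an entry `c` of the list, and the first letter
is paired with `x` by `T`.  The other entries have to be `n`, and the first letter
`x ^ (2 n - l - c)` has to be `x ^ n`, whence `c = n - l`. -/
theorem sumLists_rotation_odd (hl : l < n) (p q : ℕ) :
    sumLists n (p + 1 + q) (fun t => topCoeff k n
      ((gen k n ^ l • (cochT k n ^ (p + 1 + q) * cochU k n))
        ((gen k n ^ (n - l + defect n t) :: xWord k n t).rotate (2 * p + 3)))) = (n : k) - l := by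
  have hn : 0 < n := by lia
  have e : ∀ (t₁ t₂ : List ℕ) (c r : ℕ), t₁.length = p → t₂.length = q →
      (cochT k n ^ (p + 1 + q) * cochU k n)
      ((gen k n ^ r :: xWord k n (t₁ ++ c :: t₂)).rotate (2 * p + 3))
      = (cochT k n ^ q) (xWord k n t₂) * (tBilin k n (gen k n ^ r) (gen k n) *
        ((cochT k n ^ p) (wordX k n t₁) * euler k n (gen k n ^ c))) := by
    intro t₁ t₂ c r h1 h2
    have e1 : gen k n ^ r :: xWord k n (t₁ ++ c :: t₂)
        = (gen k n ^ r :: xWord k n (t₁ ++ [c])) ++ xWord k n t₂ := by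
      rw [List.cons_append, ← xWord_append, List.append_assoc]
      rfl
    have e2 : 2 * p + 3 = (gen k n ^ r :: xWord k n (t₁ ++ [c])).length := by
      simp [length_xWord, h1]; ring
    rw [e1, e2, List.rotate_append_length_eq, cochT_pow_mul_cochU_split,
      cochT_pow_mul_append _ (by rw [length_xWord, h2]), xWord_append_single]
    congr 1
    refine (ofBilin_mul_cons_cons _ _ _ _ _).trans ?_
    congr 1
    exact cochT_pow_mul_append _ (by rw [length_wordX, h1]) _
  rw [sumLists_eq_sum]
  · have e3 : ∀ c ∈ range (n + 1),
        topCoeff k n ((gen k n ^ l • (cochT k n ^ (p + 1 + q) * cochU k n))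
        ((gen k n ^ (n - l + defect n (List.replicate p n ++ c :: List.replicate q n)) ::
          xWord k n (List.replicate p n ++ c :: List.replicate q n)).rotate (2 * p + 3)))
        = if c = n - l then (n : k) - l else 0 := by
      intro c hc
      rw [mem_range] at hc
      rw [wsmul, e _ _ _ _ (by simp) (by simp), cochT_pow_xWord_replicate hn,
        cochT_pow_wordX_replicate hn, defect_replicate_append, tBilin_gen_pow_x hn, euler_gen,
        one_mul, one_mul]
      by_cases h : c = n - l
      · subst h
        rw [if_pos (by lia), if_pos rfl, one_mul, smul_eq_mul, mul_smul_comm, ← pow_add, map_smul,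
          topCoeff_gen_pow, if_pos (by lia), smul_eq_mul, mul_one, Nat.cast_sub hl.le]
      · rw [if_neg (by lia), if_neg h, zero_mul, smul_zero, map_zero]
    rw [sum_congr rfl e3, sum_ite_eq' (range (n + 1)) (n - l), if_pos (by simp)]
  · intro t₁ t₂ c h1 h2 _ _ _ hne
    rw [wsmul, e _ _ _ _ h1 h2]
    rcases hne with hne | hne
    · rw [cochT_pow_wordX_eq_zero hn h1 hne, zero_mul, mul_zero, mul_zero, smul_zero, map_zero]
    · rw [cochT_pow_xWord_eq_zero hn h2 hne, zero_mul, smul_zero, map_zero]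

/-- In this rotation `U` is evaluated at `x`, and the first letter is paired by `T` with `x ^ c` for
the last entry `c` of the list.  The other entries have to be `n`, the first letter is
`x ^ (2 n - l - c)`, and each of the `l + 1` values `c ≥ n - l` contributes `1`. -/
theorem sumLists_rotation_even (hl : l < n) (p q : ℕ) :
    sumLists n (p + 1 + q) (fun t => topCoeff k n
      ((gen k n ^ l • (cochT k n ^ (p + 1 + q) * cochU k n))
        ((gen k n ^ (n - l + defect n t) :: xWord k n t).rotate (2 * p + 2)))) = (l : k) + 1 := by
  have hn : 0 < n := by lia
  have e : ∀ (t : List ℕ) (c r : ℕ), t.length = p + q →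
      (cochT k n ^ (p + 1 + q) * cochU k n)
      ((gen k n ^ r :: xWord k n (t ++ [c])).rotate (2 * p + 2))
      = (cochT k n ^ q) (wordX k n (t.drop p)) * (tBilin k n (gen k n ^ c) (gen k n ^ r) *
        ((cochT k n ^ p) (xWord k n (t.take p)) * gen k n)) := by
    intro t c r h
    have e1 : gen k n ^ r :: xWord k n (t ++ [c])
        = (gen k n ^ r :: (xWord k n (t.take p) ++ [gen k n])) ++
          (wordX k n (t.drop p) ++ [gen k n ^ c]) := by
      conv_lhs => rw [← List.take_append_drop p t]
      rw [List.append_assoc, xWord_append, xWord_append_single]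
      simp
    have e2 : 2 * p + 2 = (gen k n ^ r :: (xWord k n (t.take p) ++ [gen k n])).length := by
      simp [length_xWord, h]
    rw [e1, e2, List.rotate_append_length_eq, cochT_pow_mul_cochU_split, List.append_assoc,
      cochT_pow_mul_append _ (by rw [length_wordX, List.length_drop]; lia)]
    congr 1
    refine (ofBilin_mul_cons_cons _ _ _ _ _).trans ?_
    congr 1
    rw [cochT_pow_mul_append _ (by rw [length_xWord, List.length_take]; lia)]
    congr 1
    simpa [cochU, ofLin] using euler_gen k (n := n) 1
  rw [show sumLists n (p + 1 + q) = sumLists (M := k) n (p + q + 1 + 0) by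
    rw [show p + 1 + q = p + q + 1 + 0 by ring], sumLists_eq_sum]
  · have e3 : ∀ c ∈ range (n + 1),
        topCoeff k n ((gen k n ^ l • (cochT k n ^ (p + 1 + q) * cochU k n))
        ((gen k n ^ (n - l + defect n (List.replicate (p + q) n ++ c :: List.replicate 0 n)) ::
          xWord k n (List.replicate (p + q) n ++ c :: List.replicate 0 n)).rotate (2 * p + 2)))
        = if n - l ≤ c then 1 else 0 := by
      intro c hc
      rw [mem_range] at hc
      rw [wsmul, defect_replicate_append, List.replicate_zero, e _ _ _ (by simp),
        List.drop_replicate, List.take_replicate, Nat.add_sub_cancel_left,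
        Nat.min_eq_left (by lia), cochT_pow_xWord_replicate hn, cochT_pow_wordX_replicate hn,
        one_mul, one_mul]
      by_cases h : n - l ≤ c
      · rw [tBilin_gen k (by lia) (by lia), tau, if_pos (by lia), if_pos h, smul_eq_mul,
          ← pow_succ, ← pow_add, topCoeff_gen_pow, if_pos (by lia)]
      · rw [tBilin_gen_right k (by lia), if_neg h, zero_mul, smul_zero, map_zero]
    rw [sum_congr rfl e3, ← sum_filter, sum_const, nsmul_eq_mul, mul_one]
    have : (range (n + 1)).filter (fun c => n - l ≤ c) = Finset.Ico (n - l) (n + 1) := by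
      ext c
      simp only [mem_filter, mem_range, mem_Ico]
      tauto
    rw [this, Nat.card_Ico, show n + 1 - (n - l) = l + 1 by lia, Nat.cast_succ]
  · intro t t₂ c h1 h2 _ _ _ hne
    obtain rfl := List.length_eq_zero_iff.1 h2
    rw [wsmul, e _ _ _ h1]
    have hne' : t ≠ List.replicate (p + q) n := by simpa using hne
    by_cases h : t.take p = List.replicate p n
    · have h' : t.drop p ≠ List.replicate q n := fun h' => hne' (by
        rw [← List.take_append_drop p t, h, h', List.replicate_append_replicate])
      rw [cochT_pow_wordX_eq_zero hn (by simp [h1]) h', zero_mul, smul_zero, map_zero]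
    · rw [cochT_pow_xWord_eq_zero hn (by simp [h1]) h, zero_mul, mul_zero, mul_zero, smul_zero,
        map_zero]

/-- The coefficient of `x ^ l` in the contraction of `Δ (T ^ i U x ^ l)`.  Of the `2 i + 1`
rotations, one contributes `n - l`, and the others contribute `l + 1` and `n - l` alternately. -/
theorem coef_contract_iterate_delta (hl : l < n) (i : ℕ) :
    coef k n l (contract^[i] (truncDeltaFun k n (gen k n ^ l • (cochT k n ^ i * cochU k n))) [])
      = -((i : k) + 1) * n - i + l := by
  set f := gen k n ^ l • (cochT k n ^ i * cochU k n) with hf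
  have hfc : IsLin k f := by
    have : IsCochain k (cochT k n ^ i * cochU k n) :=
      (cocycleT k n ^ i * cocycleU k n : cocycles k (TruncPoly k n)).2.1
    exact (this.elem_smul _).isLin
  have hterm : ∀ t : List ℕ, t.length = i →
      topCoeff k n (gen k n ^ (n - l) * gen k n ^ defect n t * truncDeltaFun k n f (xWord k n t))
      = -(topCoeff k n (f ((gen k n ^ (n - l + defect n t) :: xWord k n t).rotate 1))
        + ∑ p ∈ range i,
          (topCoeff k n (f ((gen k n ^ (n - l + defect n t) :: xWord k n t).rotate (2 * p + 2)))
          + topCoeff k n (f ((gen k n ^ (n - l + defect n t) :: xWord k n t).rotate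
            (2 * p + 3))))) := by
    intro t ht
    rw [← pow_add, truncDeltaFun, eps_deltaFun _ _ _ (topCoeff_expand k n) hfc, length_xWord, ht]
    set w := gen k n ^ (n - l + defect n t) :: xWord k n t with hw
    have hlen : w.length = 2 * i + 1 := by rw [hw, List.length_cons, length_xWord, ht]
    -- One of `r` and `2 i + 1 - r` is even, so the signs of the rotations are all `1`.
    have hsign : ∀ r ∈ range (2 * i + 1), (-1 : k) ^ (r * (2 * i + 1 - r))
        * topCoeff k n (f (w.rotate r)) = topCoeff k n (f (w.rotate r)) := by
      intro r hr
      rw [mem_range] at hr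
      have : Even (r * (2 * i + 1 - r)) := by
        rcases Nat.even_or_odd r with h | h
        · exact h.mul_right _
        · refine Even.mul_left ?_ r
          obtain ⟨c, rfl⟩ := h
          exact ⟨i - c, by lia⟩
      rw [this.neg_one_pow, one_mul]
    have hodd : (-1 : k) ^ (2 * i + 1) = -1 := (odd_two_mul_add_one i).neg_one_pow
    rw [sum_congr rfl hsign, hodd, neg_one_mul,
      -- The sum over all rotations is rearranged so that it starts with `rotate 1`.
      ← sum_shift (fun r => topCoeff k n (f (w.rotate r))) (fun r => by
        rw [← List.rotate_mod, hlen, Nat.add_mod_right, ← hlen, List.rotate_mod]) 1,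
      sum_range_odd]
  rw [coef, LinearMap.comp_apply, LinearMap.mulRight_apply, mul_comm, topCoeff_contract_iterate,
    sumLists_congr fun t ht _ => hterm t ht]
  have hneg : ∀ (j : ℕ) (φ : List ℕ → k), sumLists n j (fun t => -φ t) = -sumLists n j φ := by
    intro j
    induction j with
    | zero => exact fun φ => rfl
    | succ j ih => intro φ; simp only [sumLists, sum_neg_distrib, ih]
  rw [hneg, sumLists_add, sumLists_sum, sumLists_rotation_one hl]
  have hp : ∀ p ∈ range i, sumLists n i (fun t =>
      topCoeff k n (f ((gen k n ^ (n - l + defect n t) :: xWord k n t).rotate (2 * p + 2)))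
      + topCoeff k n (f ((gen k n ^ (n - l + defect n t) :: xWord k n t).rotate (2 * p + 3))))
      = ((l : k) + 1) + (n - l) := by
    intro p hp
    rw [mem_range] at hp
    obtain ⟨q, rfl⟩ : ∃ q, i = p + 1 + q := ⟨i - (p + 1), by lia⟩
    rw [sumLists_add, sumLists_rotation_even hl, sumLists_rotation_odd hl]
  rw [sum_congr rfl hp, sum_const, card_range, nsmul_eq_mul]
  ring

/-- The class `Δ (t ^ i u x ^ l)` has length `2 i`, so it is the product of `t ^ i` with an iterated
contraction, which is a multiple of `x ^ l` for degree reasons. -/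
theorem hhDelta_hhT_pow_mul_hhU [CharZero k] (i l : ℕ) :
    hhDelta k n (hhT k n ^ i * hhU k n * hhConst k n (gen k n ^ l))
      = (-((i : k) + 1) * n - i + l) • (hhT k n ^ i * hhConst k n (gen k n ^ l)) := by
  by_cases hl : n ≤ l
  · rw [mul_assoc, hhU_mul_hhConst_of_le hl, mul_zero, map_zero]
    by_cases h : n < l ∨ n ≤ l ∧ 0 < i
    · rw [hhT_pow_mul_hhConst h, smul_zero]
    · obtain ⟨rfl, rfl⟩ : i = 0 ∧ l = n := by lia
      rw [show -(((0 : ℕ) : k) + 1) * l - ((0 : ℕ) : k) + l = 0 by push_cast; ring, zero_smul]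
  push Not at hl
  set z := cocycleT k n ^ i * cocycleU k n * constCocycle k n (gen k n ^ l) with hz
  have hz' : (z : WordFun (TruncPoly k n)) = gen k n ^ l • (cochT k n ^ i * cochU k n) := by
    rw [hz, Subalgebra.coe_mul, coe_constCocycle, mul_smul_comm, mul_one]
    rfl
  have hz'' : (z : WordFun (TruncPoly k n)) = cochT k n ^ i *
      (cochU k n * (gen k n ^ l • (1 : WordFun (TruncPoly k n)))) := by
    rw [hz', mul_smul_comm, mul_one, mul_smul_comm]
  have hmk : hhT k n ^ i * hhU k n * hhConst k n (gen k n ^ l) = Ideal.Quotient.mk _ z := by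
    rw [hz, map_mul (Ideal.Quotient.mk _), map_mul (Ideal.Quotient.mk _),
      map_pow (Ideal.Quotient.mk _)]; rfl
  have hF : IsSupportedAt (2 * i + 0)
      ((cocycleDelta k n z : cocycles k (TruncPoly k n)) : WordFun (TruncPoly k n)) := by
    refine IsSupportedAt.truncDeltaFun ?_
    rw [hz']
    exact (isSupportedAt_cochU.cochT_pow_mul i).elem_smul _
  have h0 : IsSupportedAt 0 ((contractCocycle^[i] (cocycleDelta k n z) :
      cocycles k (TruncPoly k n)) : WordFun (TruncPoly k n)) := by
    rw [coe_contractCocycle_iterate]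
    exact hF.contract_iterate
  -- `Δ` does not depend on `m`, and for `m = 1` the degree of `x ^ j` determines `j`.
  have hd : HasDegree k (truncDeg k n 1)
      ((i * (2 * 1 * n + 2 * (1 - 1)) + (-1 + -2 * 1 * l)) + 1)
      ((cocycleDelta k n z : cocycles k (TruncPoly k n)) : WordFun (TruncPoly k n)) := by
    refine HasDegree.truncDeltaFun ?_
    rw [hz'']
    exact hasDegree_cochT_pow_mul (hasDegree_cochU.mul
      (hasDegree_smul_one (gen_pow_mem_truncDeg rfl))) _
  have hy := hd.contract_iterate i [] [] .nil
  set y := contract^[i] ((cocycleDelta k n z : cocycles k (TruncPoly k n)) :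
    WordFun (TruncPoly k n)) [] with hy_def
  have hyl : y - coef k n l y • gen k n ^ l ∈ (⊥ : Submodule k (TruncPoly k n)) := by
    refine map_mem_of_truncDeg _ (LinearMap.id - (coef k n l).smulRight (gen k n ^ l))
      (fun j hj e => ?_) hy
    obtain rfl : j = l := by
      simp at e
      have : 2 * (l : ℤ) = 2 * j := by linear_combination -e
      lia
    simp [coef_gen_pow k hj]
  rw [Submodule.mem_bot, sub_eq_zero] at hyl
  have hc : coef k n l y = -((i : k) + 1) * n - i + l := by
    rw [← coef_contract_iterate_delta hl i, ← hz']
    rfl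
  rw [hmk, hhDelta_mk, mk_eq_hhT_pow_mul _ hF, mk_eq_of_isSupportedAt_zero _ h0,
    coe_contractCocycle_iterate, ← hy_def, hyl, hc, map_smul, mul_smul_comm]

end Rotations

end Hochschild

/-! ### The Batalin–Vilkovisky structure on the Hochschild cohomology -/

theorem mainTheorem2 (k : Type*) [Field k] [CharZero k] (n : ℕ) (m : ℤ) :
    Hochschild.IsBVAlgebra (H := Hochschild.HH k (Hochschild.TruncPoly k n))
      (Hochschild.HHdeg k (Hochschild.truncDeg k n m))
      (Hochschild.hhDelta k n) ∧
    ∃ Φ : Hochschild.Model k n ≃ₐ[k] Hochschild.HH k (Hochschild.TruncPoly k n),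
      (∀ d : ℤ, (Hochschild.modelDeg k n m d).map Φ.toLinearMap
        = Hochschild.HHdeg k (Hochschild.truncDeg k n m) d) ∧
      (∀ i l : ℕ, Hochschild.hhDelta k n
        (Φ (Hochschild.modelT k n ^ i * Hochschild.modelX k n ^ l)) = 0) ∧
      (∀ i l : ℕ, Hochschild.hhDelta k n
        (Φ (Hochschild.modelT k n ^ i * Hochschild.modelU k n * Hochschild.modelX k n ^ l))
        = (-((i : k) + 1) * n - i + l) •
          Φ (Hochschild.modelT k n ^ i * Hochschild.modelX k n ^ l)) := by
  obtain ⟨Φ, hX, hU, hT⟩ := Hochschild.exists_modelEquiv k n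
  have hTX : ∀ i l : ℕ, Φ (Hochschild.modelT k n ^ i * Hochschild.modelX k n ^ l)
      = Hochschild.hhT k n ^ i * Hochschild.hhConst k n (Hochschild.gen k n ^ l) := fun i l => by
    rw [map_mul, map_pow, map_pow, hX, hT, map_pow (Hochschild.hhConst k n)]
  have hTUX : ∀ i l : ℕ,
      Φ (Hochschild.modelT k n ^ i * Hochschild.modelU k n * Hochschild.modelX k n ^ l)
      = Hochschild.hhT k n ^ i * Hochschild.hhU k n
        * Hochschild.hhConst k n (Hochschild.gen k n ^ l) := fun i l => by
    rw [map_mul, map_mul, map_pow, map_pow, hX, hT, hU, map_pow (Hochschild.hhConst k n)]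
  have h0 : ∀ i l : ℕ, Hochschild.hhDelta k n
      (Φ (Hochschild.modelT k n ^ i * Hochschild.modelX k n ^ l)) = 0 := fun i l => by
    rw [hTX]
    exact Hochschild.hhDelta_hhT_pow_mul i l
  have h1 : ∀ i l : ℕ, Hochschild.hhDelta k n
      (Φ (Hochschild.modelT k n ^ i * Hochschild.modelU k n * Hochschild.modelX k n ^ l))
      = (-((i : k) + 1) * n - i + l) •
        Φ (Hochschild.modelT k n ^ i * Hochschild.modelX k n ^ l) := fun i l => by
    rw [hTUX, hTX]
    exact Hochschild.hhDelta_hhT_pow_mul_hhU i l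
  have hdeg := Hochschild.map_modelDeg (m := m) Φ hX hU hT
  refine ⟨?_, Φ, hdeg, h0, h1⟩
  refine (Hochschild.isBVAlgebra_model
    (Δ := Φ.symm.toLinearMap ∘ₗ Hochschild.hhDelta k n ∘ₗ Φ.toLinearMap) ?_ ?_ m).map Φ hdeg
    fun a => ?_
  · intro i l
    change Φ.symm (Hochschild.hhDelta k n (Φ _)) = _
    rw [h0, map_zero]
  · intro i l
    change Φ.symm (Hochschild.hhDelta k n (Φ _)) = _
    rw [h1, map_smul, AlgEquiv.symm_apply_apply]
  · exact (Φ.apply_symm_apply _).symm
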